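/- Let $Y$ be a toric manifold, written as a symplectic quotient $Y=\{z\in\mathbb{C}^N : \mu_K(z)=a\}/K$, where $K\subset T^N$ is a subtorus, $\mu_K$ is its moment map, and $K$ acts freely on the level set. Let $T^n=T^N/K$ be the residual torus, with Lie algebra $\mathfrak{t}^n$, and let $v_j\in\mathfrak{t}^n$ be the image of the $j$-th standard basis vector of $\mathbb{Z}^N$, so that $v_j$ is the primitive normal vector of the toric divisor $D_j=\{z_j=0\}$ whenever $D_j\neq\emptyset$. Let $T^k\subset T^n$ be a subtorus with Lie algebra $\mathfrak{t}^k$ and moment map $\mu:Y\to(\mathfrak{t}^k)^*$, acting freely on $\mu^{-1}(c)$. Let $X=\mu^{-1}(c)/T^k$, and let $L^\pi=\{(y,[y]) : y\in\mu^{-1}(c)\}\subset Y^-\times X$, where $Y^-=(Y,-\omega_Y)$. Let $B$ be an open toric stratum of $Y$ with $B\cap\mu^{-1}(c)\neq\emptyset$, and let $D_i$ be a toric divisor with $\overline B\not\subset D_i$ and $\overline B\cap D_i\neq\emptyset$. Suppose that the basic disc class $\beta_i$ of $\overline B$ (the class of discs that are bounded by a $T^n$-orbit $F\subset B\cap \mu^{-1}(c)$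 and meet $D_i$ once, with multiplicity one, and no other toric divisor of $\overline B$) is represented by a disc $u$ whose boundary lies in a single $T^k$-orbit, that is, over a single point $x\in X$. Let $\beta_i^B$ be the class of discs in $Y^-\times X$ bounded by $L^\pi$ that is represented by $\zeta\mapsto(u(\bar\zeta),x)$, which is constant in the $X$ factor. Then there are a unique vector $v$ and unique integers $n_j$, indexed by the $j$ with $D_j\supset\overline B\cap D_i$, such that $v=\sum_j n_jv_j$, $n_i>0$, and $v$ is a primitive lattice vector of $\mathfrak{t}^n$ lying in the intersection of $\mathfrak{t}^k$ with the normal space of the moment map image of $\overline B\cap D_i$ (the vectors of $\mathfrak{t}^n$ that annihilate all differences of points of this image). Every disc bounded by $L^\pi$ in the class $\beta_i^B$ has Maslov index $$\mu(\beta_i^B)=2\sum_j n_j .$$ -/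

import Mathlib

open scoped Real unitInterval

noncomputable section

/-! ### Tori, subtori and their action on `ℂ^N` -/

/-- The standard torus `T^N`. -/
abbrev StdTorus (N : ℕ) := Fin N → Circle

/-- The exponential map `ℝ^N → T^N`, with kernel `ℤ^N`. -/
def torusExp {N : ℕ} (θ : Fin N → ℝ) : StdTorus N := fun j => Circle.exp (2 * π * θ j)

/-- The integral lattice `ℤ^N ⊂ ℝ^N`. -/
def intLattice (N : ℕ) : AddSubgroup (Fin N → ℝ) := ((Int.castAddHom ℝ).compLeft (Fin N)).range

/-- A subspace is rational for the lattice `Λ` if it is spanned by lattice vectors; the rational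
subspaces of the Lie algebra of a torus are the Lie algebras of its subtori. -/
def IsRationalSubspace {V : Type*} [AddCommGroup V] [Module ℝ V] (Λ : AddSubgroup V)
    (s : Submodule ℝ V) : Prop :=
  Submodule.span ℝ ((s : Set V) ∩ (Λ : Set V)) = s

/-- The subgroup `exp(s)` of `T^N`. -/
def expSubgroup {N : ℕ} (s : Submodule ℝ (Fin N → ℝ)) : Subgroup (StdTorus N) where
  carrier := {t | ∃ θ ∈ s, torusExp θ = t}
  mul_mem' := by
    rintro _ _ ⟨θ, hθ, rfl⟩ ⟨η, hη, rfl⟩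
    refine ⟨θ + η, s.add_mem hθ hη, ?_⟩
    funext j
    simp [torusExp, mul_add, Circle.exp_add]
  one_mem' := ⟨0, s.zero_mem, by funext j; simp [torusExp]⟩
  inv_mem' := by
    rintro _ ⟨θ, hθ, rfl⟩
    refine ⟨-θ, s.neg_mem hθ, ?_⟩
    funext j
    simp [torusExp, Circle.exp_neg]

/-- The coordinatewise action of `T^N` on `ℂ^N`. -/
def rotate {N : ℕ} (t : StdTorus N) (z : Fin N → ℂ) : Fin N → ℂ := fun j => (t j : ℂ) * z j

/-- The moment map `z ↦ (|z_j|²/2 - a_j)_j` of the action of `T^N` on `ℂ^N`, with values in the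
dual of the Lie algebra `ℝ^N`; the constant `a` is a normalization. -/
def stdMoment {N : ℕ} (a : Fin N → ℝ) (z : Fin N → ℂ) : Module.Dual ℝ (Fin N → ℝ) :=
  ∑ j, (‖z j‖ ^ 2 / 2 - a j) • LinearMap.proj j

lemma rotate_mul {N : ℕ} (s t : StdTorus N) (z : Fin N → ℂ) :
    rotate (s * t) z = rotate s (rotate t z) := by
  funext j
  simp [rotate, mul_assoc]

lemma rotate_one {N : ℕ} (z : Fin N → ℂ) : rotate 1 z = z := by
  funext j
  simp [rotate]

lemma stdMoment_rotate {N : ℕ} (a : Fin N → ℝ) (t : StdTorus N) (z : Fin N → ℂ) :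
    stdMoment a (rotate t z) = stdMoment a z := by
  simp only [stdMoment, rotate, norm_mul, Circle.norm_coe, one_mul]

/-! ### Toric manifolds as symplectic quotients of `ℂ^N` -/

/-- The data of a toric manifold: a subtorus `K = exp(k)` of `T^N` and a level of the moment map
`ℂ^N → k^*` on which `K` acts freely. The manifold itself is `ToricManifold.Space`. -/
structure ToricManifold (N : ℕ) where
  /-- the Lie algebra of `K` -/
  k : Submodule ℝ (Fin N → ℝ)
  rational : IsRationalSubspace (intLattice N) k
  /-- the level, as the restriction to `k` of an element of the dual of `ℝ^N` -/
  a : Fin N → ℝ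
  free : ∀ z : Fin N → ℂ, (∀ θ ∈ k, stdMoment a z θ = 0) →
    ∀ t ∈ expSubgroup k, rotate t z = z → t = 1

namespace ToricManifold

variable {N : ℕ} (Y : ToricManifold N)

/-- The level set in `ℂ^N` of the moment map of `K`. -/
def Level : Set (Fin N → ℂ) := {z | ∀ θ ∈ Y.k, stdMoment Y.a z θ = 0}

/-- The acting torus `K`. -/
def K : Subgroup (StdTorus N) := expSubgroup Y.k

/-- Two points of the level set are equivalent if they lie in one `K`-orbit. -/
def orbitSetoid : Setoid Y.Level where
  r z z' := ∃ t ∈ Y.K, rotate t z.1 = z'.1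
  iseqv :=
    { refl := fun z => ⟨1, Y.K.one_mem, rotate_one _⟩
      symm := by
        rintro z z' ⟨t, ht, h⟩
        exact ⟨t⁻¹, Y.K.inv_mem ht, by rw [← h, ← rotate_mul, inv_mul_cancel, rotate_one]⟩
      trans := by
        rintro z z' z'' ⟨t, ht, h⟩ ⟨s, hs, h'⟩
        exact ⟨s * t, Y.K.mul_mem hs ht, by rw [rotate_mul, h, h']⟩ }

/-- The toric manifold `Y`: the level set modulo `K`, with the quotient topology. -/
def Space : Type := Quotient Y.orbitSetoid

instance : TopologicalSpace Y.Space := inferInstanceAs (TopologicalSpace (Quotient Y.orbitSetoid))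

/-- `z` is a point of the level set representing the point `y` of `Y`. -/
def Represents (z : Fin N → ℂ) (y : Y.Space) : Prop :=
  ∃ h : z ∈ Y.Level, (Quotient.mk Y.orbitSetoid ⟨z, h⟩ : Y.Space) = y

/-- The Lie algebra `𝔱^n` of the residual torus. -/
abbrev Lie : Type := (Fin N → ℝ) ⧸ Y.k

/-- The integral lattice of the residual torus. -/
def lattice : AddSubgroup Y.Lie := (intLattice N).map Y.k.mkQ.toAddMonoidHom

/-- The vectors `v_j` in the lattice: images of the standard basis vectors of `ℤ^N`. -/
def v (j : Fin N) : Y.Lie := Y.k.mkQ (Pi.single j 1)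

/-- The residual torus `T^n = T^N / K`. -/
abbrev ResTorus : Type := StdTorus N ⧸ Y.K

lemma rotate_mem_level (t : StdTorus N) {z : Fin N → ℂ} (hz : z ∈ Y.Level) :
    rotate t z ∈ Y.Level := fun θ hθ => by
  rw [stdMoment_rotate]
  exact hz θ hθ

/-- The action of the residual torus on `Y`: `[t] • [z] = [t z]`. -/
def act : Y.ResTorus → Y.Space → Y.Space :=
  Quotient.map₂ (fun t z => (⟨rotate t z.1, Y.rotate_mem_level t z.2⟩ : Y.Level)) (by
    rintro s t hst z z' ⟨r, hr, hz⟩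
    refine ⟨(s⁻¹ * t) * r, Y.K.mul_mem (QuotientGroup.leftRel_apply.1 hst) hr, ?_⟩
    change rotate (s⁻¹ * t * r) (rotate s z.1) = rotate t z'.1
    rw [← hz, ← rotate_mul, ← rotate_mul]
    congr 1
    rw [mul_right_comm, mul_comm s⁻¹ t, inv_mul_cancel_right])

lemma act_one (y : Y.Space) : Y.act 1 y = y := by
  induction y using Quotient.inductionOn with
  | h z => exact Quotient.sound ⟨1, Y.K.one_mem, by
      rw [rotate_one]; exact (rotate_one z.1)⟩

lemma act_mul (s t : Y.ResTorus) (y : Y.Space) : Y.act (s * t) y = Y.act s (Y.act t y) := by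
  induction y using Quotient.inductionOn with
  | h z =>
    induction s using QuotientGroup.induction_on with
    | H s =>
      induction t using QuotientGroup.induction_on with
      | H t => exact Quotient.sound ⟨1, Y.K.one_mem, by
          rw [rotate_one]; exact rotate_mul s t z.1⟩

/-- The moment map `Y → (𝔱^n)^*` of the residual torus. -/
def moment : Y.Space → Module.Dual ℝ Y.Lie :=
  Quotient.lift (fun z => Y.k.liftQ (stdMoment Y.a z.1) (fun θ hθ => LinearMap.mem_ker.2 (z.2 θ hθ))) (by
    rintro z z' ⟨t, _, h⟩
    have : stdMoment Y.a z.1 = stdMoment Y.a z'.1 := by rw [← h, stdMoment_rotate]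
    simp only [this])

/-- The toric divisor `D_i`, given by the vanishing of the `i`-th homogeneous coordinate. -/
def divisor (i : Fin N) : Set Y.Space := {y | ∃ z, Y.Represents z y ∧ z i = 0}

/-- The open toric stratum on which precisely the coordinates with index in `J` vanish. -/
def stratum (J : Finset (Fin N)) : Set Y.Space :=
  {y | ∃ z, Y.Represents z y ∧ ∀ j, z j = 0 ↔ j ∈ J}

/-- The normal space in `𝔱^n` of the moment map image of `S`. -/
def momentNormal (S : Set Y.Space) : Set Y.Lie :=
  {ξ | ∀ p ∈ Y.moment '' S, ∀ q ∈ Y.moment '' S, (p - q) ξ = 0}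

/-- `v` is a primitive vector of the lattice of `T^n`. -/
def IsPrimitive (v : Y.Lie) : Prop :=
  v ∈ Y.lattice ∧ ∀ (m : ℤ), ∀ u ∈ Y.lattice, v = m • u → IsUnit m

end ToricManifold

/-! ### The symplectic quotient `X` of `Y` by a subtorus -/

/-- The data of a symplectic quotient of `Y` by a subtorus of the residual torus: the Lie algebra
`h` of the subtorus `T^k` and a level `c` of its moment map on which the subtorus acts freely. -/
structure ToricReduction {N : ℕ} (Y : ToricManifold N) where
  /-- the Lie algebra `𝔱^k` of the subtorus -/
  h : Submodule ℝ Y.Lie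
  rational : IsRationalSubspace Y.lattice h
  c : Module.Dual ℝ h
  free : ∀ y : Y.Space, (Y.moment y).comp h.subtype = c →
    ∀ t ∈ (expSubgroup (h.comap Y.k.mkQ)).map (QuotientGroup.mk' Y.K), Y.act t y = y → t = 1

namespace ToricReduction

variable {N : ℕ} {Y : ToricManifold N} (R : ToricReduction Y)

/-- The moment map `μ : Y → (𝔱^k)^*` of the subtorus. -/
def μ (y : Y.Space) : Module.Dual ℝ R.h := (Y.moment y).comp R.h.subtype

/-- The moment level set `μ⁻¹(c)` in `Y`. -/
def Level : Set Y.Space := {y | R.μ y = R.c}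

/-- The Lie algebra of the preimage in `T^N` of the subtorus `T^k`. -/
def hLift : Submodule ℝ (Fin N → ℝ) := R.h.comap Y.k.mkQ

/-- The subtorus `T^k ⊂ T^n`. -/
def T : Subgroup Y.ResTorus := (expSubgroup R.hLift).map (QuotientGroup.mk' Y.K)

/-- Two points of `μ⁻¹(c)` are equivalent if they lie in one `T^k`-orbit. -/
def orbitSetoid : Setoid R.Level where
  r y y' := ∃ t ∈ R.T, Y.act t y.1 = y'.1
  iseqv :=
    { refl := fun y => ⟨1, R.T.one_mem, Y.act_one _⟩
      symm := by
        rintro y y' ⟨t, ht, h⟩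
        exact ⟨t⁻¹, R.T.inv_mem ht, by rw [← h, ← Y.act_mul, inv_mul_cancel, Y.act_one]⟩
      trans := by
        rintro y y' y'' ⟨t, ht, h⟩ ⟨s, hs, h'⟩
        exact ⟨s * t, R.T.mul_mem hs ht, by rw [Y.act_mul, h, h']⟩ }

/-- The symplectic quotient `X = μ⁻¹(c) / T^k`. -/
def Space : Type := Quotient R.orbitSetoid

instance : TopologicalSpace R.Space := inferInstanceAs (TopologicalSpace (Quotient R.orbitSetoid))

/-- The quotient map `μ⁻¹(c) → X`. -/
def proj (y : R.Level) : R.Space := Quotient.mk R.orbitSetoid y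

/-- `z ∈ ℂ^N` represents a point of `μ⁻¹(c)` that lies over the point `x` of `X`. -/
def Represents (z : Fin N → ℂ) (x : R.Space) : Prop :=
  ∃ y : R.Level, Y.Represents z y.1 ∧ R.proj y = x

/-- The Lagrangian correspondence `L^π = {(y, [y])} ⊂ Y⁻ × X`. -/
def Lag : Set (Y.Space × R.Space) := {p | ∃ y : R.Level, p = (y.1, R.proj y)}

end ToricReduction

/-! ### Tangent spaces

Let `s` be the Lie algebra of a subtorus of `T^N`. At a point `z` of a level set of its moment map
on which it acts freely, the level set has tangent space `tangentLevel s z`, the orbit has tangent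
space `tangentOrbit s z`, and `tangentOrbit s z` is the kernel of the restriction of the standard
symplectic form to `tangentLevel s z`. The tangent space of the symplectic quotient at `[z]` is
`tangentLevel s z / tangentOrbit s z`, with the induced symplectic form. For `s = Y.k` this is
`T_[z] Y`, and for `s = R.hLift` it is `T_[z] X`, with `T_[z] μ⁻¹(c)` equal to
`tangentLevel R.hLift z / tangentOrbit Y.k z`. -/

/-- The standard symplectic form `∑ dx_j ∧ dy_j` of `ℂ^r`. -/
def stdSymp {r : ℕ} (ξ η : Fin r → ℂ) : ℝ := ∑ j, ((starRingEnd ℂ) (ξ j) * η j).im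

/-- The common kernel at `z` of the differentials of `z ↦ ∑ θ_j |z_j|²/2` for `θ ∈ s`. -/
def tangentLevel {N : ℕ} (s : Submodule ℝ (Fin N → ℝ)) (z : Fin N → ℂ) : Set (Fin N → ℂ) :=
  {ξ | ∀ θ ∈ s, ∑ j, θ j * ((starRingEnd ℂ) (z j) * ξ j).re = 0}

/-- The tangent space at `z` of the orbit of `exp(s)`. -/
def tangentOrbit {N : ℕ} (s : Submodule ℝ (Fin N → ℝ)) (z : Fin N → ℂ) : Set (Fin N → ℂ) :=
  {ξ | ∃ θ ∈ s, ξ = fun j => Complex.I * (θ j : ℂ) * z j}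

namespace ToricReduction

variable {N : ℕ} {Y : ToricManifold N} (R : ToricReduction Y)

/-- The pairs `(ξ, ξ')` of vectors at `z`, `z'` that represent vectors of `T_[z] Y × T_[z'] X`
tangent to `L^π = {(y, [y]) : y ∈ μ⁻¹(c)}`. Here `z' = t z` with `t` in the preimage of `T^k` in
`T^N`, so a vector `η` tangent to `μ⁻¹(c)` at `[z]` is mapped to the class of `t η` in
`T_[z'] X`. -/
def lagTangent (z z' : Fin N → ℂ) : Set ((Fin N → ℂ) × (Fin N → ℂ)) :=
  {p | ∃ t ∈ expSubgroup R.hLift, z' = rotate t z ∧ ∃ η ∈ tangentLevel R.hLift z,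
    p.1 - η ∈ tangentOrbit Y.k z ∧ p.2 - rotate t η ∈ tangentOrbit R.hLift z'}

end ToricReduction

/-! ### Discs and the Maslov index -/

/-- The closed unit disc. -/
abbrev Disc : Type := Metric.closedBall (0 : ℂ) 1

/-- The boundary point `exp(2πiτ)` of the disc. -/
def bdryPoint (τ : ℝ) : Disc := ⟨Circle.exp (2 * π * τ), by
  rw [mem_closedBall_zero_iff, Circle.norm_coe]⟩

/-- Complex conjugation on the disc. -/
def discConj : C(Disc, Disc) where
  toFun ζ := ⟨(starRingEnd ℂ) ζ.1, by
    rw [mem_closedBall_zero_iff, RCLike.norm_conj]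
    exact mem_closedBall_zero_iff.1 ζ.2⟩
  continuous_toFun := by fun_prop

namespace ToricReduction

variable {N : ℕ} {Y : ToricManifold N} (R : ToricReduction Y)

/-- A map from the disc to `Y × X` is bounded by `L^π` if it maps the unit circle to `L^π`. -/
def IsBounded (w : C(Disc, Y.Space × R.Space)) : Prop := ∀ ζ : Disc, ‖ζ.1‖ = 1 → w ζ ∈ R.Lag

/-- A lift of a map `w` from the disc to `Y × X` to a pair of maps to `ℂ^N`. -/
structure DiscLift (w : C(Disc, Y.Space × R.Space)) where
  fst : C(Disc, Fin N → ℂ)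
  snd : C(Disc, Fin N → ℂ)
  fst_rep : ∀ ζ, Y.Represents (fst ζ) (w ζ).1
  snd_rep : ∀ ζ, R.Represents (snd ζ) (w ζ).2

/-- A symplectic trivialization `Disc × (ℂ^r, standard) ≅ w^* T(Y⁻ × X)`, given by representatives
in `ℂ^N × ℂ^N`. The symplectic form of `Y⁻ × X` is `(-ω_Y) ⊕ ω_X`. Injectivity modulo the tangent
spaces of the orbits follows from nondegeneracy of the standard form on `ℂ^r`. -/
structure SympTriv {w : C(Disc, Y.Space × R.Space)} (l : R.DiscLift w) where
  r : ℕ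
  map : Disc → (Fin r → ℂ) →ₗ[ℝ] (Fin N → ℂ) × (Fin N → ℂ)
  continuous_map : ∀ b, Continuous fun ζ => map ζ b
  mem_fst : ∀ ζ b, (map ζ b).1 ∈ tangentLevel Y.k (l.fst ζ)
  mem_snd : ∀ ζ b, (map ζ b).2 ∈ tangentLevel R.hLift (l.snd ζ)
  symp : ∀ ζ b b', -stdSymp (map ζ b).1 (map ζ b').1 + stdSymp (map ζ b).2 (map ζ b').2
    = stdSymp b b'
  surj : ∀ ζ, ∀ ξ ∈ tangentLevel Y.k (l.fst ζ), ∀ ξ' ∈ tangentLevel R.hLift (l.snd ζ),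
    ∃ b, ξ - (map ζ b).1 ∈ tangentOrbit Y.k (l.fst ζ) ∧
      ξ' - (map ζ b).2 ∈ tangentOrbit R.hLift (l.snd ζ)

/-- In a symplectic trivialization, the tangent spaces of `L^π` along the boundary of the disc form
a loop of Lagrangian subspaces of `ℂ^r`. A framing consists of a continuous family of real bases of
these subspaces along `[0, 1]`, and a continuous argument of the square of the determinant. -/
structure LagFraming {w : C(Disc, Y.Space × R.Space)} {l : R.DiscLift w} (Φ : R.SympTriv l) where
  frame : I → Matrix (Fin Φ.r) (Fin Φ.r) ℂ
  continuous_frame : Continuous frame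
  span_frame : ∀ (τ : I) (b : Fin Φ.r → ℂ), b ∈ Submodule.span ℝ (Set.range (frame τ)) ↔
    Φ.map (bdryPoint τ) b ∈ R.lagTangent (l.fst (bdryPoint τ)) (l.snd (bdryPoint τ))
  arg : C(I, ℝ)
  arg_spec : ∀ τ, (frame τ).det ^ 2 =
    (‖(frame τ).det ^ 2‖ : ℂ) * Complex.exp (2 * π * arg τ * Complex.I)

/-- The Maslov index of the disc `w` in `Y⁻ × X` bounded by `L^π` is `m`: the winding number of
the squared determinant of the loop of Lagrangian subspaces is `m`, for all choices of lift,
symplectic trivialization and framing, and such choices exist. -/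
def IsMaslovIndex (w : C(Disc, Y.Space × R.Space)) (m : ℤ) : Prop :=
  (∃ (l : R.DiscLift w) (Φ : R.SympTriv l), Nonempty (R.LagFraming Φ)) ∧
  ∀ (l : R.DiscLift w) (Φ : R.SympTriv l) (F : R.LagFraming Φ), F.arg 1 - F.arg 0 = m

end ToricReduction

/-! ### The disc classes -/

/-- `u` is a disc in the closure of the stratum `B` with index set `J` that represents the basic
class `β_i`: in homogeneous coordinates its `i`-th coordinate is `ζ` times a nowhere vanishing
function, the coordinates with index in `J` vanish identically, and the others vanish nowhere. So
`u` meets `D_i` once, at `ζ = 0` and with multiplicity one, and no other toric divisor of the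
closure of `B`. -/
def ToricManifold.IsBasicDisc {N : ℕ} (Y : ToricManifold N) (J : Finset (Fin N)) (i : Fin N)
    (u : C(Disc, Y.Space)) : Prop :=
  ∃ f : C(Disc, Fin N → ℂ), (∀ ζ j, f ζ j = 0 ↔ j ∈ J) ∧
    ∀ ζ : Disc, Y.Represents (Function.update (f ζ) i (ζ.1 * f ζ i)) (u ζ)

namespace ToricReduction

variable {N : ℕ} {Y : ToricManifold N} (R : ToricReduction Y)

/-- The disc in `Y⁻ × X` with constant second component `x`, and with first component `u`
precomposed with complex conjugation (a holomorphic disc in `Y` becomes holomorphic in `Y⁻`). -/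
def constDisc (u : C(Disc, Y.Space)) (x : R.Space) : C(Disc, Y.Space × R.Space) :=
  (u.comp discConj).prodMk (ContinuousMap.const Disc x)

/-- The class `β_i^B` of discs in `Y⁻ × X` bounded by `L^π`, where `B` is the stratum with index
set `J`: all discs homotopic, through discs bounded by `L^π`, to a disc that is constant in `X` and
basic in the closure of `B`. -/
def basicClass (J : Finset (Fin N)) (i : Fin N) : Set C(Disc, Y.Space × R.Space) :=
  {w | ∃ (u : C(Disc, Y.Space)) (x : R.Space), Y.IsBasicDisc J i u ∧
    R.IsBounded (R.constDisc u x) ∧ (R.constDisc u x).HomotopicWith w R.IsBounded}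

/-- `v = ∑ n_j v_j` is a primitive vector in the intersection of `𝔱^k` with the normal space of the
moment map image of the intersection of `D_i` with the closure of `B`; the sum is over the divisors
that contain this intersection (those with index in `J` or equal to `i`), and `n_i > 0`. -/
structure IsNormalVector (J : Finset (Fin N)) (i : Fin N) (v : Y.Lie) (n : Fin N → ℤ) : Prop where
  expansion : v = ∑ j, n j • Y.v j
  support : ∀ j, j ∉ insert i J → n j = 0
  pos : 0 < n i
  primitive : Y.IsPrimitive v
  mem : v ∈ R.h
  normal : v ∈ Y.momentNormal (closure (Y.stratum J) ∩ Y.divisor i)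

end ToricReduction

end

/-!
Points of `Y` and `X` are represented by points of `ℂ^N`, on which the subtori `K` and
`H = exp(hLift)` of `T^N` act freely; `H` is the preimage of `T^k`. As the disc is contractible, a
disc in `Y⁻ × X` lifts to a pair `(z, z')` of maps to `ℂ^N` (`exists_lift`). If it is bounded by
`L^π`, then `z' = t z` along the boundary for a loop `t = exp(2πi φ)` in `H`. The winding vector
`φ(1) - φ(0)` is a lattice vector in the Lie algebra of `H`, and it depends only on the class of
the disc (`IsTransition.sub_eq_of_homotopic`).

The Maslov index is twice the sum of the entries of the winding vector (`LagFraming.arg_sub_eq`).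
Modulo the tangent spaces of the orbits, the tangent space of `L^π` is the tangent space of
`{(z, t z)}`, where `z` runs through the level set and `t` through `H`. It is preserved by the
antiunitary involution `(a, b) ↦ (t⁻¹ b, t a)` that exchanges the two factors. After conjugation of
the first factor, this determines the phase of the determinant of a real frame up to sign as that of
`∏ t_j` (`exists_frameDet_sq_eq`). This determinant refers to the coordinates of `ℂ^N × ℂ^N`, whereas
the Maslov index is computed in a symplectic trivialization `Φ`, which need not be complex linear. The
two are compared by deforming `Φ` to its complex linear part while the disc is shrunk to its centre.
The frames stay independent over `ℂ` (`linearIndependent_deformed`), and at the centre a complex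
linear map multiplies the determinant by a constant. Trivializations and framings exist because
continuous linearly independent vectors over a contractible compact space have a continuous
orthonormal frame of their complement (`exists_orthonormal_frame`).

For a basic disc that is constant in `X`, the path `t` undoes the rotation of `z`. So the winding
vector `n` has entry one at `i`, because the disc meets `D_i` once, and vanishes at the coordinates
that do not vanish on the disc (`exists_winding_of_isBasicDisc`). Hence `∑ n_j v_j`, which lies in
`𝔱^k`, is normal to the moment map image of the intersection of `D_i` with the closure of the
stratum. Freeness of the action of `K` at the centre of the disc makes it primitive, and freeness of
the action of `H` at the boundary makes it the only such vector.
-/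

noncomputable section

/-! ### Continuation over contractible compact spaces -/

/-- Continuation principle: a property of self-maps of a contractible compact space that holds for
constant maps, and that passes from a map to every uniformly close one, holds for the identity.
The set of times of a contraction at which the property holds is open and closed. -/
theorem of_contraction {B : Type*} [TopologicalSpace B] [CompactSpace B] [ContractibleSpace B]
    {O : Set (B × B)} (hO : IsOpen O) (hdiag : ∀ b, (b, b) ∈ O) (p : C(B, B) → Prop)
    (hconst : ∀ b, p (ContinuousMap.const B b))
    (hstep : ∀ φ ψ : C(B, B), (∀ b, (φ b, ψ b) ∈ O) → p φ → p ψ) :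
    p (ContinuousMap.id B) := by
  obtain ⟨b₀, ⟨H⟩⟩ := id_nullhomotopic B
  have hU : IsOpen {x : I × I | ∀ b, (H (x.1, b), H (x.2, b)) ∈ O} := by
    have : IsOpen ((fun y : (I × I) × B => (H (y.1.1, y.2), H (y.1.2, y.2))) ⁻¹' O) :=
      hO.preimage (by fun_prop)
    have hc := isClosedMap_fst_of_compactSpace _ this.isClosed_compl
    convert! hc.isOpen_compl using 1
    ext x
    simp
  let S : Set I := {s | p (H.curry s)}
  have hS : IsClopen S := by
    have key : ∀ s : I, ∀ᶠ s' in nhds s, (s' ∈ S ↔ s ∈ S) := by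
      intro s
      have h1 : ∀ᶠ s' in nhds s, (s, s') ∈ {x : I × I | ∀ b, (H (x.1, b), H (x.2, b)) ∈ O} :=
        (hU.preimage (by fun_prop : Continuous fun s' : I => (s, s'))).mem_nhds
          fun b => hdiag _
      have h2 : ∀ᶠ s' in nhds s, (s', s) ∈ {x : I × I | ∀ b, (H (x.1, b), H (x.2, b)) ∈ O} :=
        (hU.preimage (by fun_prop : Continuous fun s' : I => (s', s))).mem_nhds
          fun b => hdiag _
      filter_upwards [h1, h2] with s' h1 h2
      exact ⟨hstep _ _ h2, hstep _ _ h1⟩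
    refine ⟨⟨isOpen_iff_mem_nhds.2 fun s hs => ?_⟩, isOpen_iff_mem_nhds.2 fun s hs => ?_⟩
    · filter_upwards [key s] with s' h h'
      exact hs (h.1 h')
    · filter_upwards [key s] with s' h
      exact h.2 hs
  have h1 : (1 : I) ∈ S := by
    have : H.curry 1 = ContinuousMap.const B b₀ := by ext b; simp
    change p _
    rw [this]
    exact hconst b₀
  have h0 : (0 : I) ∈ S := by
    rw [hS.eq_univ ⟨1, h1⟩]
    trivial
  have : H.curry 0 = ContinuousMap.id B := by ext b; simp
  change p _ at h0
  rwa [this] at h0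

/-- A nowhere vanishing complex function on a contractible compact space has a continuous
argument, measured in turns. -/
theorem exists_continuous_turns {B : Type*} [TopologicalSpace B] [CompactSpace B]
    [ContractibleSpace B] (f : C(B, ℂ)) (hf : ∀ b, f b ≠ 0) :
    ∃ θ : C(B, ℝ), ∀ b, f b = (‖f b‖ : ℂ) * Complex.exp (2 * π * θ b * Complex.I) := by
  have hO : IsOpen {x : B × B | 0 < (starRingEnd ℂ (f x.1) * f x.2).re} :=
    isOpen_lt continuous_const (by fun_prop)
  refine of_contraction hO (fun b => ?_)
    (fun φ => ∃ θ : C(B, ℝ), ∀ b, f (φ b) = (‖f (φ b)‖ : ℂ) *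
      Complex.exp (2 * π * θ b * Complex.I)) (fun b => ?_) ?_
  · have := Complex.normSq_pos.2 (hf b)
    simpa [Complex.normSq_apply] using this
  · refine ⟨ContinuousMap.const B ((f b).arg / (2 * π)), fun _ => ?_⟩
    have h : (2 * π * ((f b).arg / (2 * π) : ℝ) : ℂ) = (f b).arg := by
      push_cast
      field_simp
    simp only [ContinuousMap.const_apply, h, Complex.norm_mul_exp_arg_mul_I]
  · rintro φ ψ h ⟨θ, hθ⟩
    let q : B → ℂ := fun b => starRingEnd ℂ (f (φ b)) * f (ψ b)
    have hq : Continuous fun b => (q b).arg := continuous_iff_continuousAt.2 fun b =>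
      ContinuousAt.comp (f := q) (Complex.continuousAt_arg (Or.inl (h b)))
        (by fun_prop : Continuous q).continuousAt
    refine ⟨⟨fun b => θ b + (q b).arg / (2 * π), by fun_prop⟩, fun b => ?_⟩
    have e1 : (2 * π * (θ b + (q b).arg / (2 * π) : ℝ) * Complex.I : ℂ)
        = 2 * π * θ b * Complex.I + (q b).arg * Complex.I := by
      push_cast
      field_simp
    have e2 := Complex.norm_mul_exp_arg_mul_I (q b)
    have e3 : (‖q b‖ : ℂ) = ‖f (φ b)‖ * ‖f (ψ b)‖ := by simp [q]
    have e4 : (‖f (φ b)‖ : ℂ) ≠ 0 := by simpa using hf _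
    have e5 : f (φ b) * starRingEnd ℂ (f (φ b)) = (‖f (φ b)‖ : ℂ) ^ 2 := Complex.mul_conj' _
    simp only [ContinuousMap.coe_mk, e1, Complex.exp_add]
    rw [e3] at e2
    generalize Complex.exp ((q b).arg * Complex.I) = E at e2 ⊢
    apply mul_left_cancel₀ (pow_ne_zero 2 e4)
    rw [← e5]
    calc _ = f (φ b) * q b := by simp only [q]; ring
      _ = _ := by
        rw [← e2, e5]
        nth_rewrite 1 [hθ b]
        ring

/-- A continuous real function of which the exponential is constant is itself constant. -/
theorem eq_of_exp_turns_eq {B : Type*} [TopologicalSpace B] [PreconnectedSpace B] {g : B → ℝ}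
    (hg : Continuous g) {c : ℂ} (h : ∀ b, Complex.exp (2 * π * g b * Complex.I) = c) (a b : B) :
    g a = g b := by
  have key : ∀ x, ∃ n : ℤ, g x - g a = n := fun x => by
    have := (h x).trans (h a).symm
    obtain ⟨n, hn⟩ := Complex.exp_eq_exp_iff_exists_int.1 this
    refine ⟨n, ?_⟩
    have h2 : (2 * π * Complex.I : ℂ) ≠ 0 := Complex.two_pi_I_ne_zero
    have : (g x - g a : ℂ) = n := by
      apply mul_left_cancel₀ h2
      linear_combination hn
    exact_mod_cast this
  choose n hn using key
  have hc : Continuous n := by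
    rw [Int.isClosedEmbedding_coe_real.isInducing.continuous_iff]
    have : ((↑) : ℤ → ℝ) ∘ n = fun x => g x - g a := funext fun x => (hn x).symm
    rw [this]
    fun_prop
  have h1 := PreconnectedSpace.constant ‹_› hc (x := a) (y := b)
  have ha := hn a
  have hb := hn b
  rw [← h1, ← ha] at hb
  linarith

/-! ### Continuous frames of orthogonal complements -/

section Frame
variable {𝕜 V : Type*} [RCLike 𝕜] [NormedAddCommGroup V] [InnerProductSpace 𝕜 V]

theorem continuous_gramSchmidt {B : Type*} [TopologicalSpace B] {m : ℕ} (f : B → Fin m → V)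
    (hf : ∀ i, Continuous fun b => f b i) (hind : ∀ b, LinearIndependent 𝕜 (f b)) (i : Fin m) :
    Continuous fun b => InnerProductSpace.gramSchmidt 𝕜 (f b) i := by
  induction i using WellFoundedLT.induction with
  | ind i ih =>
    have h : (fun b => InnerProductSpace.gramSchmidt 𝕜 (f b) i) = fun b => f b i -
        ∑ j ∈ Finset.Iio i, (inner 𝕜 (InnerProductSpace.gramSchmidt 𝕜 (f b) j) (f b i) /
          ((‖InnerProductSpace.gramSchmidt 𝕜 (f b) j‖ ^ 2 : ℝ) : 𝕜)) •
            InnerProductSpace.gramSchmidt 𝕜 (f b) j := by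
      funext b
      rw [InnerProductSpace.gramSchmidt_def]
      congr 1
      exact Finset.sum_congr rfl fun j _ => Submodule.starProjection_singleton 𝕜 _
    rw [h]
    refine (hf i).sub (continuous_finsetSum _ fun j hj => ?_)
    have hj' := ih j (Finset.mem_Iio.1 hj)
    refine Continuous.smul (Continuous.div (hj'.inner (hf i)) (by fun_prop) fun b => ?_) hj'
    have := InnerProductSpace.gramSchmidt_ne_zero j (hind b)
    exact RCLike.ofReal_ne_zero.2 (pow_ne_zero 2 (norm_ne_zero_iff.2 this))

theorem continuous_gramSchmidtNormed {B : Type*} [TopologicalSpace B] {m : ℕ}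
    (f : B → Fin m → V) (hf : ∀ i, Continuous fun b => f b i)
    (hind : ∀ b, LinearIndependent 𝕜 (f b)) (i : Fin m) :
    Continuous fun b => InnerProductSpace.gramSchmidtNormed 𝕜 (f b) i := by
  have h := continuous_gramSchmidt f hf hind i
  change Continuous fun b => ((‖InnerProductSpace.gramSchmidt 𝕜 (f b) i‖ : 𝕜)⁻¹ •
    InnerProductSpace.gramSchmidt 𝕜 (f b) i)
  refine Continuous.smul (Continuous.inv₀ (by fun_prop) fun b => ?_) h
  exact RCLike.ofReal_ne_zero.2
    (norm_ne_zero_iff.2 (InnerProductSpace.gramSchmidt_ne_zero i (hind b)))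

/-- Continuous linearly independent vectors `u` on a contractible compact space have a continuous
orthonormal frame of their pointwise orthogonal complement. A frame for `u ∘ φ` is a complement to
`u ∘ ψ` if `φ` and `ψ` are close, and the Gram-Schmidt process applied to `u ∘ ψ`, followed by this
frame, produces a frame for `u ∘ ψ`. -/
theorem exists_orthonormal_frame [FiniteDimensional 𝕜 V] {B : Type*} [TopologicalSpace B]
    [CompactSpace B] [ContractibleSpace B] {s d : ℕ} (u : Fin s → C(B, V))
    (hu : ∀ b, LinearIndependent 𝕜 fun a => u a b) (hd : s + d = Module.finrank 𝕜 V) :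
    ∃ e : Fin d → C(B, V), ∀ b, Orthonormal 𝕜 (fun j => e j b) ∧
      Submodule.span 𝕜 (Set.range fun j => e j b) =
        (Submodule.span 𝕜 (Set.range fun a => u a b))ᗮ := by
  have hrank : ∀ b, Module.finrank 𝕜 (Submodule.span 𝕜 (Set.range fun a => u a b))ᗮ = d := by
    intro b
    have h1 := Submodule.finrank_add_finrank_orthogonal
      (Submodule.span 𝕜 (Set.range fun a => u a b))
    have h2 := finrank_span_eq_card (hu b)
    rw [Fintype.card_fin] at h2
    omega
  have hO : IsOpen {x : B × B | (Matrix.of fun a c => inner 𝕜 (u a x.1) (u c x.2)).det ≠ 0} := by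
    refine isOpen_ne_fun (Continuous.matrix_det ?_) continuous_const
    exact continuous_pi fun a => continuous_pi fun c => by
      simp only [Matrix.of_apply]; fun_prop
  refine of_contraction hO (fun b => ?_)
    (fun φ => ∃ e : Fin d → C(B, V), ∀ b, Orthonormal 𝕜 (fun j => e j b) ∧
      Submodule.span 𝕜 (Set.range fun j => e j b) =
        (Submodule.span 𝕜 (Set.range fun a => u a (φ b)))ᗮ) (fun b => ?_) ?_
  · exact Matrix.det_gram_ne_zero_iff_linearIndependent.2 (hu b)
  · let e := (stdOrthonormalBasis 𝕜 (Submodule.span 𝕜 (Set.range fun a => u a b))ᗮ).reindex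
      (finCongr (hrank b))
    refine ⟨fun j => ContinuousMap.const B (e j : V), fun _ => ⟨?_, ?_⟩⟩
    · exact e.orthonormal.comp_linearIsometry (Submodule.subtypeₗᵢ _)
    · have h := congrArg (Submodule.map (Submodule.subtype _)) e.toBasis.span_eq
      rw [Submodule.map_span, Submodule.map_top, Submodule.range_subtype, ← Set.range_comp] at h
      simpa [Function.comp_def] using h
  · rintro φ ψ h ⟨e, he⟩
    let f : B → Fin (s + d) → V := fun b => Fin.append (fun a => u a (ψ b)) (fun j => e j b)
    have hf : ∀ i, Continuous fun b => f b i := fun i => by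
      refine Fin.addCases (fun a => ?_) (fun j => ?_) i
      · simp only [f, Fin.append_left]; fun_prop
      · simp only [f, Fin.append_right]; fun_prop
    have hind : ∀ b, LinearIndependent 𝕜 (f b) := by
      intro b
      rw [Fintype.linearIndependent_iff]
      intro g hg
      rw [Fin.sum_univ_add] at hg
      simp only [f, Fin.append_left, Fin.append_right] at hg
      have horth : ∀ a j, inner 𝕜 (u a (φ b)) (e j b) = 0 := fun a j => by
        have : e j b ∈ (Submodule.span 𝕜 (Set.range fun a => u a (φ b)))ᗮ := by
          rw [← (he b).2]; exact Submodule.subset_span ⟨j, rfl⟩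
        exact Submodule.inner_right_of_mem_orthogonal
          (Submodule.subset_span (Set.mem_range_self a)) this
      have h1 : ∀ a, g (Fin.castAdd d a) = 0 := by
        have hz : (Matrix.of fun a c => inner 𝕜 (u a (φ b)) (u c (ψ b))).mulVec
            (fun a => g (Fin.castAdd d a)) = 0 := by
          funext a
          have := congrArg (inner 𝕜 (u a (φ b))) hg
          rw [inner_add_right, inner_sum, inner_sum] at this
          simp only [inner_smul_right, horth, mul_zero, Finset.sum_const_zero, add_zero,
            inner_zero_right] at this
          simpa [Matrix.mulVec, dotProduct, mul_comm] using this
        have := Matrix.eq_zero_of_mulVec_eq_zero (h b) hz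
        exact fun a => congrFun this a
      have h2 : ∀ j, g (Fin.natAdd s j) = 0 := by
        simp only [h1, zero_smul, Finset.sum_const_zero, zero_add] at hg
        exact Fintype.linearIndependent_iff.1 (he b).1.linearIndependent _ hg
      exact fun i => Fin.addCases h1 h2 i
    refine ⟨fun j => ContinuousMap.mk
      (fun b => InnerProductSpace.gramSchmidtNormed 𝕜 (f b) (Fin.natAdd s j))
      (continuous_gramSchmidtNormed f hf hind _), fun b => ?_⟩
    have ho : Orthonormal 𝕜 fun j : Fin d =>
        InnerProductSpace.gramSchmidtNormed 𝕜 (f b) (Fin.natAdd s j) :=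
      (InnerProductSpace.gramSchmidtNormed_orthonormal (hind b)).comp _
        (Fin.natAdd_injective d s)
    refine ⟨ho, Submodule.eq_of_le_of_finrank_eq ?_ ?_⟩
    · rw [Submodule.span_le]
      rintro _ ⟨j, rfl⟩
      rw [SetLike.mem_coe, Submodule.mem_orthogonal']
      intro x hx
      induction hx using Submodule.span_induction with
      | mem x hx =>
        obtain ⟨a, rfl⟩ := hx
        have := InnerProductSpace.gramSchmidt_inv_triangular 𝕜 (f b)
          (i := Fin.castAdd d a) (j := Fin.natAdd s j) (by
            rw [Fin.lt_def]; simp; omega)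
        simp only [ContinuousMap.coe_mk, InnerProductSpace.gramSchmidtNormed, inner_smul_left]
        simp only [f, Fin.append_left] at this ⊢
        rw [this, mul_zero]
      | zero => simp
      | add x y _ _ hx hy => rw [inner_add_right, hx, hy, add_zero]
      | smul c x _ hx => rw [inner_smul_right, hx, mul_zero]
    · rw [hrank]
      exact (finrank_span_eq_card ho.linearIndependent).trans (Fintype.card_fin d)

end Frame

/-! ### Integral projections onto rational subspaces -/

/-- `exp(s)` acts freely at `z`. -/
def FreeAt {N : ℕ} (s : Submodule ℝ (Fin N → ℝ)) (z : Fin N → ℂ) : Prop :=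
  ∀ t ∈ expSubgroup s, rotate t z = z → t = 1

theorem torusExp_add {N : ℕ} (θ η : Fin N → ℝ) :
    torusExp (θ + η) = torusExp θ * torusExp η := by
  funext j
  simp [torusExp, mul_add, Circle.exp_add]

theorem torusExp_neg {N : ℕ} (θ : Fin N → ℝ) : torusExp (-θ) = (torusExp θ)⁻¹ := by
  funext j
  simp [torusExp, Circle.exp_neg]

theorem torusExp_eq_one_iff {N : ℕ} {θ : Fin N → ℝ} :
    torusExp θ = 1 ↔ ∀ j, ∃ n : ℤ, θ j = n := by
  rw [funext_iff]
  refine forall_congr' fun j => ?_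
  rw [torusExp, Pi.one_apply, Circle.exp_eq_one]
  refine exists_congr fun n => ?_
  have : (2 * π : ℝ) ≠ 0 := by positivity
  rw [mul_comm, mul_left_inj' this]

theorem exists_torusExp_eq {N : ℕ} (t : StdTorus N) : ∃ θ, torusExp θ = t := by
  refine ⟨fun j => (Complex.arg (t j)) / (2 * π), ?_⟩
  funext j
  have : (2 * π : ℝ) ≠ 0 := by positivity
  rw [torusExp, mul_div_cancel₀ _ this, Circle.exp_arg]

/-- Where `exp(s)` acts freely, the vectors of `s` whose coordinates at nonzero entries of `z` are
integral are lattice vectors, as their exponentials fix `z`. -/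
theorem FreeAt.integral {N : ℕ} {s : Submodule ℝ (Fin N → ℝ)} {z : Fin N → ℂ} (h : FreeAt s z)
    {θ : Fin N → ℝ} (hθ : θ ∈ s) (hz : ∀ j, z j ≠ 0 → ∃ n : ℤ, θ j = n) (j : Fin N) :
    ∃ n : ℤ, θ j = n := by
  refine torusExp_eq_one_iff.1 (h _ ⟨θ, hθ, rfl⟩ ?_) j
  funext k
  by_cases hk : z k = 0
  · simp [rotate, hk]
  · obtain ⟨n, hn⟩ := hz k hk
    have : torusExp θ k = 1 := by
      rw [torusExp, hn, Circle.exp_eq_one]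
      exact ⟨n, mul_comm _ _⟩
    simp [rotate, this]

theorem eq_zero_of_forall_smul_integral {N : ℕ} {θ : Fin N → ℝ}
    (h : ∀ (x : ℝ) (j : Fin N), ∃ n : ℤ, (x • θ) j = n) : θ = 0 := by
  funext j
  by_contra h0
  rw [Pi.zero_apply] at h0
  obtain ⟨n, hn⟩ := h (1 / (2 * θ j)) j
  rw [Pi.smul_apply, smul_eq_mul] at hn
  have h2 : (2 * n : ℝ) = 1 := by
    rw [← hn]
    field_simp
  have h3 : 2 * n = 1 := by exact_mod_cast h2
  omega

/-- Where `exp(s)` acts freely, `θ ↦ (θ_j z_j)` is injective on `s`. -/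
theorem FreeAt.eq_zero {N : ℕ} {s : Submodule ℝ (Fin N → ℝ)} {z : Fin N → ℂ} (h : FreeAt s z)
    {θ : Fin N → ℝ} (hθ : θ ∈ s) (hz : ∀ j, (θ j : ℂ) * z j = 0) : θ = 0 := by
  refine eq_zero_of_forall_smul_integral fun x => h.integral (s.smul_mem x hθ) fun j hj => ?_
  have : θ j = 0 := by
    rcases mul_eq_zero.1 (hz j) with h | h
    · exact_mod_cast h
    · exact absurd h hj
  exact ⟨0, by simp [this]⟩

theorem FreeAt.rotate {N : ℕ} {s : Submodule ℝ (Fin N → ℝ)} {z : Fin N → ℂ} (h : FreeAt s z)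
    (t : StdTorus N) : FreeAt s (rotate t z) := by
  intro r hr hrz
  refine h r hr ?_
  have := congrArg (_root_.rotate t⁻¹) hrz
  rwa [← rotate_mul, ← rotate_mul, ← rotate_mul, mul_right_comm, inv_mul_cancel, one_mul,
    rotate_one] at this

/-- The real linear map given by an integer matrix. -/
def intMap {N : ℕ} (P : Matrix (Fin N) (Fin N) ℤ) : (Fin N → ℝ) →ₗ[ℝ] (Fin N → ℝ) :=
  Matrix.mulVecLin (P.map (Int.cast : ℤ → ℝ))

theorem intMap_apply {N : ℕ} (P : Matrix (Fin N) (Fin N) ℤ) (θ : Fin N → ℝ) (i : Fin N) :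
    intMap P θ i = ∑ j, (P i j : ℝ) * θ j := by
  simp [intMap, Matrix.mulVec, dotProduct]

/-- If lattice points of a rational subspace `s` can be recognized by their coordinates in `S`,
then there is an integral projection onto `s` that only depends on these coordinates: the
projection of `s ∩ ℤ^N` to the coordinates in `S` is a saturated, hence complemented, sublattice. -/
theorem exists_intMap_projection {N : ℕ} {s : Submodule ℝ (Fin N → ℝ)}
    (hs : IsRationalSubspace (intLattice N) s) (S : Finset (Fin N))
    (hS : ∀ θ ∈ s, (∀ j ∈ S, ∃ n : ℤ, θ j = n) → ∀ j, ∃ n : ℤ, θ j = n) :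
    ∃ P : Matrix (Fin N) (Fin N) ℤ, (∀ i, ∀ j ∉ S, P i j = 0) ∧ (∀ θ, intMap P θ ∈ s) ∧
      ∀ θ ∈ s, intMap P θ = θ := by
  classical
  let c : (Fin N → ℤ) →+ (Fin N → ℝ) := (Int.castAddHom ℝ).compLeft (Fin N)
  have hc : ∀ n j, c n j = n j := fun _ _ => rfl
  -- `Γ` is the lattice `s ∩ ℤ^N`, and `A` sets the coordinates outside `S` to zero.
  let Γ : Submodule ℤ (Fin N → ℤ) := AddSubgroup.toIntSubmodule (s.toAddSubgroup.comap c)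
  have hΓ : ∀ n, n ∈ Γ ↔ c n ∈ s := fun n => Iff.rfl
  let A : (Fin N → ℤ) →ₗ[ℤ] (Fin N → ℤ) :=
    LinearMap.pi fun j => if j ∈ S then LinearMap.proj j else 0
  have hA : ∀ n j, A n j = if j ∈ S then n j else 0 := fun n j => by
    simp only [A, LinearMap.pi_apply]
    split_ifs <;> rfl
  let a : Γ →ₗ[ℤ] (Fin N → ℤ) := A.domRestrict Γ
  have ha : Function.Injective a := by
    rw [← LinearMap.ker_eq_bot, LinearMap.ker_eq_bot']
    rintro ⟨n, hn⟩ h0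
    have h1 : c n = 0 := by
      refine eq_zero_of_forall_smul_integral fun x => hS _ (s.smul_mem x ((hΓ n).1 hn)) ?_
      intro j hj
      have := congrFun h0 j
      simp only [a, LinearMap.domRestrict_apply, hA, if_pos hj, Pi.zero_apply] at this
      exact ⟨0, by simp [hc, this]⟩
    ext j
    have := congrFun h1 j
    rw [hc, Pi.zero_apply] at this
    exact_mod_cast this
  -- The image of `Γ` under `A` is saturated in `ℤ^N`, so it has a retraction.
  let Rg := LinearMap.range a
  have htf : Module.IsTorsionFree ℤ ((Fin N → ℤ) ⧸ Rg) := by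
    rw [Module.isTorsionFree_iff_smul_eq_zero]
    intro m x hx
    by_contra! hne
    obtain ⟨x, rfl⟩ := Rg.mkQ_surjective x
    rw [← map_smul, Submodule.mkQ_apply, Submodule.Quotient.mk_eq_zero] at hx
    obtain ⟨⟨n, hn⟩, hnx⟩ := hx
    have hm : (m : ℝ) ≠ 0 := by exact_mod_cast hne.1
    have hnj : ∀ j, A n j = m * x j := fun j => congrFun hnx j
    have hmem : (m : ℝ)⁻¹ • c n ∈ s := s.smul_mem _ ((hΓ n).1 hn)
    have hint := hS _ hmem (fun j hj => ⟨x j, by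
      have := hnj j
      rw [hA, if_pos hj] at this
      rw [Pi.smul_apply, hc, this, smul_eq_mul, Int.cast_mul, inv_mul_cancel_left₀ hm]⟩)
    choose n' hn' using hint
    have hn'Γ : n' ∈ Γ := by
      rw [hΓ]
      convert hmem using 1
      funext j
      rw [hn' j, hc]
    refine hne.2 ((Submodule.Quotient.mk_eq_zero _).2 ⟨⟨n', hn'Γ⟩, ?_⟩)
    funext j
    change A n' j = x j
    have := hnj j
    rw [hA] at this ⊢
    split_ifs with hj
    · rw [if_pos hj] at this
      have h2 := hn' j
      rw [Pi.smul_apply, hc, this, smul_eq_mul, Int.cast_mul, inv_mul_cancel_left₀ hm] at h2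
      exact_mod_cast h2.symm
    · rw [if_neg hj] at this
      exact ((mul_eq_zero.1 this.symm).resolve_left hne.1).symm
  obtain ⟨sec, hsec⟩ := Module.projective_lifting_property Rg.mkQ LinearMap.id Rg.mkQ_surjective
  let e : Γ ≃ₗ[ℤ] Rg := LinearEquiv.ofInjective a ha
  let r : (Fin N → ℤ) →ₗ[ℤ] Rg := LinearMap.codRestrict Rg (LinearMap.id - sec ∘ₗ Rg.mkQ) (by
    intro x
    rw [← Submodule.Quotient.mk_eq_zero, ← Submodule.mkQ_apply]
    have := LinearMap.congr_fun hsec (Rg.mkQ x)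
    simp only [LinearMap.comp_apply, LinearMap.id_apply] at this
    rw [LinearMap.sub_apply, LinearMap.comp_apply, LinearMap.id_apply, map_sub, this, sub_self])
  have hr : ∀ x : Γ, r (a x) = e x := fun x => by
    ext1
    have : Rg.mkQ (a x) = 0 := (Submodule.Quotient.mk_eq_zero _).2 ⟨x, rfl⟩
    simp only [r, LinearMap.codRestrict_apply, LinearMap.sub_apply, LinearMap.comp_apply,
      LinearMap.id_apply, this, map_zero, sub_zero]
    rfl
  let L : (Fin N → ℤ) →ₗ[ℤ] (Fin N → ℤ) := Γ.subtype ∘ₗ e.symm.toLinearMap ∘ₗ r ∘ₗ A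
  have hLΓ : ∀ x, L x ∈ Γ := fun x => (e.symm (r (A x))).2
  have hL : ∀ n ∈ Γ, L n = n := fun n hn => by
    change ((e.symm (r (a ⟨n, hn⟩)) : Γ) : Fin N → ℤ) = n
    rw [hr, LinearEquiv.symm_apply_apply]
  have hcast : ∀ n, intMap (LinearMap.toMatrix' L) (c n) = c (L n) := fun n => by
    funext i
    rw [intMap_apply, hc]
    conv_rhs => rw [← LinearMap.toMatrix'_mulVec L n]
    simp [Matrix.mulVec, dotProduct, hc]
  refine ⟨LinearMap.toMatrix' L, fun i j hj => ?_, fun θ => ?_, fun θ hθ => ?_⟩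
  · rw [LinearMap.toMatrix'_apply]
    have : A (Pi.single j 1) = 0 := by
      funext k
      rw [hA]
      split_ifs with hk
      · exact Pi.single_eq_of_ne (by rintro rfl; exact hj hk) _
      · rfl
    have h2 : L (Pi.single j 1) = 0 := by simp [L, this]
    simpa [Pi.single_apply] using congrFun h2 i
  · rw [pi_eq_sum_univ' θ, map_sum]
    refine s.sum_mem fun j _ => ?_
    rw [map_smul]
    refine s.smul_mem _ ?_
    have : (Pi.single j 1 : Fin N → ℝ) = c (Pi.single j 1) := by
      funext k
      rw [hc, Pi.single_apply, Pi.single_apply]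
      split_ifs <;> simp
    rw [this, hcast]
    exact hLΓ _
  · rw [← hs] at hθ
    induction hθ using Submodule.span_induction with
    | mem θ h =>
      obtain ⟨h1, n, rfl⟩ := h
      exact (hcast n).trans (congrArg c (hL n h1))
    | zero => exact map_zero _
    | add x y _ _ hx hy => rw [map_add, hx, hy]
    | smul x y _ hy => rw [map_smul, hy]

/-! ### Division by a freely acting torus -/

/-- The monomial map `t ↦ (∏ t_j ^ P_ij)_i` of the torus. -/
def torusPow {N : ℕ} (P : Matrix (Fin N) (Fin N) ℤ) (t : StdTorus N) : StdTorus N :=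
  fun i => ∏ j, t j ^ P i j

theorem continuous_torusPow {N : ℕ} (P : Matrix (Fin N) (Fin N) ℤ) : Continuous (torusPow P) := by
  unfold torusPow
  fun_prop

theorem torusPow_mul {N : ℕ} (P : Matrix (Fin N) (Fin N) ℤ) (s t : StdTorus N) :
    torusPow P (s * t) = torusPow P s * torusPow P t := by
  funext i
  simp [torusPow, mul_zpow, Finset.prod_mul_distrib]

theorem torusPow_torusExp {N : ℕ} (P : Matrix (Fin N) (Fin N) ℤ) (θ : Fin N → ℝ) :
    torusPow P (torusExp θ) = torusExp (intMap P θ) := by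
  funext i
  simp only [torusPow, torusExp, intMap_apply, ← Circle.exp_intCast_mul, Finset.mul_sum]
  have hsum : ∀ f : Fin N → ℝ, Circle.exp (∑ j, f j) = ∏ j, Circle.exp (f j) := fun f => by
    have := map_sum Circle.expHom f Finset.univ
    exact congrArg Additive.toMul this
  rw [hsum]
  exact Finset.prod_congr rfl fun j _ => congrArg _ (by ring)

theorem torusPow_mem {N : ℕ} {s : Submodule ℝ (Fin N → ℝ)} {P : Matrix (Fin N) (Fin N) ℤ}
    (hP : ∀ θ, intMap P θ ∈ s) (t : StdTorus N) : torusPow P t ∈ expSubgroup s := by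
  obtain ⟨θ, rfl⟩ := exists_torusExp_eq t
  exact ⟨_, hP θ, (torusPow_torusExp P θ).symm⟩

theorem torusPow_eq_self {N : ℕ} {s : Submodule ℝ (Fin N → ℝ)} {P : Matrix (Fin N) (Fin N) ℤ}
    (hP : ∀ θ ∈ s, intMap P θ = θ) {t : StdTorus N} (ht : t ∈ expSubgroup s) :
    torusPow P t = t := by
  obtain ⟨θ, hθ, rfl⟩ := ht
  rw [torusPow_torusExp, hP θ hθ]

/-- The monomial with exponents `m` in the variables `z`; negative exponents are realized by
powers of the conjugate variables. -/
def confMonomial {N : ℕ} (m : Fin N → ℤ) (z : Fin N → ℂ) : ℂ :=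
  ∏ j, (z j ^ (m j).toNat * (starRingEnd ℂ (z j)) ^ (-m j).toNat)

theorem continuous_confMonomial {N : ℕ} (m : Fin N → ℤ) : Continuous (confMonomial m) := by
  unfold confMonomial
  fun_prop

theorem confMonomial_rotate {N : ℕ} (m : Fin N → ℤ) (t : StdTorus N) (z : Fin N → ℂ) :
    confMonomial m (rotate t z) = ((∏ j, t j ^ m j : Circle) : ℂ) * confMonomial m z := by
  have hprod : ((∏ j, t j ^ m j : Circle) : ℂ) = ∏ j, ((t j ^ m j : Circle) : ℂ) :=
    map_prod Circle.coeHom _ _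
  simp only [confMonomial, rotate, map_mul, mul_pow]
  rw [hprod, ← Finset.prod_mul_distrib]
  refine Finset.prod_congr rfl fun j _ => ?_
  have h : ((t j : ℂ) ^ (m j).toNat) * (starRingEnd ℂ (t j)) ^ (-m j).toNat
      = ((t j ^ m j : Circle) : ℂ) := by
    rw [← Circle.coe_inv_eq_conj, Circle.coe_zpow, Circle.coe_inv, ← zpow_natCast,
      ← zpow_natCast, inv_zpow', ← zpow_add₀ (Circle.coe_ne_zero _)]
    congr 1
    omega
  rw [← h]
  ring

theorem confMonomial_ne_zero {N : ℕ} {m : Fin N → ℤ} {z : Fin N → ℂ}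
    (h : ∀ j, z j = 0 → m j = 0) : confMonomial m z ≠ 0 := by
  refine Finset.prod_ne_zero_iff.2 fun j _ => ?_
  by_cases hz : z j = 0
  · simp [h j hz]
  · exact mul_ne_zero (pow_ne_zero _ hz) (pow_ne_zero _ ((map_ne_zero _).2 hz))

/-- A continuous substitute for the quotient `z' / z` of two points of one orbit, which has the
phase of `t` at `(z, t z)`. For each possible support of points at which the action is free,
monomials in the coordinates of the support transform like the coordinates of the torus; the sum
over the supports does not vanish at any of these points. -/
theorem exists_division {N : ℕ} {s : Submodule ℝ (Fin N → ℝ)}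
    (hs : IsRationalSubspace (intLattice N) s) :
    ∃ F : (Fin N → ℂ) → (Fin N → ℂ) → Fin N → ℂ,
      (∀ i, Continuous fun p : (Fin N → ℂ) × (Fin N → ℂ) => F p.1 p.2 i) ∧
      (∀ t ∈ expSubgroup s, ∀ z z' i, F z (rotate t z') i = t i * F z z' i) ∧
      (∀ t ∈ expSubgroup s, ∀ z z' i, F (rotate t z) z' i = starRingEnd ℂ (t i) * F z z' i) ∧
      ∀ z, FreeAt s z → ∀ i, ∃ r : ℝ, 0 < r ∧ F z z i = r := by
  classical
  have hex : ∀ S : Finset (Fin N), ∃ P : Matrix (Fin N) (Fin N) ℤ,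
      (∃ z, FreeAt s z ∧ ∀ j, z j ≠ 0 ↔ j ∈ S) →
        (∀ i, ∀ j ∉ S, P i j = 0) ∧ ∀ t ∈ expSubgroup s, torusPow P t = t := by
    intro S
    by_cases h : ∃ z, FreeAt s z ∧ ∀ j, z j ≠ 0 ↔ j ∈ S
    · obtain ⟨z, hz, hzS⟩ := h
      obtain ⟨P, h1, h2, h3⟩ := exists_intMap_projection hs S fun θ hθ h =>
        hz.integral hθ fun j hj => h j ((hzS j).1 hj)
      exact ⟨P, fun _ => ⟨h1, fun t ht => torusPow_eq_self h3 ht⟩⟩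
    · exact ⟨0, fun h' => absurd h' h⟩
  choose P hP using hex
  let G : Finset (Finset (Fin N)) :=
    Finset.univ.filter fun S => ∃ z, FreeAt s z ∧ ∀ j, z j ≠ 0 ↔ j ∈ S
  have hG : ∀ S, S ∈ G ↔ ∃ z, FreeAt s z ∧ ∀ j, z j ≠ 0 ↔ j ∈ S := by simp [G]
  have hrot : ∀ S ∈ G, ∀ t ∈ expSubgroup s, ∀ z i,
      confMonomial (P S i) (rotate t z) = t i * confMonomial (P S i) z := by
    intro S hS t ht z i
    rw [confMonomial_rotate]
    have := congrFun ((hP S ((hG S).1 hS)).2 t ht) i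
    rw [torusPow] at this
    rw [this]
  refine ⟨fun z z' i => ∑ S ∈ G, starRingEnd ℂ (confMonomial (P S i) z) * confMonomial (P S i) z',
    fun i => ?_, fun t ht z z' i => ?_, fun t ht z z' i => ?_, fun z hz i => ?_⟩
  · have h := fun S => continuous_confMonomial (P S i)
    fun_prop
  · rw [Finset.mul_sum]
    refine Finset.sum_congr rfl fun S hS => ?_
    rw [hrot S hS t ht]
    ring
  · rw [Finset.mul_sum]
    refine Finset.sum_congr rfl fun S hS => ?_
    rw [hrot S hS t ht, map_mul]
    ring
  · refine ⟨∑ S ∈ G, Complex.normSq (confMonomial (P S i) z), ?_, ?_⟩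
    · refine Finset.sum_pos' (fun S _ => Complex.normSq_nonneg _)
        ⟨Finset.univ.filter fun j => z j ≠ 0, (hG _).2 ⟨z, hz, by simp⟩, ?_⟩
      refine Complex.normSq_pos.2 (confMonomial_ne_zero fun j hj => ?_)
      exact (hP _ ⟨z, hz, by simp⟩).1 i j (by simp [hj])
    · push_cast
      exact Finset.sum_congr rfl fun S _ => Complex.normSq_eq_conj_mul_self.symm

/-! ### Lifting maps to torus quotients -/

instance : ContractibleSpace Disc :=
  (convex_closedBall (0 : ℂ) 1).contractibleSpace ⟨0, by simp⟩

instance : ContractibleSpace I :=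
  (convex_Icc (0 : ℝ) 1).contractibleSpace ⟨0, by simp⟩

instance : CompactSpace Disc :=
  isCompact_iff_compactSpace.1 (isCompact_closedBall (0 : ℂ) 1)

/-- The direction of a nonzero complex number as a point of the circle. -/
def circlePhase (c : ℂ) : Circle := Circle.exp c.arg

theorem coe_circlePhase {c : ℂ} (hc : c ≠ 0) : (circlePhase c : ℂ) = c / ‖c‖ := by
  have h : (‖c‖ : ℂ) ≠ 0 := by simpa using hc
  rw [circlePhase, Circle.coe_exp, eq_div_iff h, mul_comm, Complex.norm_mul_exp_arg_mul_I]

theorem continuousOn_circlePhase : ContinuousOn circlePhase {c | c ≠ 0} := by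
  have hind : Topology.IsInducing (fun t : Circle => (t : ℂ)) := ⟨rfl⟩
  rw [hind.continuousOn_iff]
  refine ContinuousOn.congr (f := fun c => c / (‖c‖ : ℂ)) ?_ fun c hc => coe_circlePhase hc
  exact continuousOn_id.div (by fun_prop) fun c hc => by simpa using hc

theorem circlePhase_mul (t : Circle) {c : ℂ} (hc : c ≠ 0) :
    circlePhase (t * c) = t * circlePhase c := by
  ext
  rw [Circle.coe_mul, coe_circlePhase hc,
    coe_circlePhase (mul_ne_zero (Circle.coe_ne_zero t) hc), norm_mul, Circle.norm_coe, one_mul,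
    mul_div_assoc]

theorem circlePhase_pos {r : ℝ} (hr : 0 < r) : circlePhase r = 1 := by
  rw [circlePhase, Complex.arg_ofReal_of_nonneg hr.le, Circle.exp_zero]

/-- The element of a torus that moves a point to another point of its orbit depends continuously
on the two points wherever the action is free. -/
theorem continuous_of_rotate_eq {N : ℕ} {s : Submodule ℝ (Fin N → ℝ)}
    (hs : IsRationalSubspace (intLattice N) s) {B : Type*} [TopologicalSpace B]
    {z z' : B → Fin N → ℂ} (hz : Continuous z) (hz' : Continuous z') {t : B → StdTorus N}
    (ht : ∀ b, t b ∈ expSubgroup s) (hfree : ∀ b, FreeAt s (z b))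
    (h : ∀ b, z' b = rotate (t b) (z b)) : Continuous t := by
  obtain ⟨F, hF, hF1, -, hF3⟩ := exists_division hs
  refine continuous_pi fun i => ?_
  have key : ∀ b, F (z b) (z' b) i ≠ 0 ∧ t b i = circlePhase (F (z b) (z' b) i) := fun b => by
    obtain ⟨r, hr, hr'⟩ := hF3 (z b) (hfree b) i
    have hr0 : (r : ℂ) ≠ 0 := by exact_mod_cast hr.ne'
    rw [h b, hF1 _ (ht b), hr']
    exact ⟨mul_ne_zero (Circle.coe_ne_zero _) hr0, by
      rw [circlePhase_mul _ hr0, circlePhase_pos hr, mul_one]⟩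
  simp_rw [fun b => (key b).2]
  exact continuousOn_circlePhase.comp_continuous ((hF i).comp (hz.prodMk hz')) fun b => (key b).1

theorem isOpenQuotientMap_of_orbits {X Q G : Type*} [TopologicalSpace X] [TopologicalSpace Q]
    {q : X → Q} (hq : Topology.IsQuotientMap q) (a : G → X → X) (ha : ∀ g, Continuous (a g))
    (h : ∀ x x', q x = q x' ↔ ∃ g, a g x = x') : IsOpenQuotientMap q := by
  refine ⟨hq.surjective, hq.continuous, fun U hU => ?_⟩
  rw [← hq.isOpen_preimage]
  have : q ⁻¹' (q '' U) = ⋃ g, a g ⁻¹' U := by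
    ext x
    simp only [Set.mem_preimage, Set.mem_image, Set.mem_iUnion]
    constructor
    · rintro ⟨u, hu, e⟩
      obtain ⟨g, rfl⟩ := (h x u).1 e.symm
      exact ⟨g, hu⟩
    · rintro ⟨g, hg⟩
      exact ⟨_, hg, ((h x _).2 ⟨g, rfl⟩).symm⟩
  rw [this]
  exact isOpen_iUnion fun g => hU.preimage (ha g)

theorem continuous_rotate_uncurry {N : ℕ} :
    Continuous fun p : StdTorus N × (Fin N → ℂ) => rotate p.1 p.2 := by
  refine continuous_pi fun j => Continuous.mul ?_ (by fun_prop)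
  exact continuous_induced_dom.comp
    (by fun_prop : Continuous fun p : StdTorus N × (Fin N → ℂ) => p.1 j)

theorem continuous_rotate {N : ℕ} (t : StdTorus N) : Continuous (rotate t) :=
  continuous_rotate_uncurry.comp (by fun_prop : Continuous fun z => (t, z))

/-- Maps from contractible compact spaces to the quotient of a set `M` by a free action of a torus
lift to `M`: the point of an orbit `[z']` closest in phase to a given nearby point `z` serves as a
transport between fibres. -/
theorem exists_lift {N : ℕ} {s : Submodule ℝ (Fin N → ℝ)}
    (hs : IsRationalSubspace (intLattice N) s) {M : Set (Fin N → ℂ)} {Q : Type*}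
    [TopologicalSpace Q] {q : M → Q} (hq : Topology.IsQuotientMap q)
    (hinv : ∀ t ∈ expSubgroup s, ∀ z ∈ M, rotate t z ∈ M) (hfree : ∀ z ∈ M, FreeAt s z)
    (hfib : ∀ z z' : M, q z = q z' ↔ ∃ t ∈ expSubgroup s, rotate t z.1 = z'.1)
    {B : Type*} [TopologicalSpace B] [CompactSpace B] [ContractibleSpace B] (W : C(B, Q)) :
    ∃ Z : C(B, M), ∀ b, q (Z b) = W b := by
  obtain ⟨F, hF, hF1, hF2, hF3⟩ := exists_division hs
  obtain ⟨P, -, hP1, hP2⟩ := exists_intMap_projection hs Finset.univ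
    fun θ _ h j => h j (Finset.mem_univ j)
  have hqo : IsOpenQuotientMap q := by
    refine isOpenQuotientMap_of_orbits (G := expSubgroup s) hq
      (fun t z => ⟨rotate t z.1, hinv t t.2 z z.2⟩)
      (fun t => ((continuous_rotate _).comp continuous_subtype_val).subtype_mk _) fun z z' => ?_
    rw [hfib]
    simp [Subtype.ext_iff]
  let ν : M × M → StdTorus N := fun p => torusPow P fun i => circlePhase (F p.1 p.2 i)
  have hν : ∀ p, ν p ∈ expSubgroup s := fun p => torusPow_mem hP1 _
  -- `T (z, z')` depends only on `z` and the orbit of `z'`, and is a point of that orbit.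
  let T : M × M → M := fun p => ⟨rotate (ν p)⁻¹ p.2, hinv _ (inv_mem (hν p)) _ p.2.2⟩
  let U : Set (M × M) := {p | ∀ i, F p.1 p.2 i ≠ 0}
  have hU : IsOpen U := by
    simp only [U, Set.ofPred_forall]
    refine isOpen_iInter_of_finite fun i => isOpen_ne_fun ?_ continuous_const
    exact (hF i).comp (by fun_prop : Continuous fun p : M × M => (p.1.1, p.2.1))
  have hT : ContinuousOn T U := by
    rw [Topology.IsInducing.subtypeVal.continuousOn_iff]
    have hν' : ContinuousOn ν U := (continuous_torusPow P).comp_continuousOn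
      (continuousOn_pi.2 fun i => continuousOn_circlePhase.comp
        ((hF i).comp (by fun_prop : Continuous fun p : M × M => (p.1.1, p.2.1))).continuousOn
        fun p hp => hp i)
    have h2 : ContinuousOn (fun p : M × M => ((ν p)⁻¹, p.2.1)) U :=
      hν'.inv.prodMk (continuous_subtype_val.comp continuous_snd).continuousOn
    exact continuous_rotate_uncurry.comp_continuousOn h2
  have hTinv : ∀ z z' z'' : M, q z' = q z'' → (z, z') ∈ U →
      (z, z'') ∈ U ∧ T (z, z') = T (z, z'') := by
    intro z z' z'' h hz
    obtain ⟨t, ht, htz⟩ := (hfib _ _).1 h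
    have h1 : ∀ i, F z z'' i = t i * F z z' i := fun i => by rw [← htz, hF1 t ht]
    refine ⟨fun i => ?_, ?_⟩
    · change F z z'' i ≠ 0
      rw [h1]
      exact mul_ne_zero (Circle.coe_ne_zero _) (hz i)
    · have h2 : ν (z, z'') = t * ν (z, z') := by
        have : (fun i => circlePhase (F z z'' i)) = t * fun i => circlePhase (F z z' i) := by
          funext i
          rw [h1, circlePhase_mul _ (hz i), Pi.mul_apply]
        change torusPow P (fun i => circlePhase (F z z'' i)) = _
        rw [this, torusPow_mul, torusPow_eq_self hP2 ht]
      ext1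
      change rotate (ν (z, z'))⁻¹ z'.1 = rotate (ν (z, z''))⁻¹ z''.1
      rw [h2, ← htz, ← rotate_mul, mul_inv_rev, inv_mul_cancel_right]
  have hO : IsOpen ((fun p : B × B => (W p.1, W p.2)) ⁻¹' (Prod.map q q '' U)) :=
    ((hqo.prodMap hqo).isOpenMap _ hU).preimage (by fun_prop)
  refine of_contraction hO (fun b => ?_) (fun φ => ∃ Z : C(B, M), ∀ b, q (Z b) = W (φ b))
    (fun b => ?_) ?_
  · obtain ⟨z, hz⟩ := hq.surjective (W b)
    refine ⟨(z, z), fun i => ?_, by simp [hz]⟩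
    obtain ⟨r, hr, hr'⟩ := hF3 z (hfree z z.2) i
    change F z z i ≠ 0
    rw [hr']
    exact_mod_cast hr.ne'
  · obtain ⟨z, hz⟩ := hq.surjective (W b)
    exact ⟨ContinuousMap.const B z, fun _ => hz⟩
  · rintro φ ψ h ⟨Z, hZ⟩
    let τ : M × Q → M := fun p => T (p.1, Function.surjInv hq.surjective p.2)
    have key : ∀ b, ∃ z' : M, q z' = W (ψ b) ∧ (Z b, z') ∈ U := by
      intro b
      obtain ⟨⟨w, w'⟩, hw, e⟩ := h b
      rw [Prod.map_apply, Prod.mk.injEq] at e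
      obtain ⟨t, ht, htz⟩ := (hfib _ _).1 (e.1.trans (hZ b).symm)
      refine ⟨w', e.2, fun i => ?_⟩
      change F (Z b) w' i ≠ 0
      rw [← htz, hF2 t ht]
      exact mul_ne_zero ((map_ne_zero _).2 (Circle.coe_ne_zero _)) (hw i)
    have hτq : ∀ p, q (τ p) = p.2 := fun p => by
      have h1 := Function.surjInv_eq hq.surjective p.2
      conv_rhs => rw [← h1]
      exact ((hfib _ _).2 ⟨_, inv_mem (hν _), rfl⟩).symm
    have hτ : ∀ z z' : M, (z, z') ∈ U → ContinuousAt τ (z, q z') := by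
      intro z z' hz
      have hid : IsOpenQuotientMap (Prod.map (id : M → M) q) := IsOpenQuotientMap.id.prodMap hqo
      refine (hid.continuousAt_comp_iff (x := (z, z'))).1 ?_
      refine (hT.continuousAt (hU.mem_nhds hz)).congr ?_
      filter_upwards [hU.mem_nhds hz] with p hp
      exact (hTinv p.1 p.2 _ (Function.surjInv_eq hq.surjective _).symm hp).2
    refine ⟨⟨fun b => τ (Z b, W (ψ b)), continuous_iff_continuousAt.2 fun b => ?_⟩, fun b => hτq _⟩
    obtain ⟨z', hz', hb⟩ := key b
    have := hτ _ _ hb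
    rw [hz'] at this
    exact ContinuousAt.comp (f := fun b => (Z b, W (ψ b))) this (by fun_prop)

/-! ### Angles of paths in tori -/

theorem torusExp_eq_const {N : ℕ} {B : Type*} [TopologicalSpace B] [PreconnectedSpace B]
    {g : B → Fin N → ℝ} (hg : Continuous g) {c : StdTorus N} (h : ∀ b, torusExp (g b) = c)
    (a b : B) : g a = g b := by
  funext j
  refine eq_of_exp_turns_eq (g := fun b => g b j) (c := c j) (by fun_prop) (fun b => ?_) a b
  have := congrArg ((↑) : Circle → ℂ) (congrFun (h b) j)
  rw [torusExp, Circle.coe_exp] at this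
  simpa using this

theorem exists_continuous_angles {N : ℕ} {B : Type*} [TopologicalSpace B] [CompactSpace B]
    [ContractibleSpace B] {t : B → StdTorus N} (ht : Continuous t) :
    ∃ φ : C(B, Fin N → ℝ), ∀ b, torusExp (φ b) = t b := by
  have hc : Continuous fun x : Circle => (x : ℂ) := continuous_induced_dom
  have key : ∀ j, ∃ θ : C(B, ℝ), ∀ b, Circle.exp (2 * π * θ b) = t b j := fun j => by
    obtain ⟨θ, hθ⟩ := exists_continuous_turns
      (⟨fun b => (t b j : ℂ), hc.comp (by fun_prop)⟩ : C(B, ℂ)) fun b => Circle.coe_ne_zero _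
    refine ⟨θ, fun b => ?_⟩
    ext
    have := hθ b
    simp only [ContinuousMap.coe_mk, Circle.norm_coe, Complex.ofReal_one, one_mul] at this
    rw [this, Circle.coe_exp]
    simp
  choose θ hθ using key
  exact ⟨⟨fun b j => θ j b, by fun_prop⟩, fun b => funext fun j => hθ j b⟩

/-- Angles of a path in the subtorus `exp(s)` stay in one translate of `s`: their difference to
their image under an integral projection onto `s` is a continuous lattice vector. -/
theorem sub_mem_of_torusExp_mem {N : ℕ} {s : Submodule ℝ (Fin N → ℝ)}
    (hs : IsRationalSubspace (intLattice N) s) (φ : C(I, Fin N → ℝ))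
    (h : ∀ τ, torusExp (φ τ) ∈ expSubgroup s) : φ 1 - φ 0 ∈ s := by
  obtain ⟨P, -, hP1, hP2⟩ := exists_intMap_projection hs Finset.univ
    fun θ _ h j => h j (Finset.mem_univ j)
  have hc : Continuous fun τ => intMap P (φ τ) - φ τ := by
    have : Continuous (intMap P) := LinearMap.continuous_of_finiteDimensional _
    fun_prop
  have key := torusExp_eq_const hc (c := 1) (fun τ => by
    rw [sub_eq_add_neg, torusExp_add, torusExp_neg, ← torusPow_torusExp,
      torusPow_eq_self hP2 (h τ), mul_inv_cancel]) 1 0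
  have : intMap P (φ 1 - φ 0) = φ 1 - φ 0 := by
    rw [map_sub]
    have := key
    rw [sub_eq_sub_iff_add_eq_add] at this ⊢
    rw [this, add_comm]
  rw [← this]
  exact hP1 _

theorem bdryPoint_zero_eq_one : bdryPoint 0 = bdryPoint 1 := by
  ext
  simp [bdryPoint]

theorem continuous_bdryPoint : Continuous bdryPoint := by
  have hc : Continuous fun x : Circle => (x : ℂ) := continuous_induced_dom
  exact Continuous.subtype_mk (hc.comp (by fun_prop)) _

theorem norm_bdryPoint (τ : ℝ) : ‖(bdryPoint τ).1‖ = 1 := Circle.norm_coe _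

/-! ### The quotients `Y` and `X` as torus quotients of subsets of `ℂ^N` -/

namespace ToricManifold
variable {N : ℕ} (Y : ToricManifold N)

theorem mk_eq_mk_iff (z z' : Y.Level) :
    ((Quotient.mk Y.orbitSetoid z : Y.Space) = Quotient.mk Y.orbitSetoid z') ↔
      ∃ t ∈ expSubgroup Y.k, rotate t z.1 = z'.1 := Quotient.eq

variable {Y}

theorem Represents.freeAt {z : Fin N → ℂ} {y : Y.Space} (h : Y.Represents z y) : FreeAt Y.k z :=
  Y.free z h.1

theorem Represents.exists_rotate {z z' : Fin N → ℂ} {y : Y.Space} (h : Y.Represents z y)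
    (h' : Y.Represents z' y) : ∃ t ∈ expSubgroup Y.k, rotate t z = z' := by
  obtain ⟨h1, rfl⟩ := h
  obtain ⟨h2, e⟩ := h'
  exact (Y.mk_eq_mk_iff ⟨z, h1⟩ ⟨z', h2⟩).1 e.symm

end ToricManifold

namespace ToricReduction
variable {N : ℕ} {Y : ToricManifold N} (R : ToricReduction Y)

theorem k_le_hLift : Y.k ≤ R.hLift := fun θ hθ => by
  have : Y.k.mkQ θ = 0 := (Submodule.Quotient.mk_eq_zero _).2 hθ
  rw [hLift, Submodule.mem_comap, this]
  exact R.h.zero_mem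

theorem expSubgroup_k_le : expSubgroup Y.k ≤ expSubgroup R.hLift := by
  rintro _ ⟨θ, hθ, rfl⟩
  exact ⟨θ, R.k_le_hLift hθ, rfl⟩

/-- The preimage of `T^k` in `T^N` is a subtorus. -/
theorem hLift_rational : IsRationalSubspace (intLattice N) R.hLift := by
  refine le_antisymm (Submodule.span_le.2 fun θ h => h.1) fun θ hθ => ?_
  have hk : Y.k ≤ Submodule.span ℝ ((R.hLift : Set (Fin N → ℝ)) ∩ intLattice N) := by
    have := Y.rational
    rw [IsRationalSubspace] at this
    rw [← this]
    exact Submodule.span_mono (Set.inter_subset_inter_left _ R.k_le_hLift)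
  have h1 : Y.k.mkQ θ ∈ Submodule.span ℝ ((R.h : Set Y.Lie) ∩ Y.lattice) := by
    rw [R.rational]
    exact hθ
  have h2 : Submodule.span ℝ ((R.h : Set Y.Lie) ∩ Y.lattice) ≤
      (Submodule.span ℝ ((R.hLift : Set (Fin N → ℝ)) ∩ intLattice N)).map Y.k.mkQ := by
    rw [Submodule.span_le]
    rintro _ ⟨hx, u, hu, rfl⟩
    exact ⟨u, Submodule.subset_span ⟨hx, hu⟩, rfl⟩
  obtain ⟨η, hη, e⟩ := h2 h1
  have h3 : θ - η ∈ Y.k := by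
    rw [← Submodule.Quotient.mk_eq_zero, ← Submodule.mkQ_apply, map_sub, e, sub_self]
  have := Submodule.add_mem _ (hk h3) hη
  rwa [sub_add_cancel] at this

/-- The preimage of `μ⁻¹(c)` in `ℂ^N`. -/
def zLevel : Set (Fin N → ℂ) :=
  {z | ∃ h : z ∈ Y.Level, (Quotient.mk Y.orbitSetoid ⟨z, h⟩ : Y.Space) ∈ R.Level}

theorem rotate_mem_zLevel (t : StdTorus N) {z : Fin N → ℂ} (hz : z ∈ R.zLevel) :
    rotate t z ∈ R.zLevel := by
  obtain ⟨h, h'⟩ := hz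
  refine ⟨Y.rotate_mem_level t h, ?_⟩
  have : Y.moment (Quotient.mk Y.orbitSetoid ⟨rotate t z, Y.rotate_mem_level t h⟩) =
      Y.moment (Quotient.mk Y.orbitSetoid ⟨z, h⟩) := by
    simp only [ToricManifold.moment, Quotient.lift_mk, stdMoment_rotate]
  change (Y.moment _).comp _ = _
  rw [this]
  exact h'

theorem freeAt_of_mem_zLevel {z : Fin N → ℂ} (hz : z ∈ R.zLevel) : FreeAt R.hLift z := by
  obtain ⟨h, h'⟩ := hz
  intro t ht htz
  have h1 : (QuotientGroup.mk t : Y.ResTorus) = 1 := by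
    refine R.free _ h' _ ⟨t, ht, rfl⟩ ?_
    exact Quotient.sound ⟨1, Y.K.one_mem, by rw [rotate_one]; exact htz⟩
  rw [QuotientGroup.eq_one_iff] at h1
  exact Y.free z h t h1 htz

/-- The quotient map from a subset of `ℂ^N` to the symplectic quotient. -/
def zProj (z : R.zLevel) : R.Space := R.proj ⟨_, z.2.2⟩

theorem isQuotientMap_zProj : Topology.IsQuotientMap R.zProj := by
  have hY : IsOpenQuotientMap (Quotient.mk Y.orbitSetoid : Y.Level → Y.Space) := by
    refine isOpenQuotientMap_of_orbits (G := expSubgroup Y.k) isQuotientMap_quot_mk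
      (fun t z => ⟨rotate t z.1, Y.rotate_mem_level t z.2⟩)
      (fun t => ((continuous_rotate _).comp continuous_subtype_val).subtype_mk _) fun z z' => ?_
    refine (Y.mk_eq_mk_iff z z').trans ?_
    simp [Subtype.ext_iff]
  have h1 := (hY.restrictPreimage R.Level).isQuotientMap
  have h2 : Topology.IsQuotientMap R.proj := isQuotientMap_quot_mk
  let e : R.zLevel ≃ₜ (Quotient.mk Y.orbitSetoid : Y.Level → Y.Space) ⁻¹' R.Level :=
    { toFun := fun z => ⟨⟨z.1, z.2.1⟩, z.2.2⟩
      invFun := fun z => ⟨z.1.1, z.1.2, z.2⟩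
      left_inv := fun _ => rfl
      right_inv := fun _ => rfl
      continuous_toFun := by fun_prop
      continuous_invFun := by fun_prop }
  exact (h2.comp h1).comp e.isQuotientMap

theorem zProj_eq_iff (z z' : R.zLevel) :
    R.zProj z = R.zProj z' ↔ ∃ t ∈ expSubgroup R.hLift, rotate t z.1 = z'.1 := by
  refine Quotient.eq.trans ⟨?_, ?_⟩
  · rintro ⟨_, ⟨t, ht, rfl⟩, e⟩
    obtain ⟨s, hs, e'⟩ := (Y.mk_eq_mk_iff ⟨_, Y.rotate_mem_level t z.2.1⟩ ⟨_, z'.2.1⟩).1 e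
    exact ⟨s * t, mul_mem (R.expSubgroup_k_le hs) ht, (rotate_mul _ _ _).trans e'⟩
  · rintro ⟨t, ht, e⟩
    refine ⟨_, ⟨t, ht, rfl⟩, ?_⟩
    exact (Y.mk_eq_mk_iff ⟨_, Y.rotate_mem_level t z.2.1⟩ ⟨_, z'.2.1⟩).2
      ⟨1, one_mem _, (rotate_one _).trans e⟩

variable {R}

theorem represents_iff {z : Fin N → ℂ} {x : R.Space} :
    R.Represents z x ↔ ∃ h : z ∈ R.zLevel, R.zProj ⟨z, h⟩ = x := by
  constructor
  · rintro ⟨⟨_, hy⟩, ⟨h, rfl⟩, rfl⟩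
    exact ⟨⟨h, hy⟩, rfl⟩
  · rintro ⟨h, rfl⟩
    exact ⟨⟨_, h.2⟩, ⟨h.1, rfl⟩, rfl⟩

theorem Represents.freeAt {z : Fin N → ℂ} {x : R.Space} (h : R.Represents z x) :
    FreeAt R.hLift z := R.freeAt_of_mem_zLevel (represents_iff.1 h).1

theorem Represents.exists_rotate {z z' : Fin N → ℂ} {x : R.Space} (h : R.Represents z x)
    (h' : R.Represents z' x) : ∃ t ∈ expSubgroup R.hLift, rotate t z = z' := by
  obtain ⟨h1, rfl⟩ := represents_iff.1 h
  obtain ⟨h2, e⟩ := represents_iff.1 h'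
  exact (R.zProj_eq_iff ⟨z, h1⟩ ⟨z', h2⟩).1 e.symm

theorem represents_of_mem_lag {p : Y.Space × R.Space} (hp : p ∈ R.Lag) {z : Fin N → ℂ}
    (hz : Y.Represents z p.1) : R.Represents z p.2 := by
  obtain ⟨y, rfl⟩ := hp
  exact ⟨y, hz, rfl⟩

variable (R)

/-- Maps from contractible compact spaces to `Y × X` lift to `ℂ^N × ℂ^N`. -/
theorem exists_lift_pair {B : Type*} [TopologicalSpace B] [CompactSpace B] [ContractibleSpace B]
    (W : C(B, Y.Space × R.Space)) : ∃ Z Z' : C(B, Fin N → ℂ),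
      ∀ b, Y.Represents (Z b) (W b).1 ∧ R.Represents (Z' b) (W b).2 := by
  obtain ⟨Z, hZ⟩ := exists_lift (M := Y.Level)
    (q := fun z => (Quotient.mk Y.orbitSetoid z : Y.Space))
    Y.rational isQuotientMap_quot_mk
    (fun t _ z hz => Y.rotate_mem_level t hz) Y.free Y.mk_eq_mk_iff
    ((⟨Prod.fst, continuous_fst⟩ : C(Y.Space × R.Space, Y.Space)).comp W)
  obtain ⟨Z', hZ'⟩ := exists_lift R.hLift_rational R.isQuotientMap_zProj
    (fun t _ z hz => R.rotate_mem_zLevel t hz) (fun z hz => R.freeAt_of_mem_zLevel hz)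
    R.zProj_eq_iff ((⟨Prod.snd, continuous_snd⟩ : C(Y.Space × R.Space, R.Space)).comp W)
  refine ⟨⟨fun b => Z b, by fun_prop⟩, ⟨fun b => Z' b, by fun_prop⟩, fun b =>
    ⟨⟨(Z b).2, hZ b⟩, represents_iff.2 ⟨(Z' b).2, hZ' b⟩⟩⟩

/-! ### The transition path of a disc bounded by the Lagrangian correspondence -/

variable {R}

/-- `φ` is a path of angles of the elements of the torus `exp(hLift)` that move the first component
of a lift of a disc to the second one, along the boundary of the disc. -/
def IsTransition {w : C(Disc, Y.Space × R.Space)} (l : R.DiscLift w) (φ : C(I, Fin N → ℝ)) :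
    Prop :=
  ∀ τ : I, torusExp (φ τ) ∈ expSubgroup R.hLift ∧
    l.snd (bdryPoint τ) = rotate (torusExp (φ τ)) (l.fst (bdryPoint τ))

theorem exists_angles {B : Type*} [TopologicalSpace B] [CompactSpace B] [ContractibleSpace B]
    {W : B → Y.Space × R.Space} (hW : ∀ b, W b ∈ R.Lag) (Z Z' : C(B, Fin N → ℂ))
    (hZ : ∀ b, Y.Represents (Z b) (W b).1) (hZ' : ∀ b, R.Represents (Z' b) (W b).2) :
    ∃ φ : C(B, Fin N → ℝ), ∀ b, torusExp (φ b) ∈ expSubgroup R.hLift ∧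
      Z' b = rotate (torusExp (φ b)) (Z b) := by
  have key : ∀ b, ∃ t ∈ expSubgroup R.hLift, rotate t (Z b) = Z' b := fun b =>
    (represents_of_mem_lag (hW b) (hZ b)).exists_rotate (hZ' b)
  choose t ht htZ using key
  have hc : Continuous t := continuous_of_rotate_eq R.hLift_rational Z.continuous Z'.continuous ht
    (fun b => (represents_of_mem_lag (hW b) (hZ b)).freeAt) fun b => (htZ b).symm
  obtain ⟨φ, hφ⟩ := exists_continuous_angles hc
  exact ⟨φ, fun b => by rw [hφ]; exact ⟨ht b, (htZ b).symm⟩⟩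

theorem exists_isTransition {w : C(Disc, Y.Space × R.Space)} (hw : R.IsBounded w)
    (l : R.DiscLift w) : ∃ φ, IsTransition l φ :=
  exists_angles (W := fun τ : I => w (bdryPoint τ)) (fun τ => hw _ (norm_bdryPoint τ))
    (l.fst.comp ⟨fun τ : I => bdryPoint τ, continuous_bdryPoint.comp continuous_subtype_val⟩)
    (l.snd.comp ⟨fun τ : I => bdryPoint τ, continuous_bdryPoint.comp continuous_subtype_val⟩)
    (fun _ => l.fst_rep _) (fun _ => l.snd_rep _)

/-- The winding of the transition path does not depend on the lift, as two lifts differ by a map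
from the disc to the acting torus. -/
theorem IsTransition.sub_eq {w : C(Disc, Y.Space × R.Space)} (hw : R.IsBounded w)
    {l l' : R.DiscLift w} {φ φ' : C(I, Fin N → ℝ)} (h : IsTransition l φ)
    (h' : IsTransition l' φ') : φ 1 - φ 0 = φ' 1 - φ' 0 := by
  have h1 : ∀ ζ, ∃ t ∈ expSubgroup Y.k, rotate t (l.fst ζ) = l'.fst ζ := fun ζ =>
    (l.fst_rep ζ).exists_rotate (l'.fst_rep ζ)
  have h2 : ∀ ζ, ∃ t ∈ expSubgroup R.hLift, rotate t (l.snd ζ) = l'.snd ζ := fun ζ =>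
    (l.snd_rep ζ).exists_rotate (l'.snd_rep ζ)
  choose g hg hgl using h1
  choose g' hg' hgl' using h2
  obtain ⟨γ, hγ⟩ := exists_continuous_angles (continuous_of_rotate_eq Y.rational l.fst.continuous
    l'.fst.continuous hg (fun ζ => (l.fst_rep ζ).freeAt) fun ζ => (hgl ζ).symm)
  obtain ⟨γ', hγ'⟩ := exists_continuous_angles (continuous_of_rotate_eq R.hLift_rational
    l.snd.continuous l'.snd.continuous hg' (fun ζ => (l.snd_rep ζ).freeAt) fun ζ => (hgl' ζ).symm)
  have hc : Continuous fun τ : I => φ' τ + γ (bdryPoint τ) - (γ' (bdryPoint τ) + φ τ) := by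
    have := continuous_bdryPoint
    fun_prop
  have key := torusExp_eq_const hc (c := 1) (fun τ => ?_) 1 0
  · simp only [Set.Icc.coe_one, Set.Icc.coe_zero, bdryPoint_zero_eq_one] at key
    generalize γ (bdryPoint 1) = a at key
    generalize γ' (bdryPoint 1) = b at key
    have e : φ' 1 - φ 1 = φ' 0 - φ 0 := by
      have e1 : φ' 1 + a - (b + φ 1) = φ' 1 - φ 1 + (a - b) := by abel
      have e0 : φ' 0 + a - (b + φ 0) = φ' 0 - φ 0 + (a - b) := by abel
      rw [e1, e0] at key
      exact add_right_cancel key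
    rw [sub_eq_sub_iff_add_eq_add] at e ⊢
    rw [add_comm (φ 1), ← e, add_comm]
  · rw [sub_eq_add_neg, torusExp_add, torusExp_add, torusExp_neg, torusExp_add, hγ, hγ']
    have hfree : FreeAt R.hLift (l.fst (bdryPoint τ)) :=
      (represents_of_mem_lag (hw _ (norm_bdryPoint τ)) (l.fst_rep _)).freeAt
    refine hfree _ (mul_mem (mul_mem (h' τ).1 (R.expSubgroup_k_le (hg _)))
      (inv_mem (mul_mem (hg' _) (h τ).1))) ?_
    rw [mul_comm, rotate_mul, rotate_mul, hgl, ← (h' τ).2, ← hgl', (h τ).2, ← rotate_mul,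
      ← rotate_mul, mul_assoc, inv_mul_cancel, rotate_one]

/-- The winding of the transition path is constant along homotopies of discs bounded by the
Lagrangian correspondence. -/
theorem IsTransition.sub_eq_of_homotopic {w w' : C(Disc, Y.Space × R.Space)}
    (hww' : w.HomotopicWith w' R.IsBounded) {l : R.DiscLift w} {l' : R.DiscLift w'}
    {φ φ' : C(I, Fin N → ℝ)} (h : IsTransition l φ) (h' : IsTransition l' φ') :
    φ 1 - φ 0 = φ' 1 - φ' 0 := by
  obtain ⟨F⟩ := hww'
  have hF : ∀ (s : I) (ζ : Disc), ‖ζ.1‖ = 1 → F (s, ζ) ∈ R.Lag := fun s ζ hζ => F.prop s ζ hζ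
  obtain ⟨Z, Z', hZ⟩ := R.exists_lift_pair (F.toContinuousMap)
  let β : C(I × I, I × Disc) := ⟨fun p => (p.1, bdryPoint p.2), by
    have := continuous_bdryPoint
    fun_prop⟩
  obtain ⟨ψ, hψ⟩ := exists_angles (W := fun p : I × I => F (β p))
    (fun p => hF _ _ (norm_bdryPoint p.2)) (Z.comp β) (Z'.comp β)
    (fun p => (hZ _).1) (fun p => (hZ _).2)
  have hconst : ∀ a b : I, ψ (a, 1) - ψ (a, 0) = ψ (b, 1) - ψ (b, 0) := by
    refine torusExp_eq_const (c := 1) (by fun_prop) fun a => ?_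
    rw [sub_eq_add_neg, torusExp_add, torusExp_neg, mul_inv_eq_one]
    have hβ : β (a, 1) = β (a, 0) := by
      simp [β, bdryPoint_zero_eq_one]
    have hfree : FreeAt R.hLift (Z (β (a, 0))) :=
      (represents_of_mem_lag (hF _ _ (norm_bdryPoint _)) (hZ (β (a, 0))).1).freeAt
    have e1 := (hψ (a, 1)).2
    have e0 := (hψ (a, 0)).2
    simp only [ContinuousMap.comp_apply] at e0 e1
    rw [hβ, e0] at e1
    rw [← inv_mul_eq_one]
    refine hfree _ (mul_mem (inv_mem (hψ _).1) (hψ _).1) ?_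
    rw [rotate_mul, e1, ← rotate_mul, inv_mul_cancel, rotate_one]
  have hw : R.IsBounded w := fun ζ hζ => by
    have := hF 0 ζ hζ
    simpa using this
  have hw' : R.IsBounded w' := fun ζ hζ => by
    have := hF 1 ζ hζ
    simpa using this
  let l₀ : R.DiscLift w :=
    { fst := Z.comp ⟨fun ζ => (0, ζ), by fun_prop⟩
      snd := Z'.comp ⟨fun ζ => (0, ζ), by fun_prop⟩
      fst_rep := fun ζ => by
        have := (hZ (0, ζ)).1
        simpa using this
      snd_rep := fun ζ => by
        have := (hZ (0, ζ)).2
        simpa using this }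
  let l₁ : R.DiscLift w' :=
    { fst := Z.comp ⟨fun ζ => (1, ζ), by fun_prop⟩
      snd := Z'.comp ⟨fun ζ => (1, ζ), by fun_prop⟩
      fst_rep := fun ζ => by
        have := (hZ (1, ζ)).1
        simpa using this
      snd_rep := fun ζ => by
        have := (hZ (1, ζ)).2
        simpa using this }
  have h₀ : IsTransition l₀ ⟨fun τ => ψ (0, τ), by fun_prop⟩ := fun τ => hψ (0, τ)
  have h₁ : IsTransition l₁ ⟨fun τ => ψ (1, τ), by fun_prop⟩ := fun τ => hψ (1, τ)
  exact (h.sub_eq hw h₀).trans ((hconst 0 1).trans (h₁.sub_eq hw' h'))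

end ToricReduction

/-! ### The winding vector of a basic disc -/

/-- The argument of a nowhere vanishing function on the disc does not wind along the boundary, so
neither does a path of angles that compensates it. -/
theorem eq_of_exp_mul_eq {θ : I → ℝ} (hθ : Continuous θ) {f : C(Disc, ℂ)} (hf : ∀ ζ, f ζ ≠ 0)
    {c : ℂ} (h : ∀ τ : I, Complex.exp (2 * π * θ τ * Complex.I) * f (discConj (bdryPoint τ)) = c) :
    θ 1 = θ 0 := by
  obtain ⟨α, hα⟩ := exists_continuous_turns f hf
  have hc : Continuous fun τ : I => θ τ + α (discConj (bdryPoint τ)) := by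
    have := continuous_bdryPoint
    fun_prop
  have key := eq_of_exp_turns_eq hc (c := c / ‖c‖) (fun τ => ?_) 1 0
  · simpa [bdryPoint_zero_eq_one] using key
  · have h1 := h τ
    have hn : (‖f (discConj (bdryPoint τ))‖ : ℂ) ≠ 0 := by simpa using hf _
    have h2 : ‖c‖ = ‖f (discConj (bdryPoint τ))‖ := by
      rw [← h1, norm_mul]
      have : (2 * π * θ τ * Complex.I : ℂ) = ((2 * π * θ τ : ℝ) : ℂ) * Complex.I := by
        push_cast
        ring
      rw [this, Complex.norm_exp_ofReal_mul_I, one_mul]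
    rw [h2, eq_div_iff hn, ← h1]
    nth_rewrite 2 [hα]
    push_cast
    rw [mul_add, add_mul, Complex.exp_add]
    ring

theorem coe_torusExp {N : ℕ} (θ : Fin N → ℝ) (j : Fin N) :
    (torusExp θ j : ℂ) = Complex.exp (2 * π * θ j * Complex.I) := by
  simp [torusExp, Circle.coe_exp]

theorem coe_discConj_bdryPoint (τ : ℝ) :
    ((discConj (bdryPoint τ) : Disc) : ℂ) = Complex.exp (2 * π * (-τ) * Complex.I) := by
  change starRingEnd ℂ (Circle.exp (2 * π * τ) : ℂ) = _
  rw [← Circle.coe_inv_eq_conj, ← Circle.exp_neg, Circle.coe_exp]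
  congr 1
  push_cast
  ring

namespace ToricReduction
variable {N : ℕ} {Y : ToricManifold N} {R : ToricReduction Y}

theorem IsTransition.integral {w : C(Disc, Y.Space × R.Space)} (hw : R.IsBounded w)
    {l : R.DiscLift w} {φ : C(I, Fin N → ℝ)} (h : IsTransition l φ) (j : Fin N) :
    ∃ n : ℤ, (φ 1 - φ 0) j = n := by
  refine torusExp_eq_one_iff.1 ?_ j
  have hfree : FreeAt R.hLift (l.fst (bdryPoint 0)) :=
    (represents_of_mem_lag (hw _ (norm_bdryPoint 0)) (l.fst_rep _)).freeAt
  have e0 := (h 0).2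
  have e1 := (h 1).2
  simp only [Set.Icc.coe_one, Set.Icc.coe_zero] at e0 e1
  rw [← bdryPoint_zero_eq_one, e0] at e1
  rw [sub_eq_add_neg, torusExp_add, torusExp_neg, mul_comm]
  have := hfree _ (mul_mem (inv_mem (h 1).1) (h 0).1) (by
    rw [rotate_mul, e1, ← rotate_mul, inv_mul_cancel, rotate_one])
  rw [inv_mul_eq_one] at this ⊢
  exact this.symm

/-- The winding vector of a basic disc of the closure of a stratum: the transition path winds once
in the `i`-th coordinate, because the disc meets `D_i` once, and does not wind in the coordinates
that do not vanish on the disc. -/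
theorem exists_winding_of_isBasicDisc {J : Finset (Fin N)} {i : Fin N} (hi : i ∉ J)
    {u : C(Disc, Y.Space)} {x : R.Space} (hu : Y.IsBasicDisc J i u)
    (hb : R.IsBounded (R.constDisc u x)) :
    ∃ (l : R.DiscLift (R.constDisc u x)) (φ : C(I, Fin N → ℝ)) (n : Fin N → ℤ),
      IsTransition l φ ∧ (∀ j, (φ 1 - φ 0) j = n j) ∧ n i = 1 ∧ (∀ j, j ∉ insert i J → n j = 0) ∧
      (∀ j, l.fst (bdryPoint 0) j = 0 ↔ j ∈ J) ∧
      ∀ j, l.fst ⟨0, by simp⟩ j = 0 ↔ j ∈ insert i J := by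
  obtain ⟨f, hf, hrep⟩ := hu
  let Z : C(Disc, Fin N → ℂ) :=
    ⟨fun ζ => Function.update (f (discConj ζ)) i ((discConj ζ).1 * f (discConj ζ) i), by fun_prop⟩
  have hZ : ∀ ζ, Z ζ = Function.update (f (discConj ζ)) i ((discConj ζ).1 * f (discConj ζ) i) :=
    fun ζ => rfl
  have hZrep : ∀ ζ, Y.Represents (Z ζ) (R.constDisc u x ζ).1 := fun ζ => hrep (discConj ζ)
  have hz₀ : R.Represents (Z (bdryPoint 0)) x :=
    represents_of_mem_lag (hb _ (norm_bdryPoint 0)) (hZrep _)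
  let l : R.DiscLift (R.constDisc u x) :=
    { fst := Z
      snd := ContinuousMap.const Disc (Z (bdryPoint 0))
      fst_rep := hZrep
      snd_rep := fun _ => hz₀ }
  obtain ⟨φ, hφ⟩ := exists_isTransition hb l
  choose n hn using hφ.integral hb
  have hrot : ∀ (τ : I) j, Z (bdryPoint 0) j =
      Complex.exp (2 * π * φ τ j * Complex.I) * Z (bdryPoint τ) j := fun τ j => by
    have := congrFun (hφ τ).2 j
    rw [rotate, coe_torusExp] at this
    exact this
  refine ⟨l, φ, n, hφ, hn, ?_, fun j hj => ?_, fun j => ?_, fun j => ?_⟩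
  · let g : C(Disc, ℂ) := ⟨fun ζ => f ζ i, by fun_prop⟩
    have := eq_of_exp_mul_eq (θ := fun τ => φ τ i - τ) (f := g) (c := Z (bdryPoint 0) i)
      (by fun_prop) (fun ζ h => hi ((hf ζ i).1 h)) (fun τ => by
        rw [hrot τ i, hZ, Function.update_self, coe_discConj_bdryPoint, ← mul_assoc,
          ← Complex.exp_add]
        congr 2
        push_cast
        ring)
    have h1 := hn i
    rw [Pi.sub_apply] at h1
    simp only [Set.Icc.coe_one, Set.Icc.coe_zero] at this
    have : (n i : ℝ) = 1 := by linarith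
    exact_mod_cast this
  · rw [Finset.mem_insert, not_or] at hj
    let g : C(Disc, ℂ) := ⟨fun ζ => f ζ j, by fun_prop⟩
    have := eq_of_exp_mul_eq (θ := fun τ => φ τ j) (f := g) (c := Z (bdryPoint 0) j)
      (by fun_prop) (fun ζ h => hj.2 ((hf ζ j).1 h)) (fun τ => by
        rw [hrot τ j, hZ, Function.update_of_ne hj.1]
        rfl)
    have h1 := hn j
    rw [Pi.sub_apply, this, sub_self] at h1
    exact_mod_cast h1.symm
  · change Z _ j = 0 ↔ _
    rw [hZ]
    by_cases hj : j = i
    · subst hj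
      rw [Function.update_self, coe_discConj_bdryPoint, mul_eq_zero, hf]
      simp
    · rw [Function.update_of_ne hj, hf]
  · change Z _ j = 0 ↔ _
    rw [hZ]
    by_cases hj : j = i
    · subst hj
      simp [discConj]
    · rw [Function.update_of_ne hj, hf, Finset.mem_insert]
      simp [hj]

/-! ### The primitive normal vector -/

theorem sum_smul_v (Y : ToricManifold N) (n : Fin N → ℤ) :
    ∑ j, n j • Y.v j = Y.k.mkQ (fun j => (n j : ℝ)) := by
  rw [pi_eq_sum_univ' (fun j => (n j : ℝ)), map_sum]
  refine Finset.sum_congr rfl fun j _ => ?_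
  rw [map_smul, Int.cast_smul_eq_zsmul]
  rfl

/-- The absolute value of a homogeneous coordinate, as a function on `Y`. -/
def coordNorm (Y : ToricManifold N) (j : Fin N) : Y.Space → ℝ :=
  Quotient.lift (fun z => ‖z.1 j‖) (by
    rintro z z' ⟨t, _, h⟩
    simp only [← h, rotate, norm_mul, Circle.norm_coe, one_mul])

theorem continuous_coordNorm (Y : ToricManifold N) (j : Fin N) : Continuous (coordNorm Y j) :=
  Continuous.quotient_lift ((continuous_apply j).comp continuous_subtype_val).norm _

theorem coordNorm_eq {z : Fin N → ℂ} {y : Y.Space} (h : Y.Represents z y) (j : Fin N) :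
    coordNorm Y j y = ‖z j‖ := by
  obtain ⟨h, rfl⟩ := h
  rfl

theorem coordNorm_eq_zero {J : Finset (Fin N)} {i : Fin N} {y : Y.Space}
    (hy : y ∈ closure (Y.stratum J) ∩ Y.divisor i) {j : Fin N} (hj : j ∈ insert i J) :
    coordNorm Y j y = 0 := by
  rcases Finset.mem_insert.1 hj with rfl | hj
  · obtain ⟨z, hz, h0⟩ := hy.2
    rw [coordNorm_eq hz, h0, norm_zero]
  · have hc : IsClosed {y | coordNorm Y j y = 0} :=
      isClosed_eq (continuous_coordNorm Y j) continuous_const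
    refine closure_minimal ?_ hc hy.1
    rintro y ⟨z, hz, h⟩
    rw [Set.mem_ofPred_eq, coordNorm_eq hz, (h j).2 hj, norm_zero]

theorem moment_mkQ (y : Y.Space) (θ : Fin N → ℝ) :
    Y.moment y (Y.k.mkQ θ) = ∑ j, (coordNorm Y j y ^ 2 / 2 - Y.a j) * θ j := by
  induction y using Quotient.inductionOn with
  | h z =>
    change stdMoment Y.a z.1 θ = ∑ j, (‖z.1 j‖ ^ 2 / 2 - Y.a j) * θ j
    simp [stdMoment]

theorem mkQ_mem_momentNormal {J : Finset (Fin N)} {i : Fin N} {θ : Fin N → ℝ}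
    (hθ : ∀ j, j ∉ insert i J → θ j = 0) :
    Y.k.mkQ θ ∈ Y.momentNormal (closure (Y.stratum J) ∩ Y.divisor i) := by
  rintro _ ⟨y, hy, rfl⟩ _ ⟨y', hy', rfl⟩
  rw [LinearMap.sub_apply, moment_mkQ, moment_mkQ, sub_eq_zero]
  refine Finset.sum_congr rfl fun j _ => ?_
  by_cases hj : j ∈ insert i J
  · rw [coordNorm_eq_zero hy hj, coordNorm_eq_zero hy' hj]
  · rw [hθ j hj, mul_zero, mul_zero]

/-- A lattice vector of `𝔱^k` supported on the divisors through the intersection of `D_i` with the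
closure of the stratum, with coefficient one at `D_i`, is a normal vector. It is primitive: if it is
the image of `m u` with `u` integral, then the exponential of `n / m - u` is an element of `K` that
fixes `z`, so `n_i / m = 1 / m` is an integer. -/
theorem isNormalVector_of_apply_eq_one {J : Finset (Fin N)} {i : Fin N} {n : Fin N → ℤ}
    (hn : (fun j => (n j : ℝ)) ∈ R.hLift) (hni : n i = 1) (hsupp : ∀ j, j ∉ insert i J → n j = 0)
    {z : Fin N → ℂ} (hz : FreeAt Y.k z) (hzJ : ∀ j, z j = 0 ↔ j ∈ insert i J) :
    R.IsNormalVector J i (∑ j, n j • Y.v j) n where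
  expansion := rfl
  support := hsupp
  pos := by rw [hni]; exact one_pos
  primitive := by
    rw [sum_smul_v]
    refine ⟨⟨_, ⟨n, rfl⟩, rfl⟩, ?_⟩
    rintro m _ ⟨_, ⟨u, rfl⟩, rfl⟩ h
    have hmem : ∀ c : ℝ, c • ((fun j => (n j : ℝ)) - fun j => (m : ℝ) * u j) ∈ Y.k := fun c => by
      refine Y.k.smul_mem c ?_
      rw [← Submodule.Quotient.mk_eq_zero, ← Submodule.mkQ_apply, map_sub, sub_eq_zero, h,
        ← Int.cast_smul_eq_zsmul ℝ]
      rfl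
    have hint : ∀ c : ℝ, (∀ j, j ∉ insert i J → ∃ q : ℤ, c * (m * u j) = q) →
        ∃ q : ℤ, c * (1 - m * u i) = q := fun c hc => by
      have := hz.integral (hmem c) (fun j hj => by
        have hj' := fun h => hj ((hzJ j).2 h)
        obtain ⟨q, hq⟩ := hc j hj'
        exact ⟨-q, by simp [hsupp j hj', hq]⟩) i
      simpa [hni] using this
    -- For `m = 0` all multiples of `n` lie in `k`, so half of `n_i = 1` would be an integer.
    by_cases hm : m = 0
    · subst hm
      obtain ⟨q, hq⟩ := hint (1 / 2) fun j _ => ⟨0, by simp⟩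
      have : 2 * (q : ℝ) = 1 := by rw [← hq]; norm_num
      have : 2 * q = 1 := by exact_mod_cast this
      omega
    · have hm' : (m : ℝ) ≠ 0 := by exact_mod_cast hm
      obtain ⟨q, hq⟩ := hint (m : ℝ)⁻¹ fun j _ => ⟨u j, inv_mul_cancel_left₀ hm' _⟩
      have : (m : ℝ) * (q + u i) = 1 := by
        rw [← hq]
        field_simp
        ring
      have : m * (q + u i) = 1 := by exact_mod_cast this
      exact IsUnit.of_mul_eq_one _ this
  mem := by
    rw [sum_smul_v]
    exact hn
  normal := by
    rw [sum_smul_v]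
    exact mkQ_mem_momentNormal fun j hj => by rw [hsupp j hj, Int.cast_zero]

/-- Vectors of `𝔱^k` supported on the same divisors as `n` are multiples of `n`, because the
preimage of `T^k` acts freely at a point of the stratum; primitivity and positivity determine the
multiple. -/
theorem IsNormalVector.eq_of_apply_eq_one {J : Finset (Fin N)} {i : Fin N} {n : Fin N → ℤ}
    (hn : (fun j => (n j : ℝ)) ∈ R.hLift) (hni : n i = 1) (hsupp : ∀ j, j ∉ insert i J → n j = 0)
    {z : Fin N → ℂ} (hz : FreeAt R.hLift z) (hzJ : ∀ j, z j = 0 ↔ j ∈ J) {v : Y.Lie}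
    {n' : Fin N → ℤ} (h : R.IsNormalVector J i v n') : n' = n := by
  have hmem : (fun j => (n' j : ℝ)) ∈ R.hLift := by
    change Y.k.mkQ _ ∈ R.h
    rw [← sum_smul_v, ← h.expansion]
    exact h.mem
  have hmul : ∀ j, n' j = n' i * n j := by
    have h0 := hz.eq_zero (R.hLift.sub_mem hmem (R.hLift.smul_mem (n' i : ℝ) hn)) (fun j => by
      by_cases hj : j ∈ J
      · rw [(hzJ j).2 hj, mul_zero]
      · by_cases hji : j = i
        · subst hji
          simp [hni]
        · have : j ∉ insert i J := by simp [hj, hji]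
          simp [hsupp j this, h.support j this])
    intro j
    have := congrFun h0 j
    simp only [Pi.sub_apply, Pi.smul_apply, Pi.zero_apply, smul_eq_mul, sub_eq_zero] at this
    exact_mod_cast this
  have hunit : IsUnit (n' i) := by
    refine h.primitive.2 (n' i) (∑ j, n j • Y.v j) ?_ ?_
    · rw [sum_smul_v]
      exact ⟨_, ⟨n, rfl⟩, rfl⟩
    · rw [h.expansion, Finset.smul_sum]
      refine Finset.sum_congr rfl fun j _ => ?_
      rw [hmul j, mul_smul]
  have h1 : n' i = 1 := by
    rcases Int.isUnit_iff.1 hunit with h1 | h1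
    · exact h1
    · have := h.pos
      omega
  funext j
  rw [hmul j, h1, one_mul]

end ToricReduction

/-! ### Lagrangian frames and symplectic maps -/

/-- The standard symplectic form on `ℂ^ι`, as a real bilinear form. -/
def sympForm (ι : Type*) [Fintype ι] : (ι → ℂ) →ₗ[ℝ] (ι → ℂ) →ₗ[ℝ] ℝ :=
  LinearMap.mk₂ ℝ (fun ξ η => ∑ j, (starRingEnd ℂ (ξ j) * η j).im)
    (fun ξ ξ' η => by simp [add_mul, Finset.sum_add_distrib])
    (fun c ξ η => by simp [Finset.mul_sum, mul_assoc])
    (fun ξ η η' => by simp [mul_add, Finset.sum_add_distrib])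
    (fun c ξ η => by
      simp only [Pi.smul_apply, Complex.real_smul, Finset.mul_sum, smul_eq_mul]
      refine Finset.sum_congr rfl fun j _ => ?_
      rw [mul_left_comm, Complex.im_ofReal_mul])

section
variable {ι : Type*} [Fintype ι]

theorem sympForm_apply (ξ η : ι → ℂ) :
    sympForm ι ξ η = ∑ j, (starRingEnd ℂ (ξ j) * η j).im := rfl

theorem stdSymp_eq {r : ℕ} (ξ η : Fin r → ℂ) : stdSymp ξ η = sympForm (Fin r) ξ η := rfl

theorem sympForm_swap (ξ η : ι → ℂ) : sympForm ι ξ η = -sympForm ι η ξ := by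
  rw [sympForm_apply, sympForm_apply, ← Finset.sum_neg_distrib]
  refine Finset.sum_congr rfl fun j _ => ?_
  simp only [Complex.mul_im, Complex.conj_re, Complex.conj_im]
  ring

theorem sympForm_I_smul_right (ξ : ι → ℂ) :
    sympForm ι ξ (Complex.I • ξ) = ∑ j, ‖ξ j‖ ^ 2 := by
  rw [sympForm_apply]
  refine Finset.sum_congr rfl fun j _ => ?_
  rw [← Complex.normSq_eq_norm_sq, Complex.normSq_apply]
  simp

theorem sympForm_I_smul_smul (ξ η : ι → ℂ) :
    sympForm ι (Complex.I • ξ) (Complex.I • η) = sympForm ι ξ η := by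
  rw [sympForm_apply, sympForm_apply]
  refine Finset.sum_congr rfl fun j _ => ?_
  simp

theorem sum_norm_sq_eq_zero_iff (ξ : ι → ℂ) : ∑ j, ‖ξ j‖ ^ 2 = 0 ↔ ξ = 0 := by
  rw [Finset.sum_eq_zero_iff_of_nonneg fun j _ => by positivity, funext_iff]
  simp

theorem eq_zero_of_sympForm_eq_zero {ξ : ι → ℂ} (h : ∀ η, sympForm ι ξ η = 0) : ξ = 0 := by
  rw [← sum_norm_sq_eq_zero_iff, ← sympForm_I_smul_right, h]

/-- Let `Φ` be symplectic, with image orthogonal to the isotropic vectors `o`. For a Lagrangian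
frame `a`, the vectors `Φ (a l)` stay independent over `ℂ`, together with `o`, when the complex
antilinear part of `Φ` is shrunk: complex combinations of `a` are null vectors of the Hermitian
form `i ω(x̄, y)`, whereas the kernel of the complexification of each deformed map is negative
definite. For `p = 1` the map is `Φ`, and for `p = q` its complex linear part. -/
theorem linearIndependent_deformed {C : Type*} [Fintype C] {r : ℕ}
    {Φ : (Fin r → ℂ) →ₗ[ℝ] (ι → ℂ)} {o : C → ι → ℂ}
    (hΦ : ∀ b b', sympForm ι (Φ b) (Φ b') = sympForm (Fin r) b b')
    (hoΦ : ∀ c b, sympForm ι (o c) (Φ b) = 0) (hoo : ∀ c d, sympForm ι (o c) (o d) = 0)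
    (ho : LinearIndependent ℝ o) {a : Fin r → Fin r → ℂ}
    (ha : ∀ l m, sympForm (Fin r) (a l) (a m) = 0) (hind : LinearIndependent ℝ a)
    {p q : ℝ} (hp : 0 ≤ p) (hq : 0 ≤ q) (hpq : p + q = 1) :
    LinearIndependent ℂ (Sum.elim
      (fun l => (p : ℂ) • Φ (a l) - (q * Complex.I : ℂ) • Φ (Complex.I • a l)) o) := by
  rw [Fintype.linearIndependent_iff]
  intro g hg
  rw [Fintype.sum_sum_type] at hg
  simp only [Sum.elim_inl, Sum.elim_inr] at hg
  set x := ∑ l, (g (Sum.inl l)).re • a l with hx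
  set y := ∑ l, (g (Sum.inl l)).im • a l with hy
  set o₁ := ∑ c, (g (Sum.inr c)).re • o c with ho₁
  set o₂ := ∑ c, (g (Sum.inr c)).im • o c with ho₂
  set X := p • x + q • (Complex.I • y) with hX
  set Z := p • y - q • (Complex.I • x) with hZ
  have hAB : Φ X + o₁ + Complex.I • (Φ Z + o₂) = 0 := by
    have e1 : Φ X = ∑ l, ((p * (g (Sum.inl l)).re) • Φ (a l) +
        (q * (g (Sum.inl l)).im) • Φ (Complex.I • a l)) := by
      simp only [hX, hx, hy, map_add, map_smul, map_sum, Finset.smul_sum, smul_smul,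
        Finset.sum_add_distrib, smul_comm Complex.I]
    have e2 : Φ Z = ∑ l, ((p * (g (Sum.inl l)).im) • Φ (a l) -
        (q * (g (Sum.inl l)).re) • Φ (Complex.I • a l)) := by
      simp only [hZ, hx, hy, map_sub, map_smul, map_sum, Finset.smul_sum, smul_smul,
        Finset.sum_sub_distrib, smul_comm Complex.I]
    rw [← hg, e1, e2, smul_add, add_add_add_comm, Finset.smul_sum, Finset.smul_sum,
      ← Finset.sum_add_distrib, ← Finset.sum_add_distrib]
    congr 1
    · refine Finset.sum_congr rfl fun l _ => funext fun k => ?_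
      simp only [Pi.add_apply, Pi.sub_apply, Pi.smul_apply, smul_eq_mul, Complex.real_smul]
      nth_rewrite 5 [← Complex.re_add_im (g (Sum.inl l))]
      push_cast
      ring_nf
      simp only [Complex.I_sq]
      ring
    · refine Finset.sum_congr rfl fun c _ => funext fun k => ?_
      simp only [Pi.add_apply, Pi.smul_apply, smul_eq_mul, Complex.real_smul]
      nth_rewrite 3 [← Complex.re_add_im (g (Sum.inr c))]
      ring
  have hxy : sympForm (Fin r) x y = 0 := by
    simp [hx, hy, ha]
  have hoo' : sympForm ι o₁ o₂ = 0 := by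
    simp [ho₁, ho₂, hoo]
  have h1 : ∀ b, sympForm ι o₁ (Φ b) = 0 := fun b => by simp [ho₁, hoΦ]
  have h2 : ∀ b, sympForm ι o₂ (Φ b) = 0 := fun b => by simp [ho₂, hoΦ]
  have hform : sympForm ι (Φ X + o₁) (Φ Z + o₂) =
      -(p * q * (∑ j, ‖x j‖ ^ 2 + ∑ j, ‖y j‖ ^ 2)) := by
    rw [map_add, map_add, LinearMap.add_apply, LinearMap.add_apply, h1, hoo',
      sympForm_swap (Φ X) o₂, h2, hΦ]
    have e1 := sympForm_I_smul_right x
    have e2 := sympForm_I_smul_right y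
    have e3 := sympForm_swap (Complex.I • y) y
    have e4 := sympForm_I_smul_smul y x
    have e5 := sympForm_swap y x
    simp only [hX, hZ, map_add, map_sub, map_smul, LinearMap.add_apply,
      LinearMap.smul_apply, smul_eq_mul, e3, e4, e5, e1, e2, hxy]
    ring
  have hA : Φ X + o₁ = -(Complex.I • (Φ Z + o₂)) := eq_neg_of_add_eq_zero_left hAB
  have hB := hform
  rw [hA, map_neg, LinearMap.neg_apply, sympForm_swap, neg_neg, sympForm_I_smul_right] at hB
  have hnx : 0 ≤ ∑ j, ‖x j‖ ^ 2 := by positivity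
  have hny : 0 ≤ ∑ j, ‖y j‖ ^ 2 := by positivity
  have hnB : 0 ≤ ∑ j, ‖(Φ Z + o₂) j‖ ^ 2 := by positivity
  have hpos : 0 ≤ p * q * (∑ j, ‖x j‖ ^ 2 + ∑ j, ‖y j‖ ^ 2) := by positivity
  have hB0 : Φ Z + o₂ = 0 := (sum_norm_sq_eq_zero_iff _).1 (by linarith)
  have hA0 : Φ X + o₁ = 0 := by rw [hA, hB0, smul_zero, neg_zero]
  have hX0 : X = 0 := eq_zero_of_sympForm_eq_zero fun b => by
    rw [← hΦ, eq_neg_of_add_eq_zero_left hA0, map_neg, LinearMap.neg_apply, h1, neg_zero]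
  have hZ0 : Z = 0 := eq_zero_of_sympForm_eq_zero fun b => by
    rw [← hΦ, eq_neg_of_add_eq_zero_left hB0, map_neg, LinearMap.neg_apply, h2, neg_zero]
  have ho₁0 : o₁ = 0 := by simpa [hX0] using hA0
  have ho₂0 : o₂ = 0 := by simpa [hZ0] using hB0
  have hxy0 : x = 0 ∧ y = 0 := by
    have hI : ∀ v : Fin r → ℂ, Complex.I • v = 0 → v = 0 := fun v hv =>
      (smul_eq_zero.1 hv).resolve_left Complex.I_ne_zero
    rcases hp.eq_or_lt with rfl | hp
    · have hq1 : q = 1 := by linarith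
      subst hq1
      exact ⟨hI x (by simpa [hZ] using hZ0), hI y (by simpa [hX] using hX0)⟩
    · rcases hq.eq_or_lt with rfl | hq
      · have hp1 : p = 1 := by linarith
        subst hp1
        exact ⟨by simpa [hX] using hX0, by simpa [hZ] using hZ0⟩
      · have h0 : ∑ j, ‖x j‖ ^ 2 + ∑ j, ‖y j‖ ^ 2 = 0 := by
          have : p * q * (∑ j, ‖x j‖ ^ 2 + ∑ j, ‖y j‖ ^ 2) = 0 := by linarith
          exact (mul_eq_zero.1 this).resolve_left (by positivity)
        exact ⟨(sum_norm_sq_eq_zero_iff x).1 (by linarith),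
          (sum_norm_sq_eq_zero_iff y).1 (by linarith)⟩
  have gx := Fintype.linearIndependent_iff.1 hind _ (hx.symm.trans hxy0.1)
  have gy := Fintype.linearIndependent_iff.1 hind _ (hy.symm.trans hxy0.2)
  have g₁ := Fintype.linearIndependent_iff.1 ho _ (ho₁.symm.trans ho₁0)
  have g₂ := Fintype.linearIndependent_iff.1 ho _ (ho₂.symm.trans ho₂0)
  rintro (l | c)
  · exact Complex.ext (gx l) (gy l)
  · exact Complex.ext (g₁ c) (g₂ c)

end

/-! ### Determinants of frames -/

section
variable {n ι : Type*} [Fintype n] [DecidableEq n] (e : n ≃ ι)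

/-- The determinant of a family of vectors in `ℂ^ι`, in an ordering `e` of the coordinates. -/
def frameDet (v : n → ι → ℂ) : ℂ := (Matrix.of fun x y => v x (e y)).det

theorem frameDet_ne_zero [Fintype ι] {v : n → ι → ℂ} (h : LinearIndependent ℂ v) :
    frameDet e v ≠ 0 := by
  have h1 : LinearIndependent ℂ (Matrix.of fun x y => v x (e y)).row :=
    h.map' (LinearEquiv.funCongrLeft ℂ ℂ e).toLinearMap (LinearEquiv.ker _)
  exact ((Matrix.isUnit_iff_isUnit_det _).1 (Matrix.linearIndependent_rows_iff_isUnit.1 h1)).ne_zero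

theorem frameDet_sum (M : Matrix n n ℂ) (v : n → ι → ℂ) :
    frameDet e (fun x => ∑ y, M x y • v y) = M.det * frameDet e v := by
  rw [frameDet, frameDet, ← Matrix.det_mul]
  congr 1
  ext x y
  simp [Matrix.mul_apply]

theorem frameDet_sum_elim {r C : Type*} [Fintype r] [Fintype C] [DecidableEq r] [DecidableEq C]
    (e : r ⊕ C ≃ ι) (M : Matrix r r ℂ) (v : r → ι → ℂ) (o : C → ι → ℂ) :
    frameDet e (Sum.elim (fun x => ∑ y, M x y • v y) o) = M.det * frameDet e (Sum.elim v o) := by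
  have h1 : Sum.elim (fun x => ∑ y, M x y • v y) o =
      fun x => ∑ y, Matrix.fromBlocks M 0 0 (1 : Matrix C C ℂ) x y • Sum.elim v o y := by
    funext x
    rcases x with x | c
    · simp
    · simp [Matrix.one_apply, ite_smul]
  rw [h1, frameDet_sum, Matrix.det_fromBlocks_zero₂₁, Matrix.det_one, mul_one]

theorem continuous_frameDet {X : Type*} [TopologicalSpace X] {v : X → n → ι → ℂ}
    (h : ∀ x, Continuous fun b => v b x) : Continuous fun b => frameDet e (v b) := by
  refine Continuous.matrix_det (continuous_pi fun x => continuous_pi fun y => ?_)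
  exact (continuous_apply (e y)).comp (h x)

end

/-- If the real span of a frame of `ℂ^N × ℂ^N` is preserved by the antiunitary involution
`(a, b) ↦ (t b̄, t ā)`, then the squared determinant of the frame is a real multiple of
`(∏ t_j)²`, as the involution is a real change of frame. -/
theorem exists_frameDet_sq_eq {N : ℕ} {n : Type*} [Fintype n] [DecidableEq n]
    (e : n ≃ Fin N ⊕ Fin N) {v : n → Fin N ⊕ Fin N → ℂ} (hv : frameDet e v ≠ 0) (t : StdTorus N)
    (h : ∀ x, Sum.elim (fun j => (t j : ℂ) * starRingEnd ℂ (v x (Sum.inr j)))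
      (fun j => (t j : ℂ) * starRingEnd ℂ (v x (Sum.inl j))) ∈
        Submodule.span ℝ (Set.range v)) :
    ∃ ρ : ℝ, frameDet e v ^ 2 = ρ * (∏ j, (t j : ℂ)) ^ 2 := by
  have h' : ∀ x, ∃ c : n → ℝ, ∑ y, c y • v y =
      Sum.elim (fun j => (t j : ℂ) * starRingEnd ℂ (v x (Sum.inr j)))
      (fun j => (t j : ℂ) * starRingEnd ℂ (v x (Sum.inl j))) := fun x =>
    (Submodule.mem_span_range_iff_exists_fun ℝ).1 (h x)
  choose c hc using h'
  -- The involution conjugates the entries of the matrix of the frame, exchanges its two blocks of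
  -- columns by the permutation `sw`, and multiplies the columns by the entries of `d`.
  let sw : n ≃ n := (e.trans (Equiv.sumComm _ _)).trans e.symm
  let d : n → ℂ := fun y => Sum.elim (fun j => (t j : ℂ)) (fun j => (t j : ℂ)) (e y)
  have h1 : frameDet e (fun x => ∑ y, (c x y) • v y) =
      ((Matrix.of c).det : ℂ) * frameDet e v := by
    have := frameDet_sum e ((Matrix.of c).map (Complex.ofRealHom)) v
    rw [← RingHom.mapMatrix_apply, ← RingHom.map_det] at this
    exact this
  have h2 : frameDet e (fun x => ∑ y, (c x y) • v y) =
      (∏ j, (t j : ℂ)) ^ 2 * (((Equiv.Perm.sign sw : ℤ) : ℂ) * starRingEnd ℂ (frameDet e v)) := by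
    have e1 : (Matrix.of fun x y => (∑ y, (c x y) • v y) (e y)) =
        Matrix.of fun x y => d y *
          (((Complex.conjAe.toRingHom).mapMatrix
            (Matrix.of fun x y => v x (e y))).submatrix id sw) x y := by
      ext x y
      simp only [Matrix.of_apply, hc]
      simp only [d, sw, Matrix.submatrix_apply]
      rcases h : e y with j | j <;> simp [h]
    have e2 : ∏ y, d y = (∏ j, (t j : ℂ)) ^ 2 := by
      rw [← e.symm.prod_comp]
      simp [d, sq]
    rw [frameDet, e1, Matrix.det_mul_row, e2, Matrix.det_permute', ← RingHom.map_det]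
    rfl
  rw [h1] at h2
  have hn : frameDet e v * starRingEnd ℂ (frameDet e v) = (‖frameDet e v‖ : ℂ) ^ 2 :=
    Complex.mul_conj' _
  have hdet : (Matrix.of c).det ≠ 0 := by
    intro h0
    rw [h0, Complex.ofReal_zero, zero_mul, eq_comm] at h2
    have ht : (∏ j, (t j : ℂ)) ≠ 0 := Finset.prod_ne_zero_iff.2 fun j _ => Circle.coe_ne_zero _
    rcases Int.units_eq_one_or (Equiv.Perm.sign sw) with hs | hs <;> simp [hs, hv, ht] at h2
  refine ⟨((Equiv.Perm.sign sw : ℤ) : ℝ) * ‖frameDet e v‖ ^ 2 / (Matrix.of c).det, ?_⟩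
  have hdet' : ((Matrix.of c).det : ℂ) ≠ 0 := by exact_mod_cast hdet
  push_cast
  rw [div_mul_eq_mul_div, eq_div_iff hdet', ← hn]
  linear_combination (frameDet e v) * h2

/-! ### Linear algebra of the tangent spaces -/

section
variable {N : ℕ}

/-- The infinitesimal action at `z`. -/
def orbitMap (s : Submodule ℝ (Fin N → ℝ)) (z : Fin N → ℂ) : s →ₗ[ℝ] (Fin N → ℂ) where
  toFun θ j := Complex.I * (θ.1 j : ℂ) * z j
  map_add' θ η := by funext j; simp; ring
  map_smul' c θ := by funext j; simp; ring

theorem orbitMap_apply (s : Submodule ℝ (Fin N → ℝ)) (z : Fin N → ℂ) (θ : s) (j : Fin N) :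
    orbitMap s z θ j = Complex.I * (θ.1 j : ℂ) * z j := rfl

theorem mem_tangentOrbit_iff {s : Submodule ℝ (Fin N → ℝ)} {z ξ : Fin N → ℂ} :
    ξ ∈ tangentOrbit s z ↔ ∃ θ : s, orbitMap s z θ = ξ := by
  constructor
  · rintro ⟨θ, hθ, rfl⟩
    exact ⟨⟨θ, hθ⟩, rfl⟩
  · rintro ⟨θ, rfl⟩
    exact ⟨θ, θ.2, rfl⟩

theorem FreeAt.orbitMap_injective {s : Submodule ℝ (Fin N → ℝ)} {z : Fin N → ℂ}
    (h : FreeAt s z) : Function.Injective (orbitMap s z) := by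
  rw [← LinearMap.ker_eq_bot, LinearMap.ker_eq_bot']
  intro θ hθ
  refine Subtype.ext (h.eq_zero θ.2 fun j => ?_)
  have := congrFun hθ j
  rw [orbitMap_apply, mul_assoc] at this
  exact (mul_eq_zero.1 this).resolve_left Complex.I_ne_zero

/-- The differential at `z` of `z ↦ ∑ θ_j |z_j|² / 2`, as a function of `θ`. -/
def momentDiff (s : Submodule ℝ (Fin N → ℝ)) (z : Fin N → ℂ) :
    s →ₗ[ℝ] Module.Dual ℝ (Fin N → ℂ) :=
  LinearMap.mk₂ ℝ (fun θ ξ => ∑ j, θ.1 j * ((starRingEnd ℂ) (z j) * ξ j).re)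
    (fun θ η ξ => by simp only [Submodule.coe_add, Pi.add_apply, add_mul, Finset.sum_add_distrib])
    (fun c θ ξ => by
      simp only [Submodule.coe_smul, Pi.smul_apply, smul_eq_mul, Finset.mul_sum, mul_assoc])
    (fun θ ξ η => by
      simp only [Pi.add_apply, mul_add, Complex.add_re, Finset.sum_add_distrib])
    (fun c θ ξ => by
      simp only [Pi.smul_apply, Complex.real_smul, Finset.mul_sum, smul_eq_mul]
      refine Finset.sum_congr rfl fun j _ => ?_
      rw [mul_left_comm, Complex.re_ofReal_mul, mul_left_comm])

theorem momentDiff_apply (s : Submodule ℝ (Fin N → ℝ)) (z : Fin N → ℂ) (θ : s) (ξ : Fin N → ℂ) :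
    momentDiff s z θ ξ = ∑ j, θ.1 j * ((starRingEnd ℂ) (z j) * ξ j).re := rfl

/-- The tangent space of the level set as a subspace. -/
def levelSubmodule (s : Submodule ℝ (Fin N → ℝ)) (z : Fin N → ℂ) : Submodule ℝ (Fin N → ℂ) :=
  (LinearMap.range (momentDiff s z)).dualCoannihilator

theorem mem_levelSubmodule_iff {s : Submodule ℝ (Fin N → ℝ)} {z ξ : Fin N → ℂ} :
    ξ ∈ levelSubmodule s z ↔ ξ ∈ tangentLevel s z := by
  rw [levelSubmodule, Submodule.mem_dualCoannihilator]
  constructor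
  · intro h θ hθ
    exact h _ ⟨⟨θ, hθ⟩, rfl⟩
  · rintro h _ ⟨θ, rfl⟩
    exact h θ θ.2

theorem tangentLevel_anti {s s' : Submodule ℝ (Fin N → ℝ)} (h : s ≤ s') (z : Fin N → ℂ) :
    tangentLevel s' z ⊆ tangentLevel s z := fun _ hξ θ hθ => hξ θ (h hθ)

theorem finrank_levelSubmodule {s : Submodule ℝ (Fin N → ℝ)} {z : Fin N → ℂ} (h : FreeAt s z) :
    Module.finrank ℝ s + Module.finrank ℝ (levelSubmodule s z) = 2 * N := by
  have hinj : Function.Injective (momentDiff s z) := by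
    rw [← LinearMap.ker_eq_bot, LinearMap.ker_eq_bot']
    intro θ hθ
    refine Subtype.ext (h.eq_zero θ.2 fun j => ?_)
    have := LinearMap.congr_fun hθ fun j => (θ.1 j : ℂ) * z j
    rw [momentDiff_apply, LinearMap.zero_apply] at this
    have e : ∀ j, θ.1 j * ((starRingEnd ℂ) (z j) * ((θ.1 j : ℂ) * z j)).re =
        Complex.normSq ((θ.1 j : ℂ) * z j) := fun j => by
      simp [Complex.normSq_apply]
      ring
    simp only [e] at this
    rw [Finset.sum_eq_zero_iff_of_nonneg fun j _ => Complex.normSq_nonneg _] at this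
    exact Complex.normSq_eq_zero.1 (this j (Finset.mem_univ j))
  have h1 := Subspace.finrank_add_finrank_dualCoannihilator_eq (LinearMap.range (momentDiff s z))
  rw [LinearMap.finrank_range_of_inj hinj, finrank_real_of_complex, Module.finrank_fin_fun] at h1
  exact h1

theorem rotate_add (t : StdTorus N) (ξ η : Fin N → ℂ) :
    rotate t (ξ + η) = rotate t ξ + rotate t η := by
  funext j; simp [rotate, mul_add]

/-- The action of a torus element as a real linear map. -/
def rotateMap (t : StdTorus N) : (Fin N → ℂ) →ₗ[ℝ] (Fin N → ℂ) where
  toFun := rotate t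
  map_add' := rotate_add t
  map_smul' c ξ := by funext j; simp [rotate]; ring

theorem rotateMap_apply (t : StdTorus N) (ξ : Fin N → ℂ) : rotateMap t ξ = rotate t ξ := rfl

theorem rotate_orbitMap (s : Submodule ℝ (Fin N → ℝ)) (t : StdTorus N) (z : Fin N → ℂ) (θ : s) :
    rotate t (orbitMap s z θ) = orbitMap s (rotate t z) θ := by
  funext j; simp only [rotate, orbitMap_apply]; ring

theorem rotate_mem_tangentLevel {s : Submodule ℝ (Fin N → ℝ)} {t : StdTorus N}
    {z ξ : Fin N → ℂ} (h : ξ ∈ tangentLevel s z) : rotate t ξ ∈ tangentLevel s (rotate t z) := by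
  intro θ hθ
  rw [← h θ hθ]
  refine Finset.sum_congr rfl fun j _ => ?_
  simp only [rotate, map_mul]
  rw [mul_mul_mul_comm, ← Circle.coe_inv_eq_conj, ← Circle.coe_mul, inv_mul_cancel,
    Circle.coe_one, one_mul]

theorem sympForm_rotate (t : StdTorus N) (ξ η : Fin N → ℂ) :
    sympForm (Fin N) (rotate t ξ) (rotate t η) = sympForm (Fin N) ξ η := by
  rw [sympForm_apply, sympForm_apply]
  refine Finset.sum_congr rfl fun j _ => ?_
  simp only [rotate, map_mul]
  rw [mul_mul_mul_comm, ← Circle.coe_inv_eq_conj, ← Circle.coe_mul, inv_mul_cancel,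
    Circle.coe_one, one_mul]

theorem sympForm_orbitMap {s : Submodule ℝ (Fin N → ℝ)} {z ξ : Fin N → ℂ}
    (h : ξ ∈ tangentLevel s z) (θ : s) : sympForm (Fin N) (orbitMap s z θ) ξ = 0 := by
  have : sympForm (Fin N) (orbitMap s z θ) ξ =
      -∑ j, θ.1 j * ((starRingEnd ℂ) (z j) * ξ j).re := by
    rw [sympForm_apply, ← Finset.sum_neg_distrib]
    refine Finset.sum_congr rfl fun j _ => ?_
    simp [orbitMap_apply]
    ring
  rw [this, h θ θ.2, neg_zero]

theorem orbitMap_mem_tangentLevel {s s' : Submodule ℝ (Fin N → ℝ)} (z : Fin N → ℂ) (θ : s) :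
    orbitMap s z θ ∈ tangentLevel s' z := by
  intro η hη
  refine Finset.sum_eq_zero fun j _ => ?_
  simp [orbitMap_apply]
  ring_nf
  simp

/-- Conjugation in the first factor, which turns the form `(-ω) ⊕ ω` into the standard one. -/
def conjPair (N : ℕ) : (Fin N → ℂ) × (Fin N → ℂ) →ₗ[ℝ] (Fin N ⊕ Fin N → ℂ) where
  toFun p := Sum.elim (fun j => starRingEnd ℂ (p.1 j)) p.2
  map_add' p q := by funext j; rcases j with j | j <;> simp
  map_smul' c p := by funext j; rcases j with j | j <;> simp

theorem conjPair_inl (p : (Fin N → ℂ) × (Fin N → ℂ)) (j : Fin N) :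
    conjPair N p (Sum.inl j) = starRingEnd ℂ (p.1 j) := rfl

theorem conjPair_inr (p : (Fin N → ℂ) × (Fin N → ℂ)) (j : Fin N) :
    conjPair N p (Sum.inr j) = p.2 j := rfl

theorem conjPair_injective : Function.Injective (conjPair N) := by
  rw [← LinearMap.ker_eq_bot, LinearMap.ker_eq_bot']
  intro p hp
  refine Prod.ext (funext fun j => ?_) (funext fun j => ?_)
  · simpa [conjPair_inl] using congrFun hp (Sum.inl j)
  · simpa [conjPair_inr] using congrFun hp (Sum.inr j)

theorem sympForm_conjPair (p q : (Fin N → ℂ) × (Fin N → ℂ)) :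
    sympForm _ (conjPair N p) (conjPair N q) =
      -sympForm (Fin N) p.1 q.1 + sympForm (Fin N) p.2 q.2 := by
  rw [sympForm_apply, Fintype.sum_sum_type, sympForm_apply, sympForm_apply,
    ← Finset.sum_neg_distrib]
  congr 1
  refine Finset.sum_congr rfl fun j _ => ?_
  simp [conjPair_inl]
  ring

end

namespace ToricReduction
variable {N : ℕ} {Y : ToricManifold N} {R : ToricReduction Y}

/-- The infinitesimal action of the product of the acting tori of `Y` and `X`. -/
def orbitPair (R : ToricReduction Y) (z z' : Fin N → ℂ) :
    (Y.k × R.hLift) →ₗ[ℝ] (Fin N → ℂ) × (Fin N → ℂ) :=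
  (orbitMap Y.k z).prodMap (orbitMap R.hLift z')

theorem orbitPair_injective {z z' : Fin N → ℂ} (hz : FreeAt Y.k z) (hz' : FreeAt R.hLift z') :
    Function.Injective (R.orbitPair z z') :=
  Function.Injective.prodMap hz.orbitMap_injective hz'.orbitMap_injective

theorem sympForm_orbitPair {z z' : Fin N → ℂ} {p : (Fin N → ℂ) × (Fin N → ℂ)}
    (h1 : p.1 ∈ tangentLevel Y.k z) (h2 : p.2 ∈ tangentLevel R.hLift z') (c : Y.k × R.hLift) :
    sympForm _ (conjPair N (R.orbitPair z z' c)) (conjPair N p) = 0 := by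
  rw [sympForm_conjPair]
  simp [orbitPair, sympForm_orbitMap h1, sympForm_orbitMap h2]

/-- The tangent space at `(z, t z)` of `{(z, t z)} ⊂ ℂ^N × ℂ^N`, for `z` in the level set and
`t ∈ exp(hLift)`. -/
def lagMap (R : ToricReduction Y) (z : Fin N → ℂ) (t : StdTorus N) :
    (levelSubmodule R.hLift z × R.hLift) →ₗ[ℝ] (Fin N → ℂ) × (Fin N → ℂ) :=
  ((levelSubmodule R.hLift z).subtype ∘ₗ LinearMap.fst ℝ _ _).prod
    (rotateMap t ∘ₗ (levelSubmodule R.hLift z).subtype ∘ₗ LinearMap.fst ℝ _ _ +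
      orbitMap R.hLift (rotate t z) ∘ₗ LinearMap.snd ℝ _ _)

theorem lagMap_apply (z : Fin N → ℂ) (t : StdTorus N) (η : levelSubmodule R.hLift z)
    (θ : R.hLift) :
    R.lagMap z t (η, θ) = (η.1, rotate t η + orbitMap R.hLift (rotate t z) θ) := rfl

/-- As the action is free, the torus element in the definition of `lagTangent` is determined by the
two points, and one may take the first vector itself as the vector tangent to `μ⁻¹(c)`. -/
theorem mem_lagTangent_iff {z : Fin N → ℂ} {t : StdTorus N} (ht : t ∈ expSubgroup R.hLift)
    (hz : FreeAt R.hLift z) {p : (Fin N → ℂ) × (Fin N → ℂ)} :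
    p ∈ R.lagTangent z (rotate t z) ↔ p ∈ LinearMap.range (R.lagMap z t) := by
  constructor
  · rintro ⟨t', ht', e, η, hη, h1, h2⟩
    have htt : t' = t := by
      have := hz _ (mul_mem (inv_mem ht) ht') (by
        rw [rotate_mul, ← e, ← rotate_mul, inv_mul_cancel, rotate_one])
      rw [inv_mul_eq_one] at this
      exact this.symm
    subst htt
    obtain ⟨κ, hκ⟩ := mem_tangentOrbit_iff.1 h1
    obtain ⟨θ, hθ⟩ := mem_tangentOrbit_iff.1 h2
    let κ' : R.hLift := ⟨κ.1, R.k_le_hLift κ.2⟩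
    have hκ' : orbitMap R.hLift z κ' = orbitMap Y.k z κ := rfl
    refine ⟨(⟨η, mem_levelSubmodule_iff.2 hη⟩ + ⟨orbitMap R.hLift z κ',
      mem_levelSubmodule_iff.2 (orbitMap_mem_tangentLevel z _)⟩, θ - κ'), ?_⟩
    rw [lagMap_apply]
    refine Prod.ext ?_ ?_
    · simp [hκ', hκ]
    · simp only [Submodule.coe_add, rotate_add, rotate_orbitMap, map_sub, hθ]
      abel
  · rintro ⟨⟨η, θ⟩, rfl⟩
    refine ⟨t, ht, rfl, η, mem_levelSubmodule_iff.1 η.2, ?_, ?_⟩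
    · exact mem_tangentOrbit_iff.2 ⟨0, by simp [lagMap_apply]⟩
    · exact mem_tangentOrbit_iff.2 ⟨θ, by simp [lagMap_apply]⟩

theorem finrank_range_lagMap {z : Fin N → ℂ} {t : StdTorus N} (hz : FreeAt R.hLift z) :
    Module.finrank ℝ (LinearMap.range (R.lagMap z t)) = 2 * N := by
  rw [LinearMap.finrank_range_of_inj, Module.finrank_prod, add_comm, finrank_levelSubmodule hz]
  rw [← LinearMap.ker_eq_bot, LinearMap.ker_eq_bot']
  rintro ⟨η, θ⟩ h
  rw [lagMap_apply, Prod.mk_eq_zero] at h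
  have hη : η = 0 := Subtype.ext h.1
  subst hη
  have h2 : orbitMap R.hLift (rotate t z) θ = 0 := by
    have := h.2
    rw [Submodule.coe_zero, ← rotateMap_apply, map_zero, zero_add] at this
    exact this
  rw [(injective_iff_map_eq_zero _).1 (hz.rotate t).orbitMap_injective θ h2]
  rfl

theorem sympForm_lagMap (z : Fin N → ℂ) (t : StdTorus N)
    (x y : levelSubmodule R.hLift z × R.hLift) :
    sympForm _ (conjPair N (R.lagMap z t x)) (conjPair N (R.lagMap z t y)) = 0 := by
  obtain ⟨η, θ⟩ := x
  obtain ⟨η', θ'⟩ := y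
  have h1 := fun θ => sympForm_orbitMap
    (rotate_mem_tangentLevel (t := t) (mem_levelSubmodule_iff.1 η.2)) θ
  have h2 := fun θ => sympForm_orbitMap
    (rotate_mem_tangentLevel (t := t) (mem_levelSubmodule_iff.1 η'.2)) θ
  have h3 := fun θ => sympForm_orbitMap
    (orbitMap_mem_tangentLevel (s' := R.hLift) (rotate t z) θ') θ
  have h4 := sympForm_swap (rotate t η) (orbitMap R.hLift (rotate t z) θ')
  rw [sympForm_conjPair, lagMap_apply, lagMap_apply]
  simp only [map_add, LinearMap.add_apply, sympForm_rotate, h4, h1, h2, h3]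
  ring

/-- The tangent space of the correspondence is preserved by an antiunitary involution that
exchanges the two factors. -/
theorem involution_mem_lag {z : Fin N → ℂ} {t : StdTorus N} {p : (Fin N → ℂ) × (Fin N → ℂ)}
    (hp : p ∈ LinearMap.range (R.lagMap z t)) :
    ∃ q ∈ LinearMap.range (R.lagMap z t), conjPair N q =
      Sum.elim (fun j => (t j : ℂ) * starRingEnd ℂ (conjPair N p (Sum.inr j)))
        (fun j => (t j : ℂ) * starRingEnd ℂ (conjPair N p (Sum.inl j))) := by
  obtain ⟨⟨η, θ⟩, rfl⟩ := hp
  refine ⟨_, ⟨(η + ⟨orbitMap R.hLift z θ,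
    mem_levelSubmodule_iff.2 (orbitMap_mem_tangentLevel z _)⟩, -θ), rfl⟩, ?_⟩
  have htt : ∀ j, (t j : ℂ) * starRingEnd ℂ (t j) = 1 := fun j => by
    rw [← Circle.coe_inv_eq_conj, ← Circle.coe_mul, mul_inv_cancel, Circle.coe_one]
  funext j
  rcases j with j | j
  · simp only [Sum.elim_inl, conjPair_inl, conjPair_inr, lagMap_apply, Submodule.coe_add,
      Pi.add_apply, map_add, orbitMap_apply, rotate, map_mul, Complex.conj_I, Complex.conj_ofReal]
    linear_combination (-(starRingEnd ℂ (η.1 j) - Complex.I * (θ.1 j) * starRingEnd ℂ (z j))) *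
      htt j
  · simp only [Sum.elim_inr, conjPair_inl, conjPair_inr, lagMap_apply, Submodule.coe_add,
      Pi.add_apply, orbitMap_apply, rotate, Complex.conj_conj, NegMemClass.coe_neg, Pi.neg_apply,
      Complex.ofReal_neg]
    ring

theorem mem_tangentLevel_of_mem_lag {z : Fin N → ℂ} {t : StdTorus N}
    {p : (Fin N → ℂ) × (Fin N → ℂ)} (hp : p ∈ LinearMap.range (R.lagMap z t)) :
    p.1 ∈ tangentLevel Y.k z ∧ p.2 ∈ tangentLevel R.hLift (rotate t z) := by
  obtain ⟨⟨η, θ⟩, rfl⟩ := hp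
  refine ⟨tangentLevel_anti R.k_le_hLift z (mem_levelSubmodule_iff.1 η.2), ?_⟩
  rw [← mem_levelSubmodule_iff, lagMap_apply]
  exact Submodule.add_mem _
    (mem_levelSubmodule_iff.2 (rotate_mem_tangentLevel (mem_levelSubmodule_iff.1 η.2)))
    (mem_levelSubmodule_iff.2 (orbitMap_mem_tangentLevel _ _))

theorem orbitPair_mem_lag {z : Fin N → ℂ} {t : StdTorus N} (c : Y.k × R.hLift) :
    R.orbitPair z (rotate t z) c ∈ LinearMap.range (R.lagMap z t) := by
  obtain ⟨κ, θ⟩ := c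
  let κ' : R.hLift := ⟨κ.1, R.k_le_hLift κ.2⟩
  refine ⟨(⟨orbitMap R.hLift z κ', mem_levelSubmodule_iff.2 (orbitMap_mem_tangentLevel z _)⟩,
    θ - κ'), ?_⟩
  rw [lagMap_apply]
  refine Prod.ext rfl ?_
  simp only [rotate_orbitMap, map_sub]
  exact add_sub_cancel _ _

end ToricReduction

/-! ### Arguments in turns -/

/-- `c` is nonzero with argument `θ`, measured in turns. -/
def IsTurn (c : ℂ) (θ : ℝ) : Prop :=
  c ≠ 0 ∧ c = (‖c‖ : ℂ) * Complex.exp (2 * π * θ * Complex.I)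

theorem isTurn_exp (θ : ℝ) : IsTurn (Complex.exp (2 * π * θ * Complex.I)) θ := by
  refine ⟨Complex.exp_ne_zero _, ?_⟩
  have : (2 * π * θ * Complex.I : ℂ) = ((2 * π * θ : ℝ) : ℂ) * Complex.I := by push_cast; ring
  rw [this, Complex.norm_exp_ofReal_mul_I, Complex.ofReal_one, one_mul]

theorem isTurn_of_pos {c : ℝ} (hc : 0 < c) : IsTurn c 0 := by
  refine ⟨by exact_mod_cast hc.ne', ?_⟩
  simp [abs_of_pos hc]

theorem IsTurn.mul {c c' : ℂ} {θ θ' : ℝ} (h : IsTurn c θ) (h' : IsTurn c' θ') :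
    IsTurn (c * c') (θ + θ') := by
  refine ⟨mul_ne_zero h.1 h'.1, ?_⟩
  rw [norm_mul, Complex.ofReal_add, mul_add, add_mul, Complex.exp_add]
  nth_rewrite 1 [h.2, h'.2]
  push_cast
  ring

theorem IsTurn.exp_sub {c : ℂ} {θ θ' : ℝ} (h : IsTurn c θ) (h' : IsTurn c θ') :
    Complex.exp (2 * π * ((θ - θ' : ℝ) : ℂ) * Complex.I) = 1 := by
  have hn : (‖c‖ : ℂ) ≠ 0 := by simpa using h.1
  have h1 := mul_left_cancel₀ hn (h.2.symm.trans h'.2)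
  rw [Complex.ofReal_sub, mul_sub, sub_mul, Complex.exp_sub, h1, div_self (Complex.exp_ne_zero _)]

/-! ### Linear algebra of trivializations -/

theorem finrank_submodule_prod {V W : Type*} [AddCommGroup V] [Module ℝ V] [AddCommGroup W]
    [Module ℝ W] [FiniteDimensional ℝ V] [FiniteDimensional ℝ W] (p : Submodule ℝ V)
    (q : Submodule ℝ W) :
    Module.finrank ℝ (p.prod q) = Module.finrank ℝ p + Module.finrank ℝ q := by
  have h := LinearMap.finrank_range_of_inj (f := p.subtype.prodMap q.subtype)
    (Function.Injective.prodMap p.injective_subtype q.injective_subtype)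
  rw [LinearMap.range_prodMap, Submodule.range_subtype, Submodule.range_subtype,
    Module.finrank_prod] at h
  exact h

namespace ToricReduction
variable {N : ℕ} {Y : ToricManifold N} {R : ToricReduction Y}

namespace SympTriv
variable {w : C(Disc, Y.Space × R.Space)} {l : R.DiscLift w} (Φ : R.SympTriv l) (ζ : Disc)

/-- The trivialization as a map to the standard symplectic space. -/
def stdMap : (Fin Φ.r → ℂ) →ₗ[ℝ] (Fin N ⊕ Fin N → ℂ) := conjPair N ∘ₗ Φ.map ζ

/-- The basis of the tangent spaces of the orbits of the acting tori of `Y` and `X`. -/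
def orbitFrame (l : R.DiscLift w) (ζ : Disc) (c : Fin (Module.finrank ℝ (Y.k × R.hLift))) :
    Fin N ⊕ Fin N → ℂ :=
  conjPair N (R.orbitPair (l.fst ζ) (l.snd ζ) (Module.finBasis ℝ (Y.k × R.hLift) c))

theorem linearIndependent_orbitFrame : LinearIndependent ℝ (orbitFrame l ζ) := by
  have h := (Module.finBasis ℝ (Y.k × R.hLift)).linearIndependent.map'
    (conjPair N ∘ₗ R.orbitPair (l.fst ζ) (l.snd ζ)) (LinearMap.ker_eq_bot.2
      (conjPair_injective.comp
        (orbitPair_injective (l.fst_rep ζ).freeAt (l.snd_rep ζ).freeAt)))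
  exact h

theorem sympForm_stdMap (b b' : Fin Φ.r → ℂ) :
    sympForm _ (Φ.stdMap ζ b) (Φ.stdMap ζ b') = sympForm (Fin Φ.r) b b' := by
  rw [stdMap, LinearMap.comp_apply, LinearMap.comp_apply, sympForm_conjPair]
  exact Φ.symp ζ b b'

theorem sympForm_orbitFrame_stdMap (c) (b : Fin Φ.r → ℂ) :
    sympForm _ (orbitFrame l ζ c) (Φ.stdMap ζ b) = 0 :=
  sympForm_orbitPair (Φ.mem_fst ζ b) (Φ.mem_snd ζ b) _

theorem sympForm_orbitFrame_orbitFrame (c d) :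
    sympForm _ (orbitFrame l ζ c) (orbitFrame l ζ d) = 0 :=
  sympForm_orbitPair (orbitMap_mem_tangentLevel _ _) (orbitMap_mem_tangentLevel _ _) _

/-- The trivialization together with the infinitesimal action. -/
def total : ((Fin Φ.r → ℂ) × (Y.k × R.hLift)) →ₗ[ℝ] (Fin N → ℂ) × (Fin N → ℂ) :=
  (Φ.map ζ).coprod (R.orbitPair (l.fst ζ) (l.snd ζ))

theorem total_injective : Function.Injective (Φ.total ζ) := by
  rw [← LinearMap.ker_eq_bot, LinearMap.ker_eq_bot']
  rintro ⟨b, c⟩ h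
  rw [total, LinearMap.coprod_apply] at h
  have hb : b = 0 := eq_zero_of_sympForm_eq_zero fun b' => by
    rw [← Φ.sympForm_stdMap ζ, stdMap, LinearMap.comp_apply, eq_neg_of_add_eq_zero_left h, map_neg,
      map_neg, LinearMap.neg_apply, LinearMap.comp_apply,
      sympForm_orbitPair (Φ.mem_fst ζ b') (Φ.mem_snd ζ b'), neg_zero]
  subst hb
  rw [map_zero, zero_add] at h
  rw [(injective_iff_map_eq_zero _).1 (orbitPair_injective (l.fst_rep ζ).freeAt
    (l.snd_rep ζ).freeAt) c h]
  rfl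

theorem range_total : LinearMap.range (Φ.total ζ) =
    (levelSubmodule Y.k (l.fst ζ)).prod (levelSubmodule R.hLift (l.snd ζ)) := by
  refine le_antisymm ?_ ?_
  · rintro _ ⟨⟨b, c⟩, rfl⟩
    rw [total, LinearMap.coprod_apply]
    refine Submodule.add_mem _ ⟨?_, ?_⟩ ⟨?_, ?_⟩ <;> rw [SetLike.mem_coe, mem_levelSubmodule_iff]
    · exact Φ.mem_fst ζ b
    · exact Φ.mem_snd ζ b
    · exact orbitMap_mem_tangentLevel _ _
    · exact orbitMap_mem_tangentLevel _ _
  · rintro ⟨ξ, ξ'⟩ ⟨h1, h2⟩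
    obtain ⟨b, hb1, hb2⟩ := Φ.surj ζ ξ (mem_levelSubmodule_iff.1 h1) ξ'
      (mem_levelSubmodule_iff.1 h2)
    obtain ⟨κ, hκ⟩ := mem_tangentOrbit_iff.1 hb1
    obtain ⟨θ, hθ⟩ := mem_tangentOrbit_iff.1 hb2
    refine ⟨(b, (κ, θ)), ?_⟩
    rw [total, LinearMap.coprod_apply]
    refine Prod.ext ?_ ?_
    · simp [orbitPair, hκ]
    · simp [orbitPair, hθ]

theorem r_add_finrank : Φ.r + Module.finrank ℝ (Y.k × R.hLift) = 2 * N := by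
  have ζ : Disc := ⟨0, by simp⟩
  have h1 := LinearMap.finrank_range_of_inj (Φ.total_injective ζ)
  rw [range_total, finrank_submodule_prod, Module.finrank_prod, Module.finrank_prod,
    finrank_real_of_complex, Module.finrank_fin_fun] at h1
  rw [Module.finrank_prod]
  have h2 := finrank_levelSubmodule (l.fst_rep ζ).freeAt
  have h3 := finrank_levelSubmodule (l.snd_rep ζ).freeAt
  omega

/-- The subspace of `ℂ^r` that corresponds to the tangent space of the correspondence. -/
def lagSubmodule (z : Fin N → ℂ) (t : StdTorus N) : Submodule ℝ (Fin Φ.r → ℂ) :=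
  (LinearMap.range (R.lagMap z t)).comap (Φ.map ζ)

/-- A dimension count: the tangent space of `{(z, t z)}` has dimension `2 N`, and it contains the
tangent spaces of the orbits. -/
theorem finrank_lagSubmodule {t : StdTorus N} (hz : FreeAt R.hLift (l.fst ζ))
    (ht : l.snd ζ = rotate t (l.fst ζ)) :
    Module.finrank ℝ (Φ.lagSubmodule ζ (l.fst ζ) t) = Φ.r := by
  have h1 : (LinearMap.range (R.lagMap (l.fst ζ) t)).comap (Φ.total ζ) =
      (Φ.lagSubmodule ζ (l.fst ζ) t).prod ⊤ := by
    ext ⟨b, c⟩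
    rw [Submodule.mem_comap, total, LinearMap.coprod_apply, ht]
    rw [Submodule.add_mem_iff_left _ (orbitPair_mem_lag c)]
    simp [lagSubmodule]
  have h2 : Submodule.map (Φ.total ζ) ((LinearMap.range (R.lagMap (l.fst ζ) t)).comap (Φ.total ζ)) =
      LinearMap.range (R.lagMap (l.fst ζ) t) := by
    refine Submodule.map_comap_eq_self fun p hp => ?_
    rw [range_total, Submodule.mem_prod, mem_levelSubmodule_iff, mem_levelSubmodule_iff, ht]
    exact mem_tangentLevel_of_mem_lag hp
  have h3 := (Submodule.equivMapOfInjective _ (Φ.total_injective ζ)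
    ((LinearMap.range (R.lagMap (l.fst ζ) t)).comap (Φ.total ζ))).finrank_eq
  rw [h2, h1, finrank_submodule_prod, finrank_top, finrank_range_lagMap hz] at h3
  have h4 := Φ.r_add_finrank
  omega

/-- An ordering of the coordinates of `ℂ^N × ℂ^N` by the vectors of a frame. -/
def coordEquiv : Fin Φ.r ⊕ Fin (Module.finrank ℝ (Y.k × R.hLift)) ≃ Fin N ⊕ Fin N :=
  Fintype.equivOfCardEq (by
    have := Φ.r_add_finrank
    simp only [Fintype.card_sum, Fintype.card_fin]
    omega)

/-- The vectors `p Φ(a_l) - i q Φ(i a_l)`, which are `Φ(a_l)` for `p = 1` and the images under the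
complex linear part of `Φ` for `p = q = 1/2`, together with the tangent vectors of the orbits. -/
def deformedFrame (p q : ℝ) (a : Fin Φ.r → Fin Φ.r → ℂ) :
    Fin Φ.r ⊕ Fin (Module.finrank ℝ (Y.k × R.hLift)) → Fin N ⊕ Fin N → ℂ :=
  Sum.elim (fun j => (p : ℂ) • Φ.stdMap ζ (a j) - (q * Complex.I : ℂ) •
    Φ.stdMap ζ (Complex.I • a j)) (orbitFrame l ζ)

theorem frameDet_deformedFrame_ne_zero {p q : ℝ} (hp : 0 ≤ p) (hq : 0 ≤ q) (hpq : p + q = 1)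
    {a : Fin Φ.r → Fin Φ.r → ℂ} (ha : ∀ j m, sympForm (Fin Φ.r) (a j) (a m) = 0)
    (hind : LinearIndependent ℝ a) : frameDet Φ.coordEquiv (Φ.deformedFrame ζ p q a) ≠ 0 :=
  frameDet_ne_zero _ (linearIndependent_deformed (Φ.sympForm_stdMap ζ)
    (Φ.sympForm_orbitFrame_stdMap ζ) (sympForm_orbitFrame_orbitFrame ζ)
    (linearIndependent_orbitFrame ζ) ha hind hp hq hpq)

theorem deformedFrame_real (p q : ℝ) (c : Fin Φ.r → Fin Φ.r → ℝ)
    (a : Fin Φ.r → Fin Φ.r → ℂ) :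
    frameDet Φ.coordEquiv (Φ.deformedFrame ζ p q fun j => ∑ m, c j m • a m) =
      ((Matrix.of c).det : ℂ) * frameDet Φ.coordEquiv (Φ.deformedFrame ζ p q a) := by
  have h := frameDet_sum_elim Φ.coordEquiv ((Matrix.of c).map Complex.ofRealHom)
    (fun j => (p : ℂ) • Φ.stdMap ζ (a j) - (q * Complex.I : ℂ) • Φ.stdMap ζ (Complex.I • a j))
    (orbitFrame l ζ)
  rw [← RingHom.mapMatrix_apply, ← RingHom.map_det] at h
  refine Eq.trans (congrArg (fun f => frameDet Φ.coordEquiv (Sum.elim f (orbitFrame l ζ)))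
    (funext fun j => ?_)) h
  simp only [map_sum, map_smul, Finset.smul_sum, RingHom.mapMatrix_apply, Matrix.map_apply,
    Matrix.of_apply, Complex.ofRealHom_eq_coe, smul_sub, Finset.sum_sub_distrib, Complex.coe_smul,
    smul_comm Complex.I]
  congr 1
  · exact Finset.sum_congr rfl fun m _ => smul_comm p (c j m) (Φ.stdMap ζ (a m))
  · exact Finset.sum_congr rfl fun m _ =>
      smul_comm (q * Complex.I : ℂ) (c j m) (Φ.stdMap ζ (Complex.I • a m))

theorem eq_sum_real_basis {r : ℕ} (v : Fin r → ℂ) :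
    v = ∑ m, ((v m).re • (Pi.single m 1 : Fin r → ℂ) +
      (v m).im • (Complex.I • (Pi.single m 1 : Fin r → ℂ))) := by
  funext k
  rw [Finset.sum_apply, Finset.sum_eq_single k]
  · simp [mul_comm Complex.I]
  · intro m _ hm
    simp [hm.symm]
  · simp

/-- The map `v ↦ (Φ(v) - i Φ(i v)) / 2` is complex linear. -/
theorem stdMap_linear_part (v : Fin Φ.r → ℂ) :
    ((1 / 2 : ℝ) : ℂ) • Φ.stdMap ζ v - ((1 / 2 : ℝ) * Complex.I : ℂ) • Φ.stdMap ζ (Complex.I • v) =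
      ∑ m, v m • (((1 / 2 : ℝ) : ℂ) • Φ.stdMap ζ (Pi.single m 1) -
        ((1 / 2 : ℝ) * Complex.I : ℂ) • Φ.stdMap ζ (Complex.I • Pi.single m 1)) := by
  have hv := eq_sum_real_basis v
  have hIv : Complex.I • v = ∑ m, ((v m).re • (Complex.I • (Pi.single m 1 : Fin Φ.r → ℂ)) -
      (v m).im • (Pi.single m 1 : Fin Φ.r → ℂ)) := by
    conv_lhs => rw [hv]
    rw [Finset.smul_sum]
    refine Finset.sum_congr rfl fun m _ => ?_
    rw [smul_add, smul_comm Complex.I, smul_comm Complex.I, smul_smul Complex.I Complex.I,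
      Complex.I_mul_I, neg_one_smul, smul_neg, sub_eq_add_neg]
  nth_rewrite 1 [hv]
  rw [hIv]
  simp only [map_sum, map_add, map_sub, map_smul, Finset.smul_sum, ← Finset.sum_sub_distrib]
  refine Finset.sum_congr rfl fun m _ => funext fun k => ?_
  simp only [Pi.add_apply, Pi.sub_apply, Pi.smul_apply, smul_eq_mul, Complex.real_smul]
  nth_rewrite 5 [← Complex.re_add_im (v m)]
  ring_nf
  simp only [Complex.I_sq]
  ring

theorem deformedFrame_complex (a : Matrix (Fin Φ.r) (Fin Φ.r) ℂ) :
    frameDet Φ.coordEquiv (Φ.deformedFrame ζ (1 / 2) (1 / 2) a) =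
      a.det * frameDet Φ.coordEquiv (Φ.deformedFrame ζ (1 / 2) (1 / 2) fun m => Pi.single m 1) := by
  have h := frameDet_sum_elim Φ.coordEquiv a
    (fun m => ((1 / 2 : ℝ) : ℂ) • Φ.stdMap ζ (Pi.single m 1) -
      ((1 / 2 : ℝ) * Complex.I : ℂ) • Φ.stdMap ζ (Complex.I • Pi.single m 1)) (orbitFrame l ζ)
  exact Eq.trans (congrArg (fun f => frameDet Φ.coordEquiv (Sum.elim f (orbitFrame l ζ)))
    (funext fun j => Φ.stdMap_linear_part ζ (a j))) h

theorem continuous_map_apply {X : Type*} [TopologicalSpace X] {z : X → Disc} (hz : Continuous z)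
    {b : X → Fin Φ.r → ℂ} (hb : Continuous b) : Continuous fun x => Φ.map (z x) (b x) := by
  have h : (fun x => Φ.map (z x) (b x)) = fun x =>
      ∑ m, ((b x m).re • Φ.map (z x) (Pi.single m 1) +
        (b x m).im • Φ.map (z x) (Complex.I • Pi.single m 1)) := by
    funext x
    nth_rewrite 1 [eq_sum_real_basis (b x)]
    simp only [map_sum, map_add, map_smul]
  rw [h]
  have hc := fun v => (Φ.continuous_map v).comp hz
  simp only [Function.comp_def] at hc
  have h1 := fun m => hc (Pi.single m 1)
  have h2 := fun m => hc (Complex.I • Pi.single m 1)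
  have hre : ∀ m, Continuous fun x => (b x m).re := fun m => by fun_prop
  have him : ∀ m, Continuous fun x => (b x m).im := fun m => by fun_prop
  exact continuous_finsetSum _ fun m _ => ((hre m).smul (h1 m)).add ((him m).smul (h2 m))

theorem continuous_conjPair : Continuous (conjPair N) :=
  LinearMap.continuous_of_finiteDimensional _

theorem continuous_orbitFrame (c) : Continuous fun ζ => orbitFrame l ζ c := by
  let x := Module.finBasis ℝ (Y.k × R.hLift) c
  have h1 : Continuous fun ζ => orbitMap Y.k (l.fst ζ) x.1 := continuous_pi fun j => by
    simp only [orbitMap_apply]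
    fun_prop
  have h2 : Continuous fun ζ => orbitMap R.hLift (l.snd ζ) x.2 := continuous_pi fun j => by
    simp only [orbitMap_apply]
    fun_prop
  exact continuous_conjPair.comp (h1.prodMk h2)

end SympTriv
end ToricReduction

/-! ### The winding number of a framing -/

namespace ToricReduction
variable {N : ℕ} {Y : ToricManifold N} {R : ToricReduction Y}

namespace SympTriv
variable {w : C(Disc, Y.Space × R.Space)} {l : R.DiscLift w} (Φ : R.SympTriv l) {ζ : Disc}
  {t : StdTorus N} {a : Fin Φ.r → Fin Φ.r → ℂ}

theorem sympForm_frame (ha : Submodule.span ℝ (Set.range a) = Φ.lagSubmodule ζ (l.fst ζ) t)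
    (j m : Fin Φ.r) : sympForm (Fin Φ.r) (a j) (a m) = 0 := by
  have h : ∀ j, Φ.map ζ (a j) ∈ LinearMap.range (R.lagMap (l.fst ζ) t) := fun j => by
    have : a j ∈ Φ.lagSubmodule ζ (l.fst ζ) t := by
      rw [← ha]
      exact Submodule.subset_span ⟨j, rfl⟩
    exact this
  obtain ⟨x, hx⟩ := h j
  obtain ⟨y, hy⟩ := h m
  rw [← Φ.sympForm_stdMap ζ, stdMap, LinearMap.comp_apply, LinearMap.comp_apply, ← hx, ← hy,
    sympForm_lagMap]

theorem linearIndependent_frame (hz : FreeAt R.hLift (l.fst ζ))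
    (ht : l.snd ζ = rotate t (l.fst ζ))
    (ha : Submodule.span ℝ (Set.range a) = Φ.lagSubmodule ζ (l.fst ζ) t) :
    LinearIndependent ℝ a := by
  rw [linearIndependent_iff_card_eq_finrank_span, Set.finrank, ha,
    Φ.finrank_lagSubmodule ζ hz ht, Fintype.card_fin]

/-- Along the boundary, the images of a Lagrangian frame and the tangent vectors of the orbits form
a frame of the tangent space of `{(z, t z)}`, so the involution of the latter determines the phase
of the determinant up to sign. -/
theorem frameDet_sq_eq (hz : FreeAt R.hLift (l.fst ζ)) (ht : l.snd ζ = rotate t (l.fst ζ))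
    (ha : Submodule.span ℝ (Set.range a) = Φ.lagSubmodule ζ (l.fst ζ) t) :
    ∃ ρ : ℝ, frameDet Φ.coordEquiv (Φ.deformedFrame ζ 1 0 a) ^ 2 =
      ρ * (∏ j, (t j : ℂ)) ^ 2 := by
  have hinl : ∀ j, Φ.deformedFrame ζ 1 0 a (Sum.inl j) = conjPair N (Φ.map ζ (a j)) := fun j => by
    simp [deformedFrame, stdMap]
  have hinr : ∀ c, Φ.deformedFrame ζ 1 0 a (Sum.inr c) = conjPair N
      (R.orbitPair (l.fst ζ) (l.snd ζ) (Module.finBasis ℝ (Y.k × R.hLift) c)) := fun c => rfl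
  have hmem : ∀ x, ∃ p ∈ LinearMap.range (R.lagMap (l.fst ζ) t),
      Φ.deformedFrame ζ 1 0 a x = conjPair N p := by
    rintro (j | c)
    · refine ⟨_, ?_, hinl j⟩
      have : a j ∈ Φ.lagSubmodule ζ (l.fst ζ) t := by
        rw [← ha]
        exact Submodule.subset_span ⟨j, rfl⟩
      exact this
    · refine ⟨_, ?_, hinr c⟩
      rw [ht]
      exact orbitPair_mem_lag _
  have hspan : ∀ q ∈ LinearMap.range (R.lagMap (l.fst ζ) t), conjPair N q ∈
      Submodule.span ℝ (Set.range (Φ.deformedFrame ζ 1 0 a)) := by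
    intro q hq
    have hq' : q ∈ LinearMap.range (Φ.total ζ) := by
      rw [range_total, Submodule.mem_prod, mem_levelSubmodule_iff, mem_levelSubmodule_iff, ht]
      exact mem_tangentLevel_of_mem_lag hq
    obtain ⟨⟨b, c⟩, rfl⟩ := hq'
    rw [total, LinearMap.coprod_apply] at hq ⊢
    rw [ht, Submodule.add_mem_iff_left _ (orbitPair_mem_lag c)] at hq
    have hb : b ∈ Submodule.span ℝ (Set.range a) := by rw [ha]; exact hq
    have hc : c ∈ Submodule.span ℝ (Set.range (Module.finBasis ℝ (Y.k × R.hLift))) := by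
      rw [Module.Basis.span_eq]; trivial
    rw [map_add]
    refine Submodule.add_mem _ ?_ ?_
    · have h1 := Submodule.mem_map_of_mem (f := conjPair N ∘ₗ Φ.map ζ) hb
      rw [Submodule.map_span, ← Set.range_comp] at h1
      refine Submodule.span_mono ?_ h1
      rintro _ ⟨j, rfl⟩
      exact ⟨Sum.inl j, hinl j⟩
    · have h1 := Submodule.mem_map_of_mem
        (f := conjPair N ∘ₗ R.orbitPair (l.fst ζ) (l.snd ζ)) hc
      rw [Submodule.map_span, ← Set.range_comp] at h1
      refine Submodule.span_mono ?_ h1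
      rintro _ ⟨c, rfl⟩
      exact ⟨Sum.inr c, hinr c⟩
  refine exists_frameDet_sq_eq _ (Φ.frameDet_deformedFrame_ne_zero ζ zero_le_one le_rfl
    (add_zero 1) (Φ.sympForm_frame ha) (Φ.linearIndependent_frame hz ht ha)) t fun x => ?_
  obtain ⟨p, hp, e⟩ := hmem x
  obtain ⟨q, hq, hpq⟩ := involution_mem_lag hp
  rw [e, ← hpq]
  exact hspan q hq

theorem continuous_frameDet_deformedFrame {X : Type*} [TopologicalSpace X] {z : X → Disc}
    (hz : Continuous z) {p q : X → ℝ} (hp : Continuous p) (hq : Continuous q)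
    {a : X → Fin Φ.r → Fin Φ.r → ℂ} (ha : Continuous a) :
    Continuous fun x => frameDet Φ.coordEquiv (Φ.deformedFrame (z x) (p x) (q x) (a x)) := by
  refine continuous_frameDet _ ?_
  rintro (j | c)
  · have ha' : Continuous fun x => a x j := by fun_prop
    have h1 : Continuous fun x => Φ.stdMap (z x) (a x j) :=
      continuous_conjPair.comp (Φ.continuous_map_apply hz ha')
    have h2 : Continuous fun x => Φ.stdMap (z x) (Complex.I • a x j) :=
      continuous_conjPair.comp (Φ.continuous_map_apply hz (by fun_prop))
    simp only [deformedFrame, Sum.elim_inl]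
    fun_prop
  · exact (continuous_orbitFrame c).comp hz

end SympTriv

/-- The radial contraction of the boundary of the disc. -/
def radial (x : I × I) : Disc := ⟨(x.1 : ℝ) * (bdryPoint x.2).1, by
  rw [mem_closedBall_zero_iff, norm_mul, norm_bdryPoint, mul_one, Complex.norm_real,
    Real.norm_of_nonneg x.1.2.1]
  exact x.1.2.2⟩

theorem continuous_radial : Continuous radial := by
  have := continuous_bdryPoint
  refine Continuous.subtype_mk ?_ _
  fun_prop

theorem radial_one (τ : I) : radial (1, τ) = bdryPoint τ := by
  ext
  simp [radial]

theorem radial_zero (τ τ' : I) : radial (0, τ) = radial (0, τ') := by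
  ext
  simp [radial]

theorem radial_end (s : I) : radial (s, 1) = radial (s, 0) := by
  ext
  simp [radial, bdryPoint_zero_eq_one]

namespace LagFraming
variable {w : C(Disc, Y.Space × R.Space)} {l : R.DiscLift w} {Φ : R.SympTriv l}

/-- The span of a framing as a subspace of `ℂ^r`. -/
theorem span_eq (F : R.LagFraming Φ) {φ : C(I, Fin N → ℝ)} (hw : R.IsBounded w)
    (hφ : IsTransition l φ) (τ : I) : Submodule.span ℝ (Set.range (F.frame τ)) =
      Φ.lagSubmodule (bdryPoint τ) (l.fst (bdryPoint τ)) (torusExp (φ τ)) := by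
  ext b
  rw [F.span_frame, (hφ τ).2, mem_lagTangent_iff (hφ τ).1
    (represents_of_mem_lag (hw _ (norm_bdryPoint _)) (l.fst_rep _)).freeAt]
  rfl

/-- The winding number of the squared determinant of a framing is twice the winding number of the
product of the coordinates of the transition path. While the disc is shrunk radially, the symplectic
trivialization is deformed to its complex linear part; at the end only the determinant of the
framing is left, and at the beginning the framing spans the tangent spaces of the correspondence. -/
theorem arg_sub_eq (F : R.LagFraming Φ) {φ : C(I, Fin N → ℝ)} (hw : R.IsBounded w)
    (hφ : IsTransition l φ) : F.arg 1 - F.arg 0 = 2 * ∑ j, (φ 1 - φ 0) j := by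
  have hfree : ∀ τ : I, FreeAt R.hLift (l.fst (bdryPoint τ)) := fun τ =>
    (represents_of_mem_lag (hw _ (norm_bdryPoint _)) (l.fst_rep _)).freeAt
  have hspan := F.span_eq hw hφ
  have hnull := fun τ => Φ.sympForm_frame (hspan τ)
  have hind := fun τ => Φ.linearIndependent_frame (hfree τ) (hφ τ).2 (hspan τ)
  let A : I → Fin Φ.r → Fin Φ.r → ℂ := fun τ => F.frame τ
  have hA : ∀ τ b, b ∈ Submodule.span ℝ (Set.range (A τ)) ↔ _ := F.span_frame
  let D : I × I → ℂ := fun x => frameDet Φ.coordEquiv (Φ.deformedFrame (radial x)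
    ((1 + x.1) / 2) ((1 - x.1) / 2) (A x.2))
  have hD : Continuous D := Φ.continuous_frameDet_deformedFrame continuous_radial (by fun_prop)
    (by fun_prop) (F.continuous_frame.comp continuous_snd)
  have hD0 : ∀ x, D x ≠ 0 := fun x => by
    refine Φ.frameDet_deformedFrame_ne_zero _ ?_ ?_ (by ring) (hnull x.2) (hind x.2)
    · have := x.1.2.1
      positivity
    · have := x.1.2.2
      exact div_nonneg (by linarith) zero_le_two
  obtain ⟨Θ, hΘ⟩ := exists_continuous_turns (⟨fun x => D x ^ 2, by fun_prop⟩ : C(I × I, ℂ))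
    fun x => pow_ne_zero 2 (hD0 x)
  have hturn : ∀ x, IsTurn (D x ^ 2) (Θ x) := fun x => ⟨pow_ne_zero 2 (hD0 x), hΘ x⟩
  -- The frames at the two ends of the path span the same subspace.
  obtain ⟨c, hc⟩ : ∃ c : Fin Φ.r → Fin Φ.r → ℝ, (fun j => ∑ m, c j m • A 0 m) = A 1 := by
    have h : ∀ j, ∃ c : Fin Φ.r → ℝ, ∑ m, c m • A 0 m = A 1 j := fun j => by
      rw [← Submodule.mem_span_range_iff_exists_fun, hA]
      have : A 1 j ∈ Submodule.span ℝ (Set.range (A 1)) := Submodule.subset_span ⟨j, rfl⟩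
      rw [hA] at this
      simpa [bdryPoint_zero_eq_one] using this
    choose c hc using h
    exact ⟨c, funext hc⟩
  let M := Matrix.of c
  have hends : ∀ s : I, D (s, 1) = (M.det : ℂ) * D (s, 0) := fun s => by
    have h1 := Φ.deformedFrame_real (radial (s, 1)) ((1 + s) / 2) ((1 - s) / 2) c (A 0)
    rw [hc, radial_end] at h1
    simp only [D, radial_end]
    exact h1
  have hMdet : 0 < M.det ^ 2 := by
    have h1 := hends 0
    have : M.det ≠ 0 := fun h0 => hD0 (0, 1) (by rw [h1, h0, Complex.ofReal_zero, zero_mul])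
    positivity
  have hshift : Θ (1, 1) - Θ (1, 0) = Θ (0, 1) - Θ (0, 0) := by
    refine eq_of_exp_turns_eq (g := fun s : I => Θ (s, 1) - Θ (s, 0)) (c := 1) (by fun_prop)
      (fun s => ?_) 1 0
    refine (hturn (s, 1)).exp_sub ?_
    have := (isTurn_of_pos hMdet).mul (hturn (s, 0))
    rw [zero_add] at this
    convert this using 1
    rw [hends s]
    push_cast
    ring
  have hB : Θ (0, 1) - F.arg 1 = Θ (0, 0) - F.arg 0 := by
    let c₀ : ℂ := frameDet Φ.coordEquiv
      (Φ.deformedFrame (radial (0, 0)) (1 / 2) (1 / 2) fun m => Pi.single m 1)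
    have hc : ∀ τ : I, D (0, τ) = (F.frame τ).det * c₀ := fun τ => by
      have := Φ.deformedFrame_complex (radial (0, τ)) (F.frame τ)
      rw [radial_zero τ 0] at this
      simp only [D, c₀, Set.Icc.coe_zero, add_zero, sub_zero]
      rw [radial_zero τ 0]
      exact this
    have hc₀ : IsTurn (c₀ ^ 2) ((c₀ ^ 2).arg / (2 * π)) := by
      refine ⟨pow_ne_zero 2 fun h => hD0 (0, 0) (by rw [hc, h, mul_zero]), ?_⟩
      have h : (2 * π * ((c₀ ^ 2).arg / (2 * π) : ℝ) : ℂ) = (c₀ ^ 2).arg := by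
        push_cast
        field_simp
      rw [h, Complex.norm_mul_exp_arg_mul_I]
    have hdet : ∀ τ : I, IsTurn ((F.frame τ).det ^ 2) (F.arg τ) := fun τ =>
      ⟨pow_ne_zero 2 fun h => hD0 (0, τ) (by rw [hc, h, zero_mul]), F.arg_spec τ⟩
    have := eq_of_exp_turns_eq (g := fun τ : I => Θ (0, τ) - (F.arg τ + (c₀ ^ 2).arg / (2 * π)))
      (c := 1) (by fun_prop) (fun τ => by
        refine (hturn (0, τ)).exp_sub ?_
        rw [hc, mul_pow]
        exact (hdet τ).mul hc₀) 1 0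
    linarith
  -- The real factor `ρ` may be negative, so fourth powers of the determinant are compared.
  have hC : 2 * Θ (1, 1) - 4 * ∑ j, φ 1 j = 2 * Θ (1, 0) - 4 * ∑ j, φ 0 j := by
    refine eq_of_exp_turns_eq (g := fun τ : I => 2 * Θ (1, τ) - 4 * ∑ j, φ τ j)
      (c := 1) (by fun_prop) (fun τ => ?_) 1 0
    obtain ⟨ρ, hρ⟩ := Φ.frameDet_sq_eq (hfree τ) (hφ τ).2 (hspan τ)
    have hD1 : D (1, τ) ^ 2 = ρ * (∏ j, (torusExp (φ τ) j : ℂ)) ^ 2 := by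
      rw [← hρ]
      simp only [D, radial_one]
      norm_num
      rfl
    have hprod : ∏ j, (torusExp (φ τ) j : ℂ) =
        Complex.exp (2 * π * ((∑ j, φ τ j : ℝ) : ℂ) * Complex.I) := by
      simp_rw [coe_torusExp]
      rw [← Complex.exp_sum]
      congr 1
      push_cast
      rw [Finset.mul_sum, Finset.sum_mul]
    have hρ0 : 0 < ρ ^ 2 := by
      have : ρ ≠ 0 := fun h => pow_ne_zero 2 (hD0 (1, τ)) (by rw [hD1, h]; simp)
      positivity
    have h1 := (hturn (1, τ)).mul (hturn (1, τ))
    have h2 := isTurn_exp (∑ j, φ τ j)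
    rw [← hprod] at h2
    have h3 := (isTurn_of_pos hρ0).mul ((h2.mul h2).mul (h2.mul h2))
    have h4 : 2 * Θ (1, τ) - 4 * ∑ j, φ τ j = Θ (1, τ) + Θ (1, τ) -
        (0 + (∑ j, φ τ j + ∑ j, φ τ j + (∑ j, φ τ j + ∑ j, φ τ j))) := by ring
    rw [h4]
    refine h1.exp_sub ?_
    convert! h3 using 1
    rw [hD1]
    push_cast
    ring
  simp only [Pi.sub_apply, Finset.sum_sub_distrib]
  linarith

end LagFraming
end ToricReduction

/-! ### Existence of trivializations -/

theorem linearIndependent_complex_of_isotropic {ι C : Type*} [Fintype ι] [Fintype C]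
    {o : C → ι → ℂ} (hoo : ∀ c d, sympForm ι (o c) (o d) = 0) (ho : LinearIndependent ℝ o) :
    LinearIndependent ℂ o := by
  have h := linearIndependent_deformed (r := 0) (Φ := 0) (a := Fin.elim0) (p := 1) (q := 0)
    (fun b b' => by simp [sympForm_apply]) (fun c b => by simp) hoo ho (fun j => j.elim0)
    linearIndependent_empty_type zero_le_one le_rfl (add_zero 1)
  exact h.comp Sum.inr Sum.inr_injective

theorem im_inner_toLp {ι : Type*} [Fintype ι] (ξ η : ι → ℂ) :
    (inner ℂ (WithLp.toLp 2 ξ : EuclideanSpace ℂ ι) (WithLp.toLp 2 η)).im = sympForm ι ξ η := by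
  rw [sympForm_apply, PiLp.inner_apply, Complex.im_sum]
  refine Finset.sum_congr rfl fun j _ => ?_
  simp
  ring

theorem mem_tangentLevel_iff_sympForm {N : ℕ} {s : Submodule ℝ (Fin N → ℝ)} {z ξ : Fin N → ℂ} :
    ξ ∈ tangentLevel s z ↔ ∀ θ, sympForm (Fin N) (orbitMap s z θ) ξ = 0 := by
  refine ⟨fun h => sympForm_orbitMap h, fun h θ hθ => ?_⟩
  have h1 := h ⟨θ, hθ⟩
  rw [sympForm_apply] at h1
  rw [← neg_eq_zero, ← h1, ← Finset.sum_neg_distrib]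
  refine Finset.sum_congr rfl fun j _ => ?_
  simp [orbitMap_apply]
  ring

/-- The inverse of `conjPair`. -/
def conjPairInv (N : ℕ) : (Fin N ⊕ Fin N → ℂ) →ₗ[ℝ] (Fin N → ℂ) × (Fin N → ℂ) where
  toFun v := (fun j => starRingEnd ℂ (v (Sum.inl j)), fun j => v (Sum.inr j))
  map_add' v v' := by ext <;> simp
  map_smul' c v := by ext <;> simp

theorem conjPair_conjPairInv {N : ℕ} (v : Fin N ⊕ Fin N → ℂ) :
    conjPair N (conjPairInv N v) = v := by
  funext j
  rcases j with j | j
  · exact Complex.conj_conj _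
  · rfl

namespace ToricReduction
variable {N : ℕ} {Y : ToricManifold N} {R : ToricReduction Y}

theorem mem_tangentLevel_of_sympForm {z z' : Fin N → ℂ} {p : (Fin N → ℂ) × (Fin N → ℂ)}
    (h : ∀ c, sympForm _ (conjPair N (R.orbitPair z z'
      (Module.finBasis ℝ (Y.k × R.hLift) c))) (conjPair N p) = 0) :
    p.1 ∈ tangentLevel Y.k z ∧ p.2 ∈ tangentLevel R.hLift z' := by
  have h1 : ∀ x : Y.k × R.hLift,
      sympForm _ (conjPair N (R.orbitPair z z' x)) (conjPair N p) = 0 := by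
    intro x
    have : ((sympForm _).flip (conjPair N p)) ∘ₗ conjPair N ∘ₗ R.orbitPair z z' = 0 :=
      (Module.finBasis ℝ (Y.k × R.hLift)).ext fun c => h c
    exact LinearMap.congr_fun this x
  rw [mem_tangentLevel_iff_sympForm, mem_tangentLevel_iff_sympForm]
  refine ⟨fun κ => ?_, fun θ => ?_⟩
  · simpa [sympForm_conjPair, orbitPair] using h1 (κ, 0)
  · simpa [sympForm_conjPair, orbitPair] using h1 (0, θ)

/-- A symplectic trivialization given by a unitary frame of the complex orthogonal complements of
the tangent spaces of the orbits, with a continuous coordinate map. -/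
theorem exists_sympTriv {w : C(Disc, Y.Space × R.Space)} (l : R.DiscLift w) :
    ∃ (Φ : R.SympTriv l) (β : Disc × ((Fin N → ℂ) × (Fin N → ℂ)) → Fin Φ.r → ℂ),
      Continuous β ∧ ∀ ζ p, p.1 ∈ tangentLevel Y.k (l.fst ζ) →
        p.2 ∈ tangentLevel R.hLift (l.snd ζ) →
        ∃ c, p - Φ.map ζ (β (ζ, p)) = R.orbitPair (l.fst ζ) (l.snd ζ) c := by
  let m := Module.finrank ℝ (Y.k × R.hLift)
  let V := EuclideanSpace ℂ (Fin N ⊕ Fin N)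
  let L : (Fin N ⊕ Fin N → ℂ) ≃L[ℂ] V := (EuclideanSpace.equiv _ ℂ).symm
  have hL : ∀ v, L v = WithLp.toLp 2 v := fun v => rfl
  let u : Fin m → C(Disc, V) := fun c => ⟨fun ζ => L (SympTriv.orbitFrame l ζ c),
    L.continuous.comp (SympTriv.continuous_orbitFrame c)⟩
  have hu : ∀ ζ, LinearIndependent ℂ fun c => u c ζ := fun ζ =>
    (linearIndependent_complex_of_isotropic (SympTriv.sympForm_orbitFrame_orbitFrame ζ)
      (SympTriv.linearIndependent_orbitFrame ζ)).map' L.toLinearEquiv.toLinearMap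
        (LinearEquiv.ker _)
  have hV : Module.finrank ℂ V = 2 * N := by
    rw [finrank_euclideanSpace, Fintype.card_sum, Fintype.card_fin, two_mul]
  obtain ⟨r, hr⟩ : ∃ r, m + r = 2 * N := by
    have := (hu ⟨0, by simp⟩).fintype_card_le_finrank
    rw [hV, Fintype.card_fin] at this
    exact ⟨2 * N - m, by omega⟩
  obtain ⟨e, he⟩ := exists_orthonormal_frame u hu (hr.trans hV.symm)
  have horth : ∀ ζ c j, inner ℂ (u c ζ) (e j ζ) = 0 := fun ζ c j => by
    have : e j ζ ∈ (Submodule.span ℂ (Set.range fun c => u c ζ))ᗮ := by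
      rw [← (he ζ).2]
      exact Submodule.subset_span (Set.mem_range_self j)
    exact Submodule.inner_right_of_mem_orthogonal
      (Submodule.subset_span (Set.mem_range_self c)) this
  let E : Disc → (Fin r → ℂ) →ₗ[ℝ] (Fin N ⊕ Fin N → ℂ) := fun ζ =>
    { toFun := fun b => L.symm (∑ j, b j • e j ζ)
      map_add' := fun b b' => by simp [add_smul, Finset.sum_add_distrib]
      map_smul' := fun c b => by
        have h : ∑ j, (c • b) j • e j ζ = (c : ℂ) • ∑ j, b j • e j ζ := by
          rw [Finset.smul_sum]
          exact Finset.sum_congr rfl fun j _ => mul_smul (c : ℂ) (b j) (e j ζ)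
        rw [h, map_smul, Complex.coe_smul]
        rfl }
  have hE : ∀ ζ b, L (E ζ b) = ∑ j, b j • e j ζ := fun ζ b => L.apply_symm_apply _
  have huE : ∀ ζ c b, inner ℂ (u c ζ) (L (E ζ b)) = 0 := fun ζ c b => by
    rw [hE, inner_sum]
    refine Finset.sum_eq_zero fun j _ => ?_
    rw [inner_smul_right, horth, mul_zero]
  have hlevel : ∀ ζ b, (conjPairInv N (E ζ b)).1 ∈ tangentLevel Y.k (l.fst ζ) ∧
      (conjPairInv N (E ζ b)).2 ∈ tangentLevel R.hLift (l.snd ζ) := fun ζ b => by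
    refine mem_tangentLevel_of_sympForm fun c => ?_
    rw [conjPair_conjPairInv, ← im_inner_toLp]
    exact congrArg Complex.im (huE ζ c b)
  let β : Disc × ((Fin N → ℂ) × (Fin N → ℂ)) → Fin r → ℂ := fun x j =>
    inner ℂ (e j x.1) (L (conjPair N x.2))
  -- Vectors tangent to the level sets differ from their projections by real combinations of
  -- the tangent vectors of the orbits, as the Gram matrix of the latter is real.
  have hproj : ∀ ζ p, p.1 ∈ tangentLevel Y.k (l.fst ζ) → p.2 ∈ tangentLevel R.hLift (l.snd ζ) →
      ∃ c, p - conjPairInv N (E ζ (β (ζ, p))) = R.orbitPair (l.fst ζ) (l.snd ζ) c := by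
    intro ζ p h1 h2
    set x : V := L (conjPair N p) - L (E ζ (β (ζ, p))) with hx
    have hxu : x ∈ Submodule.span ℂ (Set.range fun c => u c ζ) := by
      rw [← Submodule.orthogonal_orthogonal (Submodule.span ℂ (Set.range fun c => u c ζ)),
        ← (he ζ).2, Submodule.mem_orthogonal]
      intro y hy
      induction hy using Submodule.span_induction with
      | mem y hy =>
        obtain ⟨j, rfl⟩ := hy
        rw [hx, hE, inner_sub_right, (he ζ).1.inner_right_fintype, sub_self]
      | zero => simp
      | add y y' _ _ hy hy' => rw [inner_add_left, hy, hy', add_zero]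
      | smul c y _ hy => rw [inner_smul_left, hy, mul_zero]
    obtain ⟨g, hg⟩ := (Submodule.mem_span_range_iff_exists_fun ℂ).1 hxu
    have him : ∀ c, (inner ℂ (u c ζ) x).im = 0 := fun c => by
      rw [hx, inner_sub_right, huE, sub_zero]
      exact (im_inner_toLp _ _).trans (sympForm_orbitPair h1 h2 _)
    have hreal : ∀ c d, (inner ℂ (u c ζ) (u d ζ)).im = 0 := fun c d =>
      (im_inner_toLp _ _).trans (SympTriv.sympForm_orbitFrame_orbitFrame ζ c d)
    set y : V := ∑ d, ((g d).im : ℂ) • u d ζ with hy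
    have hy0 : ∀ c, inner ℂ (u c ζ) y = 0 := fun c => by
      have h3 := him c
      rw [← hg, inner_sum, Complex.im_sum] at h3
      rw [hy, inner_sum]
      refine Complex.ext ?_ ?_
      · rw [Complex.re_sum, Complex.zero_re, ← h3]
        refine Finset.sum_congr rfl fun d _ => ?_
        rw [inner_smul_right, inner_smul_right, Complex.re_ofReal_mul, Complex.mul_im, hreal,
          mul_zero, zero_add]
      · rw [Complex.im_sum, Complex.zero_im]
        refine Finset.sum_eq_zero fun d _ => ?_
        rw [inner_smul_right, Complex.im_ofReal_mul, hreal, mul_zero]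
    have hyy : y = 0 := by
      rw [← inner_self_eq_zero (𝕜 := ℂ)]
      nth_rewrite 1 [hy]
      rw [sum_inner]
      exact Finset.sum_eq_zero fun d _ => by rw [inner_smul_left, hy0, mul_zero]
    refine ⟨∑ d, (g d).re • Module.finBasis ℝ (Y.k × R.hLift) d, conjPair_injective
      (L.injective ?_)⟩
    rw [map_sub, conjPair_conjPairInv, map_sub, ← hx, ← hg, map_sum, map_sum, map_sum]
    have h4 : ∀ d, g d • u d ζ = ((g d).re : ℂ) • u d ζ + Complex.I • ((g d).im : ℂ) • u d ζ :=
      fun d => by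
        rw [smul_smul, ← add_smul]
        congr 1
        rw [mul_comm]
        exact (Complex.re_add_im _).symm
    simp_rw [h4]
    rw [Finset.sum_add_distrib, ← Finset.smul_sum, ← hy, hyy, smul_zero, add_zero]
    refine Finset.sum_congr rfl fun d _ => ?_
    rw [map_smul, map_smul, Complex.coe_smul]
    rfl
  have hinvc : Continuous (conjPairInv N) := LinearMap.continuous_of_finiteDimensional _
  refine ⟨{ r := r
            map := fun ζ => conjPairInv N ∘ₗ E ζ
            continuous_map := fun b => hinvc.comp (L.symm.continuous.comp (by fun_prop))
            mem_fst := fun ζ b => (hlevel ζ b).1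
            mem_snd := fun ζ b => (hlevel ζ b).2
            symp := fun ζ b b' => ?_
            surj := fun ζ ξ hξ ξ' hξ' => ?_ }, β, ?_, hproj⟩
  · rw [stdSymp_eq, stdSymp_eq, stdSymp_eq, ← sympForm_conjPair]
    simp only [LinearMap.comp_apply, conjPair_conjPairInv]
    rw [← im_inner_toLp, ← hL, ← hL, hE, hE, (he ζ).1.inner_sum, Complex.im_sum]
    rfl
  · obtain ⟨c, hc⟩ := hproj ζ (ξ, ξ') hξ hξ'
    refine ⟨β (ζ, (ξ, ξ')), mem_tangentOrbit_iff.2 ⟨c.1, ?_⟩, mem_tangentOrbit_iff.2 ⟨c.2, ?_⟩⟩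
    · exact (congrArg Prod.fst hc).symm
    · exact (congrArg Prod.snd hc).symm
  · refine continuous_pi fun j => ?_
    have h1 : Continuous fun x : Disc × ((Fin N → ℂ) × (Fin N → ℂ)) => L (conjPair N x.2) :=
      L.continuous.comp (SympTriv.continuous_conjPair.comp continuous_snd)
    have h2 : Continuous fun x : Disc × ((Fin N → ℂ) × (Fin N → ℂ)) => e j x.1 := by fun_prop
    exact h2.inner h1

end ToricReduction

/-! ### Existence of framings -/

namespace ToricReduction
variable {N : ℕ} {Y : ToricManifold N} {R : ToricReduction Y}

/-- The map `(κ, θ) ↦ i κ z + θ z`. For the real inner product on `ℂ^N`, a vector orthogonal to its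
image is tangent to the level set of `μ`, and orthogonal to the `K`-orbit of `z`. -/
def normalMap (R : ToricReduction Y) (z : Fin N → ℂ) :
    (Y.k × R.hLift) →ₗ[ℝ] EuclideanSpace ℂ (Fin N) where
  toFun x := WithLp.toLp 2 fun j => ((x.2.1 j : ℂ) + Complex.I * x.1.1 j) * z j
  map_add' x y := by ext j; simp; ring
  map_smul' c x := by ext j; simp; ring

theorem normalMap_apply (z : Fin N → ℂ) (x : Y.k × R.hLift) (j : Fin N) :
    R.normalMap z x j = ((x.2.1 j : ℂ) + Complex.I * x.1.1 j) * z j := rfl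

theorem normalMap_injective {z : Fin N → ℂ} (hz : FreeAt R.hLift z) :
    Function.Injective (R.normalMap z) := by
  rw [← LinearMap.ker_eq_bot, LinearMap.ker_eq_bot']
  rintro ⟨κ, θ⟩ h
  have h1 : ∀ j, (θ.1 j = 0 ∧ κ.1 j = 0) ∨ z j = 0 := fun j => by
    have h2 : ((θ.1 j : ℂ) + Complex.I * κ.1 j) * z j = 0 := congrArg (fun v => v j) h
    refine (mul_eq_zero.1 h2).imp_left fun h3 => ⟨?_, ?_⟩
    · simpa using congrArg Complex.re h3
    · simpa using congrArg Complex.im h3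
  refine Prod.ext (Subtype.ext (hz.eq_zero (R.k_le_hLift κ.2) fun j => ?_))
    (Subtype.ext (hz.eq_zero θ.2 fun j => ?_))
  · rcases h1 j with h | h <;> simp [h]
  · rcases h1 j with h | h <;> simp [h]

theorem mem_tangentLevel_of_inner {z : Fin N → ℂ} {η : EuclideanSpace ℂ (Fin N)}
    (h : ∀ x, inner ℝ (R.normalMap z x) η = 0) : η.ofLp ∈ tangentLevel R.hLift z := by
  intro θ hθ
  rw [← h (0, ⟨θ, hθ⟩), PiLp.inner_apply]
  refine Finset.sum_congr rfl fun j _ => ?_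
  rw [normalMap_apply, Complex.inner]
  simp
  ring

theorem eq_zero_of_inner_of_eq_orbitMap {z : Fin N → ℂ} {η : EuclideanSpace ℂ (Fin N)}
    (h : ∀ x, inner ℝ (R.normalMap z x) η = 0) {κ : Y.k} (hκ : η.ofLp = orbitMap Y.k z κ) :
    η = 0 := by
  have h1 : R.normalMap z (κ, 0) = η := by
    ext j
    rw [normalMap_apply, hκ, orbitMap_apply]
    simp
  have h2 := h (κ, 0)
  rwa [h1, inner_self_eq_zero] at h2

/-- A framing for the trivialization by a unitary frame. An orthonormal frame of the orthogonal
complement of `normalMap` spans the space of vectors tangent to `μ⁻¹(c)`; its vectors `η` are mapped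
to the coordinates of `(η, t η)` in the trivialization. -/
theorem exists_lagFraming {w : C(Disc, Y.Space × R.Space)} (hw : R.IsBounded w)
    (l : R.DiscLift w) : ∃ Φ : R.SympTriv l, Nonempty (R.LagFraming Φ) := by
  obtain ⟨Φ, β, hβc, hβ⟩ := R.exists_sympTriv l
  obtain ⟨φ, hφ⟩ := exists_isTransition hw l
  refine ⟨Φ, ?_⟩
  have hb : Continuous fun τ : I => bdryPoint τ :=
    continuous_bdryPoint.comp continuous_subtype_val
  let z : I → Fin N → ℂ := fun τ => l.fst (bdryPoint τ)
  let t : I → StdTorus N := fun τ => torusExp (φ τ)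
  have hzc : Continuous z := l.fst.continuous.comp hb
  have htc : Continuous t := by
    refine continuous_pi fun j => ?_
    simp only [t, torusExp]
    fun_prop
  have hz : ∀ τ, FreeAt R.hLift (z τ) := fun τ =>
    (represents_of_mem_lag (hw _ (norm_bdryPoint _)) (l.fst_rep _)).freeAt
  let bs := Module.finBasis ℝ (Y.k × R.hLift)
  let u : Fin (Module.finrank ℝ (Y.k × R.hLift)) → C(I, EuclideanSpace ℂ (Fin N)) := fun c =>
    ⟨fun τ => R.normalMap (z τ) (bs c), by
      refine (PiLp.continuous_toLp 2 _).comp (continuous_pi fun j => ?_)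
      fun_prop⟩
  have hu : ∀ τ, LinearIndependent ℝ fun c => u c τ := fun τ =>
    bs.linearIndependent.map' (R.normalMap (z τ))
      (LinearMap.ker_eq_bot.2 (normalMap_injective (hz τ)))
  have hV : Module.finrank ℝ (EuclideanSpace ℂ (Fin N)) = 2 * N := by
    rw [finrank_real_of_complex, finrank_euclideanSpace, Fintype.card_fin]
  obtain ⟨e, he⟩ := exists_orthonormal_frame (d := Φ.r) u hu (by
    rw [hV, ← Φ.r_add_finrank, add_comm])
  have horth : ∀ τ, ∀ v ∈ Submodule.span ℝ (Set.range fun j => e j τ), ∀ x,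
      inner ℝ (R.normalMap (z τ) x) v = 0 := by
    intro τ v hv x
    rw [(he τ).2] at hv
    refine Submodule.inner_right_of_mem_orthogonal (K := Submodule.span ℝ
      (Set.range fun c => u c τ)) ?_ hv
    have hx : x ∈ Submodule.span ℝ (Set.range bs) := by rw [bs.span_eq]; trivial
    have h1 := Submodule.mem_map_of_mem (f := R.normalMap (z τ)) hx
    rwa [Submodule.map_span, ← Set.range_comp] at h1
  have hmem : ∀ τ j, e j τ ∈ Submodule.span ℝ (Set.range fun j => e j τ) := fun τ j =>
    Submodule.subset_span ⟨j, rfl⟩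
  have hlev : ∀ τ j, (e j τ).ofLp ∈ tangentLevel R.hLift (z τ) := fun τ j =>
    mem_tangentLevel_of_inner (horth τ _ (hmem τ j))
  let p : I → Fin Φ.r → (Fin N → ℂ) × (Fin N → ℂ) := fun τ j =>
    ((e j τ).ofLp, rotate (t τ) (e j τ).ofLp)
  let A : I → Fin Φ.r → Fin Φ.r → ℂ := fun τ j => β (bdryPoint τ, p τ j)
  have hAc : Continuous A := by
    refine continuous_pi fun j => hβc.comp (hb.prodMk ?_)
    have h1 : Continuous fun τ => (e j τ).ofLp := (PiLp.continuous_ofLp 2 _).comp (e j).continuous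
    refine h1.prodMk (continuous_pi fun m => ?_)
    simp only [rotate]
    have h2 : Continuous fun τ => (e j τ).ofLp m := (continuous_apply m).comp h1
    fun_prop
  have hA : ∀ (τ : I) j, ∃ c, p τ j - Φ.map (bdryPoint τ) (A τ j) =
      R.orbitPair (z τ) (rotate (t τ) (z τ)) c := fun τ j => by
    have h1 := hβ (bdryPoint τ) (p τ j) (tangentLevel_anti R.k_le_hLift _ (hlev τ j))
      (by rw [(hφ τ).2]; exact rotate_mem_tangentLevel (hlev τ j))
    rw [(hφ τ).2] at h1
    exact h1
  have hrow : ∀ (τ : I) j, A τ j ∈ Φ.lagSubmodule (bdryPoint τ) (z τ) (t τ) := fun τ j => by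
    obtain ⟨c, hc⟩ := hA τ j
    have h1 : p τ j ∈ LinearMap.range (R.lagMap (z τ) (t τ)) :=
      ⟨(⟨_, mem_levelSubmodule_iff.2 (hlev τ j)⟩, 0), by
        rw [lagMap_apply, map_zero, add_zero]⟩
    have h2 : Φ.map (bdryPoint τ) (A τ j) = p τ j -
        R.orbitPair (z τ) (rotate (t τ) (z τ)) c := by rw [← hc, sub_sub_cancel]
    change Φ.map (bdryPoint τ) (A τ j) ∈ LinearMap.range (R.lagMap (z τ) (t τ))
    rw [h2]
    exact Submodule.sub_mem _ h1 (orbitPair_mem_lag c)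
  have hind : ∀ τ, LinearIndependent ℝ (A τ) := fun τ => by
    rw [Fintype.linearIndependent_iff]
    intro g hg
    choose c hc using hA τ
    let v : EuclideanSpace ℂ (Fin N) := ∑ j, g j • e j τ
    have h1 : ∑ j, g j • p τ j = R.orbitPair (z τ) (rotate (t τ) (z τ)) (∑ j, g j • c j) := by
      have h2 : ∑ j, g j • Φ.map (bdryPoint τ) (A τ j) = 0 := by
        rw [← map_zero (Φ.map (bdryPoint τ)), ← hg, map_sum]
        simp only [map_smul]
      rw [map_sum]
      simp only [map_smul, ← hc, smul_sub, Finset.sum_sub_distrib, h2, sub_zero]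
    have h3 : v.ofLp = orbitMap Y.k (z τ) (∑ j, g j • c j).1 := by
      have h4 := congrArg Prod.fst h1
      rw [Prod.fst_sum] at h4
      rw [WithLp.ofLp_sum]
      exact h4
    have hv : v = 0 := eq_zero_of_inner_of_eq_orbitMap
      (horth τ v (Submodule.sum_mem _ fun j _ => Submodule.smul_mem _ _ (hmem τ j))) h3
    exact Fintype.linearIndependent_iff.1 (he τ).1.linearIndependent g hv
  have hspan : ∀ τ : I, Submodule.span ℝ (Set.range (A τ)) =
      Φ.lagSubmodule (bdryPoint τ) (z τ) (t τ) := fun τ => by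
    refine Submodule.eq_of_le_of_finrank_eq (Submodule.span_le.2 ?_) ?_
    · rintro _ ⟨j, rfl⟩
      exact hrow τ j
    · rw [finrank_span_eq_card (hind τ), Φ.finrank_lagSubmodule _ (hz τ) (hφ τ).2,
        Fintype.card_fin]
  have hdet : ∀ τ, (Matrix.of (A τ)).det ≠ 0 := fun τ h => by
    have h1 := Φ.frameDet_deformedFrame_ne_zero (bdryPoint τ) (p := 1 / 2) (q := 1 / 2)
      (by norm_num) (by norm_num) (by norm_num) (Φ.sympForm_frame (hspan τ)) (hind τ)
    refine h1 ((Φ.deformedFrame_complex (bdryPoint τ) (Matrix.of (A τ))).trans ?_)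
    rw [h, zero_mul]
  have hMc : Continuous fun τ => Matrix.of (A τ) := hAc
  obtain ⟨θ, hθ⟩ := exists_continuous_turns
    (⟨fun τ => (Matrix.of (A τ)).det ^ 2, hMc.matrix_det.pow 2⟩ : C(I, ℂ))
    fun τ => pow_ne_zero 2 (hdet τ)
  exact ⟨{
    frame := fun τ => Matrix.of (A τ)
    continuous_frame := hMc
    span_frame := fun τ b => by
      rw [(hφ τ).2, mem_lagTangent_iff (hφ τ).1 (hz τ)]
      change b ∈ Submodule.span ℝ (Set.range (A τ)) ↔ _
      rw [hspan τ]
      rfl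
    arg := θ
    arg_spec := hθ }⟩

theorem exists_discLift (w : C(Disc, Y.Space × R.Space)) : Nonempty (R.DiscLift w) := by
  obtain ⟨Z, Z', h⟩ := R.exists_lift_pair w
  exact ⟨⟨Z, Z', fun ζ => (h ζ).1, fun ζ => (h ζ).2⟩⟩

/-- The Maslov index is twice the total winding of a transition path. -/
theorem isMaslovIndex_of_winding {w w' : C(Disc, Y.Space × R.Space)}
    (hww' : w.HomotopicWith w' R.IsBounded) {l : R.DiscLift w} {φ : C(I, Fin N → ℝ)}
    (hφ : IsTransition l φ) {n : Fin N → ℤ} (hn : ∀ j, (φ 1 - φ 0) j = n j) :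
    R.IsMaslovIndex w' (2 * ∑ j, n j) := by
  have hw' : R.IsBounded w' := by
    obtain ⟨F⟩ := hww'
    intro ζ hζ
    have := F.prop 1 ζ hζ
    simpa using this
  refine ⟨?_, fun l' Φ F => ?_⟩
  · obtain ⟨l'⟩ := R.exists_discLift w'
    exact ⟨l', R.exists_lagFraming hw' l'⟩
  · obtain ⟨φ', hφ'⟩ := exists_isTransition hw' l'
    rw [F.arg_sub_eq hw' hφ', ← hφ.sub_eq_of_homotopic hww' hφ']
    simp only [hn]
    push_cast
    rfl

end ToricReduction

theorem mainTheorem12 {N : ℕ} (Y : ToricManifold N) (R : ToricReduction Y)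
    (J : Finset (Fin N)) (hB : (Y.stratum J ∩ R.Level).Nonempty)
    (i : Fin N) (hi : i ∉ J) (hD : (closure (Y.stratum J) ∩ Y.divisor i).Nonempty)
    (w : C(Disc, Y.Space × R.Space)) (hw : w ∈ R.basicClass J i) :
    (∃! p : Y.Lie × (Fin N → ℤ), R.IsNormalVector J i p.1 p.2) ∧
    ∀ (v : Y.Lie) (n : Fin N → ℤ), R.IsNormalVector J i v n →
      R.IsMaslovIndex w (2 * ∑ j, n j) := by
  obtain ⟨u, x, hu, hb, hom⟩ := hw
  obtain ⟨l, φ, n, hφ, hn, hni, hsupp, hzJ, hzJ'⟩ :=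
    ToricReduction.exists_winding_of_isBasicDisc hi hu hb
  have hmem : (fun j => (n j : ℝ)) ∈ R.hLift := by
    have h := sub_mem_of_torusExp_mem R.hLift_rational φ fun τ => (hφ τ).1
    rwa [funext hn] at h
  have huniq : ∀ v n', R.IsNormalVector J i v n' → n' = n := fun v n' h =>
    h.eq_of_apply_eq_one hmem hni hsupp
      (ToricReduction.represents_of_mem_lag (hb _ (norm_bdryPoint 0)) (l.fst_rep _)).freeAt hzJ
  refine ⟨⟨(∑ j, n j • Y.v j, n), ?_, ?_⟩, fun v n' h => ?_⟩
  · exact ToricReduction.isNormalVector_of_apply_eq_one hmem hni hsupp (l.fst_rep _).freeAt hzJ'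
  · rintro ⟨v, n'⟩ h
    have e := huniq v n' h
    subst e
    exact Prod.ext h.expansion rfl
  · rw [huniq v n' h]
    exact ToricReduction.isMaslovIndex_of_winding hom hφ hn

end
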